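/- Fix $k$ and a symmetric real $k\times k$ matrix $Q^*$. There is a constant $C_{Q^*}>0$, depending only on $Q^*$, such that the following holds. Let $\mathcal A$ be a set of probability vectors on $[k]$, let $\mathcal Q$ be a set of symmetric $k\times k$ matrices, and let $\alpha^*$ be a probability vector on $[k]$, such that * (A.1) for some $c>0$ all coordinates of all $\alpha\in\mathcal A$ lie in $[c,1-c]$, and all entries of all $Q\in\mathcal Q$ lie in a common compact interval contained in $(0,1)$; * (A.2) $\alpha^*$ and $Q^*$ lie in the interior of $\mathcal A$ and $\mathcal Q$ (relative to the probability simplex and to the space of symmetric matrices, respectively); * (A.3) the coordinates of the row vector $\alpha^*Q^*$ are pairwise distinct. Let $p=p_n\in[0,1]$ satisfy $\log(n)/n=o(p_n)$. For each $n$ let the labels $z^*(1),\dots,z^*(n)\in[k]$ be i.i.d. with law $\alpha^*$; given $z^*$, let $A_{ij}$, $1\le i<j\le n$, be independent Bernoulli variables with parameters $Q^*_{z^*(i)z^*(j)}$; and let $X_{ij}$, $1\le i<j\le n$, be i.i.d. Bernoulli$(p_n)$ variables independent of $(z^*,A)$ ($X_{ij}=1$ means that $A_{ij}$ is observed). Extend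 $A$ and $X$ to symmetric matrices with zero diagonal, and let $\Theta^*_{ij}=Q^*_{z^*(i)z^*(j)}$ for $i\ne j$ and $\Theta^*_{ii}=0$. Put $$\mathcal L_X(A;z,Q)=\sum_{i<j}X_{ij}\bigl(A_{ij}\log Q_{z(i)z(j)}+(1-A_{ij})\log(1-Q_{z(i)z(j)})\bigr),$$ $$l_X(A;\alpha,Q)=\sum_{z:[n]\to[k]}\Bigl(\prod_{i}\alpha_{z(i)}\Bigr)e^{\mathcal L_X(A;z,Q)} .$$ The maximum likelihood estimator $(\widehat Q,\widehat z)$ is any maximizer of $\mathcal L_X(A;z,Q)$ over $Q\in\mathcal Q$ and $z:[n]\to[k]$. The variational estimator $(\widehat\alpha^{VAR},\widehat Q^{VAR},\widehat\tau^{VAR})$ is any maximizer, over $\alpha\in\mathcal A$, $Q\in\mathcal Q$ and $n$-tuples $\tau=(\tau^1,\dots,\tau^n)$ of probability vectors on $[k]$, of $$\mathcal J_X(A;\tau,\alpha,Q)=\log l_X(A;\alpha,Q)-KL\bigl(\mathbb P_\tau\,\|\,\mathbb P(\cdot\mid X\odot A,\alpha,Q)\bigr),$$ where $\mathbb P_\tau(z)=\prod_i\tau^i_{z(i)}$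 and $\mathbb P(z\mid X\odot A,\alpha,Q)=\bigl(\prod_i\alpha_{z(i)}\bigr)e^{\mathcal L_X(A;z,Q)}/l_X(A;\alpha,Q)$. Let $\widehat z^{VAR}(i)$ be any maximizer of $a\mapsto(\widehat\tau^{VAR})^i_a$, let $\widehat Q^{ML-VAR}_{ab}$ be the average of $A_{ij}$ over the observed pairs of distinct nodes with $\widehat z^{VAR}(i)=a$, $\widehat z^{VAR}(j)=b$ (and, by convention, $0$ if there are none), and let $\widehat\Theta^{VAR}_{ij}=\widehat Q^{ML-VAR}_{\widehat z^{VAR}(i)\,\widehat z^{VAR}(j)}$ for $i\neq j$ and $\widehat\Theta^{VAR}_{ii}=0$. Then, as $n\to\infty$, with probability tending to $1$ both estimators exist and, for every choice of the maximizers, $\widehat z^{VAR}=\sigma\circ\widehat z$ for some permutation $\sigma$ of $[k]$. Moreover $$\mathbb P\left(\|\Theta^*-\widehat\Theta^{VAR}\|_2^2\le\frac{C_{Q^*}\,(k^2+n\log k)}{p_n}\text{ for every choice of the maximizers}\right)\longrightarrow1,$$ where $\|\cdot\|_2$ is the Frobenius norm. -/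

import Mathlib

open Filter Topology MeasureTheory

namespace SBM

noncomputable section

/-! ### Parameters, data and sampling model -/

/-- Probability vectors `α` on the communities `[k]`. -/
abbrev Simplex (k : ℕ) : Type := stdSimplex ℝ (Fin k)

/-- Real symmetric `k × k` matrices, with the topology inherited from `ℝ^(k × k)`. -/
abbrev SymMat (k : ℕ) : Type := {Q : Matrix (Fin k) (Fin k) ℝ // Q.IsSymm}

/-- Label functions `z : [n] → [k]`. -/
abbrev Labels (n k : ℕ) : Type := Fin n → Fin k

/-- Pairs of nodes `(i, j)` with `i < j`. -/
abbrev Pair (n : ℕ) : Type := {e : Fin n × Fin n // e.1 < e.2}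

/-- A symmetric `n × n` matrix with entries in `{0, 1}` and zero diagonal, given by its entries
`(i, j)` with `i < j`. It serves for the adjacency matrix `A` and for the sampling matrix `X`. -/
abbrev PairMat (n : ℕ) : Type := Pair n → Bool

/-- The numerical value `0` or `1` of an entry. -/
def val (b : Bool) : ℝ := if b then 1 else 0

/-- The Bernoulli distribution of parameter `q ∈ [0, 1]`. -/
def bernoulliLaw (q : ℝ) : Measure Bool :=
  ENNReal.ofReal q • Measure.dirac true + ENNReal.ofReal (1 - q) • Measure.dirac false

/-- The multinomial distribution `M(1; α)` of one label. -/
def multinomial {k : ℕ} (α : Simplex k) : Measure (Fin k) :=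
  ∑ a, ENNReal.ofReal (α.1 a) • Measure.dirac a

/-- The joint law of `(z, A, X)`: the labels are i.i.d. of law `M(1; α)`; given the labels `z`, the
entries `A i j` (`i < j`) are independent Bernoulli variables of parameter `Q (z i) (z j)`, and
independently of `(z, A)` the entries `X i j` (`i < j`) are i.i.d. Bernoulli variables of
parameter `p`. -/
def law (n : ℕ) {k : ℕ} (α : Simplex k) (Q : SymMat k) (p : ℝ) :
    Measure (Labels n k × PairMat n × PairMat n) :=
  (Measure.pi fun _ : Fin n => multinomial α).bind fun z =>
    (Measure.dirac z).prod
      ((Measure.pi fun e : Pair n => bernoulliLaw (Q.1 (z e.1.1) (z e.1.2))).prod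
        (Measure.pi fun _ : Pair n => bernoulliLaw p))

/-! ### Likelihoods and the maximum likelihood estimator -/

/-- The log-likelihood `𝓛_X(A; z, Q)` of the observed entries, given the labels `z`. -/
def logLik {n k : ℕ} (A X : PairMat n) (z : Labels n k) (Q : SymMat k) : ℝ :=
  ∑ e : Pair n, val (X e) *
    (val (A e) * Real.log (Q.1 (z e.1.1) (z e.1.2)) +
      (1 - val (A e)) * Real.log (1 - Q.1 (z e.1.1) (z e.1.2)))

/-- `(Q, z)` is a maximum likelihood estimate: it maximizes `𝓛_X(A; ·, ·)` over `𝒬` and all the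
label functions. -/
def IsMLE {n k : ℕ} (𝒬 : Set (SymMat k)) (A X : PairMat n) (Q : SymMat k) (z : Labels n k) :
    Prop :=
  Q ∈ 𝒬 ∧ ∀ Q' ∈ 𝒬, ∀ z' : Labels n k, logLik A X z' Q' ≤ logLik A X z Q

/-- The term `(∏ᵢ α_{z(i)}) exp 𝓛_X(A; z, Q)` of the label function `z` in the likelihood. -/
def jointLik {n k : ℕ} (A X : PairMat n) (z : Labels n k) (α : Simplex k) (Q : SymMat k) : ℝ :=
  (∏ i, α.1 (z i)) * Real.exp (logLik A X z Q)

/-- The likelihood `l_X(A; α, Q)` of the model with random labels. -/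
def lik {n k : ℕ} (A X : PairMat n) (α : Simplex k) (Q : SymMat k) : ℝ :=
  ∑ z : Labels n k, jointLik A X z α Q

/-- The posterior probability of the label function `z` given the observed entries of `A`. -/
def posterior {n k : ℕ} (A X : PairMat n) (α : Simplex k) (Q : SymMat k) (z : Labels n k) : ℝ :=
  jointLik A X z α Q / lik A X α Q

/-! ### The variational estimator -/

/-- The product distribution `ℙ_τ` on label functions. -/
def prodProb {n k : ℕ} (τ : Fin n → Simplex k) (z : Labels n k) : ℝ := ∏ i, (τ i).1 (z i)

/-- The Kullback-Leibler divergence `KL(P ‖ R)` of two probability mass functions on a finite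
type, where `R` has full support (with the usual convention `0 log 0 = 0`). -/
def KL {Z : Type*} [Fintype Z] (P R : Z → ℝ) : ℝ := ∑ z, P z * Real.log (P z / R z)

/-- The variational objective `𝓙_X(A; τ, α, Q)`. -/
def objective {n k : ℕ} (A X : PairMat n) (τ : Fin n → Simplex k) (α : Simplex k)
    (Q : SymMat k) : ℝ :=
  Real.log (lik A X α Q) - KL (prodProb τ) (posterior A X α Q)

/-- `(α, Q, τ)` is a variational estimate: it maximizes `𝓙_X` over `α ∈ 𝒜`, `Q ∈ 𝒬` and all
`n`-tuples `τ` of probability vectors. -/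
def IsVarEstimate {n k : ℕ} (𝒜 : Set (Simplex k)) (𝒬 : Set (SymMat k)) (A X : PairMat n)
    (α : Simplex k) (Q : SymMat k) (τ : Fin n → Simplex k) : Prop :=
  α ∈ 𝒜 ∧ Q ∈ 𝒬 ∧ ∀ α' ∈ 𝒜, ∀ Q' ∈ 𝒬, ∀ τ' : Fin n → Simplex k,
    objective A X τ' α' Q' ≤ objective A X τ α Q

/-- `z` is a variational label estimate `ẑ^VAR`: for some variational estimate `(α, Q, τ)`, the
label `z i` maximizes `a ↦ τ i a` for each `i`. -/
def IsVarLabels {n k : ℕ} (𝒜 : Set (Simplex k)) (𝒬 : Set (SymMat k)) (A X : PairMat n)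
    (z : Labels n k) : Prop :=
  ∃ (α : Simplex k) (Q : SymMat k) (τ : Fin n → Simplex k), IsVarEstimate 𝒜 𝒬 A X α Q τ ∧
    ∀ i a, (τ i).1 a ≤ (τ i).1 (z i)

/-- `z ∼ z'`: the label functions agree up to a permutation of the communities. -/
def LabelEquiv {n k : ℕ} (z z' : Labels n k) : Prop :=
  ∃ σ : Equiv.Perm (Fin k), ∀ i, z i = σ (z' i)

/-! ### The plug-in estimator of the connection probabilities -/

/-- The pairs of nodes with one node in the community `a` and the other one in `b`. -/
def block {n k : ℕ} (z : Labels n k) (a b : Fin k) : Finset (Pair n) :=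
  {e | (z e.1.1 = a ∧ z e.1.2 = b) ∨ (z e.1.1 = b ∧ z e.1.2 = a)}

/-- The mean of the observed entries of `A` between the communities `a` and `b` of `z`. -/
def blockMean {n k : ℕ} (A X : PairMat n) (z : Labels n k) : Matrix (Fin k) (Fin k) ℝ :=
  fun a b => (∑ e ∈ block z a b, val (X e) * val (A e)) / ∑ e ∈ block z a b, val (X e)

/-- The `n × n` matrix with entries `Q (z i) (z j)` off the diagonal and zero diagonal. -/
def connection {n k : ℕ} (Q : Matrix (Fin k) (Fin k) ℝ) (z : Labels n k) :
    Matrix (Fin n) (Fin n) ℝ :=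
  fun i j => if i = j then 0 else Q (z i) (z j)

/-- The squared Frobenius norm. -/
def frobSq {n : ℕ} (M : Matrix (Fin n) (Fin n) ℝ) : ℝ := ∑ i, ∑ j, M i j ^ 2

/-! ### Assumptions on the parameter spaces and on the true parameters -/

/-- The entries of the elements of `𝒜` lie in some `[c, 1 - c]` with `c > 0`, and the entries of
the elements of `𝒬` lie in some compact interval contained in `(0, 1)`. -/
def Bounded {k : ℕ} (𝒜 : Set (Simplex k)) (𝒬 : Set (SymMat k)) : Prop :=
  (∃ c : ℝ, 0 < c ∧ ∀ α ∈ 𝒜, ∀ a, α.1 a ∈ Set.Icc c (1 - c)) ∧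
    ∃ l u : ℝ, 0 < l ∧ u < 1 ∧ ∀ Q ∈ 𝒬, ∀ a b, Q.1 a b ∈ Set.Icc l u

/-- The true parameters lie in the interior of the parameter spaces, relative to the simplex and
to the space of symmetric matrices respectively. -/
def IsInterior {k : ℕ} (𝒜 : Set (Simplex k)) (𝒬 : Set (SymMat k)) (α : Simplex k)
    (Q : SymMat k) : Prop :=
  α ∈ interior 𝒜 ∧ Q ∈ interior 𝒬

/-- The coordinates of the row vector `α Q` are pairwise distinct. -/
def DistinctCoords {k : ℕ} (α : Simplex k) (Q : SymMat k) : Prop :=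
  Function.Injective (Matrix.vecMul α.1 Q.1)

end

end SBM

open Filter Topology MeasureTheory

namespace SBM

noncomputable section

/-! ### Concentration of sums over a finite product space -/

/-! The randomness is confined to one event, `GoodEvent`. On it the community frequencies are close
to `α`, the noise sums at the true labels are at most `t`, and replacing the true labels `zs` by any
`z` changes a noise sum by at most `ε n p` times the number of mismatched nodes. The last bound is a
union bound over all `kⁿ` labellings. It is affordable because the threshold grows with the
mismatch: the failure probabilities add up to about `(1 + k e^{-s})ⁿ - 1` with `s` of order `n p`,
which vanishes because `log n = o(n p)`.

The rest is deterministic. The variational objective is the mean log-likelihood under the product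
law `τ`, plus a prior and entropy term (`objective_eq`). Hard labels are degenerate weights, so one
analysis of soft weights serves both estimators, and a noise bound for hard labels passes to soft
weights by averaging (`abs_sum_pairWt_sub_le`).

Two estimates give recovery (`exists_separation`). Globally, a likelihood within `O(n)` of its value
at the truth forces the fitted connection probabilities to be close to the true ones in mean square.
Since the rows of `Q*` are distinct, this determines the communities up to a permutation, with few
errors (`exists_perm_of_sum_sqDiff_le`). Locally, once `Q` is close to `Q*` after relabelling, each
mismatched unit of weight costs at least a constant times `n p` in log-likelihood. Hence the maximum
likelihood labels are exactly a relabelling of the true ones. For the variational estimator the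
entropy gain is of smaller order, so the total misplaced weight is below `1/2` and the most likely
labels are again exact.

Existence needs an argument because `𝒜` and `𝒬` need not be closed. Maximizers exist over compact
boxes containing them. The same separation places these maximizers, once relabelled and with `α`
replaced by the mean of the `τ i`, within a small radius of the true parameters, hence inside `𝒜`
and `𝒬`.

With the labels known up to permutation, the plug-in matrix consists of block averages at the true
communities. Their error is of order `(n p)^{-1/2}`, so the squared Frobenius error is at most `n /
(4 p)`. This is below `n log k / p` because `k ≥ 2`, and the constant `1` suffices. -/

lemma integral_exp_mul_le {β : Type*} [Finite β] [MeasurableSpace β] [MeasurableSingletonClass β]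
    (μ : Measure β) [IsProbabilityMeasure μ] {f : β → ℝ} {lam v : ℝ}
    (hlam : 0 ≤ lam) (hlam' : lam ≤ 1) (hf : ∀ x, |f x| ≤ 1) (h0 : ∫ x, f x ∂μ = 0)
    (hv : ∫ x, f x ^ 2 ∂μ ≤ v) :
    ∫ x, Real.exp (lam * f x) ∂μ ≤ Real.exp (lam ^ 2 * v) := by
  have hle : ∀ x, Real.exp (lam * f x) ≤ 1 + lam * f x + lam ^ 2 * f x ^ 2 := by
    intro x
    have h1 : |lam * f x| ≤ 1 := by
      rw [abs_mul, abs_of_nonneg hlam]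
      exact mul_le_one₀ hlam' (abs_nonneg _) (hf x)
    have h2 := (abs_le.1 (Real.abs_exp_sub_one_sub_id_le h1)).2
    rw [mul_pow] at h2
    linarith
  calc ∫ x, Real.exp (lam * f x) ∂μ
      ≤ ∫ x, (1 + lam * f x + lam ^ 2 * f x ^ 2) ∂μ :=
        integral_mono Integrable.of_finite Integrable.of_finite hle
    _ = 1 + lam ^ 2 * ∫ x, f x ^ 2 ∂μ := by
        rw [integral_add Integrable.of_finite Integrable.of_finite,
          integral_add Integrable.of_finite Integrable.of_finite, integral_const_mul,
          integral_const_mul, h0]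
        simp
    _ ≤ 1 + lam ^ 2 * v := by gcongr
    _ ≤ Real.exp (lam ^ 2 * v) := by linarith [Real.add_one_le_exp (lam ^ 2 * v)]

/-- Chernoff's method with a variance proxy, in Bernstein form. The slope `lam` stays free in `[0,
1]` because each application tunes it differently. -/
lemma pi_tail {ι β : Type*} [Fintype ι] [Finite β] [MeasurableSpace β]
    [MeasurableSingletonClass β] (μ : ι → Measure β) [∀ i, IsProbabilityMeasure (μ i)]
    {f : ι → β → ℝ} {v : ι → ℝ} {lam : ℝ} (t : ℝ)
    (hlam : 0 ≤ lam) (hlam' : lam ≤ 1) (hf : ∀ i x, |f i x| ≤ 1)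
    (h0 : ∀ i, ∫ x, f i x ∂(μ i) = 0) (hv : ∀ i, ∫ x, f i x ^ 2 ∂(μ i) ≤ v i) :
    (Measure.pi μ) {x | t ≤ ∑ i, f i (x i)} ≤
      ENNReal.ofReal (Real.exp (-lam * t + lam ^ 2 * ∑ i, v i)) := by
  have h1 := ProbabilityTheory.measure_ge_le_exp_mul_mgf (μ := Measure.pi μ)
    (X := fun x => ∑ i, f i (x i)) (t := lam) t hlam Integrable.of_finite
  have h2 : ProbabilityTheory.mgf (fun x : ι → β => ∑ i, f i (x i)) (Measure.pi μ) lam ≤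
      Real.exp (lam ^ 2 * ∑ i, v i) := by
    rw [ProbabilityTheory.mgf]
    simp only [Finset.mul_sum, Real.exp_sum]
    rw [integral_fintype_prod_eq_prod (f := fun i x => Real.exp (lam * f i x))]
    exact Finset.prod_le_prod (fun i _ => integral_nonneg fun x => (Real.exp_pos _).le)
      fun i _ => integral_exp_mul_le (μ i) hlam hlam' (hf i) (h0 i) (hv i)
  rw [← ofReal_measureReal]
  apply ENNReal.ofReal_le_ofReal
  refine h1.trans ?_
  rw [Real.exp_add]
  gcongr

lemma pi_abs_tail {ι β : Type*} [Fintype ι] [Finite β] [MeasurableSpace β]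
    [MeasurableSingletonClass β] (μ : ι → Measure β) [∀ i, IsProbabilityMeasure (μ i)]
    {f : ι → β → ℝ} {v : ι → ℝ} {lam : ℝ} (t : ℝ)
    (hlam : 0 ≤ lam) (hlam' : lam ≤ 1) (hf : ∀ i x, |f i x| ≤ 1)
    (h0 : ∀ i, ∫ x, f i x ∂(μ i) = 0) (hv : ∀ i, ∫ x, f i x ^ 2 ∂(μ i) ≤ v i) :
    (Measure.pi μ) {x | t ≤ |∑ i, f i (x i)|} ≤
      2 * ENNReal.ofReal (Real.exp (-lam * t + lam ^ 2 * ∑ i, v i)) := by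
  have hsub : {x : ι → β | t ≤ |∑ i, f i (x i)|} ⊆
      {x | t ≤ ∑ i, f i (x i)} ∪ {x | t ≤ ∑ i, (-f i (x i))} := by
    intro x hx
    simp only [Set.mem_ofPred_eq, Set.mem_union, Finset.sum_neg_distrib] at hx ⊢
    exact le_abs.1 hx
  refine (measure_mono hsub).trans ((measure_union_le _ _).trans ?_)
  rw [two_mul]
  refine add_le_add (pi_tail μ t hlam hlam' hf h0 hv) ?_
  refine pi_tail μ (f := fun i x => -f i x) t hlam hlam' (fun i x => by simpa using hf i x)
    (fun i => by rw [integral_neg, h0, neg_zero]) (fun i => by simpa using hv i)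

/-! ### The sampling model -/

lemma bernoulliLaw_isProbabilityMeasure {q : ℝ} (h0 : 0 ≤ q) (h1 : q ≤ 1) :
    IsProbabilityMeasure (bernoulliLaw q) := by
  constructor
  simp only [bernoulliLaw, Measure.coe_add, Measure.coe_smul, Pi.add_apply, Pi.smul_apply,
    measure_univ, smul_eq_mul, mul_one]
  rw [← ENNReal.ofReal_add h0 (by linarith)]
  simp

lemma integral_bernoulliLaw {q : ℝ} (h0 : 0 ≤ q) (h1 : q ≤ 1) (g : Bool → ℝ) :
    ∫ x, g x ∂(bernoulliLaw q) = q * g true + (1 - q) * g false := by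
  rw [bernoulliLaw, integral_add_measure, integral_smul_measure, integral_smul_measure]
  · simp [ENNReal.toReal_ofReal h0, ENNReal.toReal_ofReal (sub_nonneg.2 h1)]
  · exact (Integrable.of_finite (μ := Measure.dirac true)).smul_measure ENNReal.ofReal_ne_top
  · exact (Integrable.of_finite (μ := Measure.dirac false)).smul_measure ENNReal.ofReal_ne_top

instance multinomial_isProbabilityMeasure {k : ℕ} (α : Simplex k) :
    IsProbabilityMeasure (multinomial α) := by
  constructor
  simp only [multinomial, Measure.coe_finsetSum, Finset.sum_apply, Measure.coe_smul,
    Pi.smul_apply, measure_univ, smul_eq_mul, mul_one]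
  rw [← ENNReal.ofReal_sum_of_nonneg fun i _ => α.2.1 i, α.2.2]
  simp

lemma integral_multinomial {k : ℕ} (α : Simplex k) (g : Fin k → ℝ) :
    ∫ x, g x ∂(multinomial α) = ∑ a, α.1 a * g a := by
  rw [multinomial, integral_finsetSum_measure]
  · refine Finset.sum_congr rfl fun a _ => ?_
    rw [integral_smul_measure]
    simp [ENNReal.toReal_ofReal (α.2.1 a)]
  · intro a _
    exact (Integrable.of_finite (μ := Measure.dirac a)).smul_measure ENNReal.ofReal_ne_top

/-- The conditional law of `(A, X)` given the labels. -/
def condLaw (n : ℕ) {k : ℕ} (Q : SymMat k) (p : ℝ) (z : Labels n k) :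
    Measure (PairMat n × PairMat n) :=
  (Measure.pi fun e : Pair n => bernoulliLaw (Q.1 (z e.1.1) (z e.1.2))).prod
    (Measure.pi fun _ : Pair n => bernoulliLaw p)

lemma law_apply (n : ℕ) {k : ℕ} (α : Simplex k) (Q : SymMat k) (p : ℝ)
    (hQ : ∀ a b, Q.1 a b ∈ Set.Icc (0 : ℝ) 1) (hp : p ∈ Set.Icc (0 : ℝ) 1)
    (S : Set (Labels n k × PairMat n × PairMat n)) :
    law n α Q p S = ∫⁻ z, condLaw n Q p z {ω | (z, ω) ∈ S}
      ∂(Measure.pi fun _ : Fin n => multinomial α) := by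
  have := bernoulliLaw_isProbabilityMeasure hp.1 hp.2
  have := fun a b => bernoulliLaw_isProbabilityMeasure (hQ a b).1 (hQ a b).2
  rw [law, Measure.bind_apply (Set.toFinite S).measurableSet
    (measurable_of_countable _).aemeasurable]
  refine lintegral_congr fun z => ?_
  rw [Measure.dirac_prod, Measure.map_apply measurable_prodMk_left (Set.toFinite S).measurableSet]
  rfl

lemma condLaw_isProbabilityMeasure (n : ℕ) {k : ℕ} (Q : SymMat k) (p : ℝ)
    (hQ : ∀ a b, Q.1 a b ∈ Set.Icc (0 : ℝ) 1) (hp : p ∈ Set.Icc (0 : ℝ) 1) (z : Labels n k) :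
    IsProbabilityMeasure (condLaw n Q p z) := by
  have := bernoulliLaw_isProbabilityMeasure hp.1 hp.2
  have := fun a b => bernoulliLaw_isProbabilityMeasure (hQ a b).1 (hQ a b).2
  unfold condLaw
  infer_instance

lemma law_isProbabilityMeasure (n : ℕ) {k : ℕ} (α : Simplex k) (Q : SymMat k) (p : ℝ)
    (hQ : ∀ a b, Q.1 a b ∈ Set.Icc (0 : ℝ) 1) (hp : p ∈ Set.Icc (0 : ℝ) 1) :
    IsProbabilityMeasure (law n α Q p) := by
  constructor
  have := condLaw_isProbabilityMeasure n Q p hQ hp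
  rw [law_apply n α Q p hQ hp]
  simp

/-- The centred number `0` or `1` of observed entries of value `s` at the pair `e`. -/
def noise {n k : ℕ} (Q : SymMat k) (p : ℝ) (z : Labels n k) (A X : PairMat n) (s : Bool)
    (e : Pair n) : ℝ :=
  val (X e) * (if s then val (A e) else 1 - val (A e)) -
    p * (if s then Q.1 (z e.1.1) (z e.1.2) else 1 - Q.1 (z e.1.1) (z e.1.2))

/-- The noise at a pair is a centred Bernoulli variable of mean at most `p`, so its variance is at
most `p` rather than `1`. This keeps the bound useful for sparse sampling. -/
lemma noise_tail {n k : ℕ} (Q : SymMat k) (p : ℝ) (z : Labels n k)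
    (hQ : ∀ a b, Q.1 a b ∈ Set.Icc (0 : ℝ) 1) (hp : p ∈ Set.Icc (0 : ℝ) 1)
    (s : Bool) (w : Pair n → ℝ) (hw : ∀ e, |w e| ≤ 1) {lam : ℝ} (hlam : 0 ≤ lam)
    (hlam' : lam ≤ 1) (t : ℝ) :
    condLaw n Q p z {ω | t ≤ |∑ e, w e * noise Q p z ω.1 ω.2 s e|} ≤
      2 * ENNReal.ofReal (Real.exp (-lam * t + lam ^ 2 * ∑ e, p * w e ^ 2)) := by
  have := bernoulliLaw_isProbabilityMeasure hp.1 hp.2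
  have := fun a b => bernoulliLaw_isProbabilityMeasure (hQ a b).1 (hQ a b).2
  obtain ⟨hp0, hp1⟩ := hp
  -- The noise at `e` depends on both `A e` and `X e`, so the law is regrouped as a product over
  -- pairs of nodes of the laws of `(A e, X e)`.
  rw [condLaw, ← (measurePreserving_arrowProdEquivProdArrow Bool Bool (Pair n)
    (fun e => bernoulliLaw (Q.1 (z e.1.1) (z e.1.2))) (fun _ => bernoulliLaw p)).map_eq,
    MeasurableEquiv.map_apply]
  have key : ∀ (q : ℝ) (_ : 0 ≤ q) (_ : q ≤ 1) (g : Bool × Bool → ℝ),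
      ∫ x, g x ∂((bernoulliLaw q).prod (bernoulliLaw p)) =
        q * (p * g (true, true) + (1 - p) * g (true, false)) +
          (1 - q) * (p * g (false, true) + (1 - p) * g (false, false)) := by
    intro q h0 h1 g
    have := bernoulliLaw_isProbabilityMeasure h0 h1
    rw [integral_prod _ Integrable.of_finite, integral_bernoulliLaw h0 h1,
      integral_bernoulliLaw hp0 hp1, integral_bernoulliLaw hp0 hp1]
  refine pi_abs_tail _ (f := fun e (x : Bool × Bool) => w e * (val x.2 *
    (if s then val x.1 else 1 - val x.1) -
    p * (if s then Q.1 (z e.1.1) (z e.1.2) else 1 - Q.1 (z e.1.1) (z e.1.2)))) t hlam hlam'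
    ?_ ?_ ?_
  · rintro e ⟨x, y⟩
    obtain ⟨h0, h1⟩ := hQ (z e.1.1) (z e.1.2)
    rw [abs_mul]
    refine mul_le_one₀ (hw e) (abs_nonneg _) ?_
    have h2 := mul_nonneg hp0 h0
    have h3 := mul_nonneg hp0 (sub_nonneg.2 h1)
    rw [abs_le]
    cases s <;> cases x <;> cases y <;> simp [val] <;> constructor <;> nlinarith
  · intro e
    obtain ⟨h0, h1⟩ := hQ (z e.1.1) (z e.1.2)
    rw [key _ h0 h1]
    cases s <;> simp [val] <;> ring
  · intro e
    obtain ⟨h0, h1⟩ := hQ (z e.1.1) (z e.1.2)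
    simp only [mul_pow]
    rw [integral_const_mul, mul_comm p (w e ^ 2)]
    refine mul_le_mul_of_nonneg_left ?_ (sq_nonneg (w e))
    rw [key _ h0 h1]
    have h2 := mul_nonneg hp0 h0
    have h3 := mul_nonneg hp0 (sub_nonneg.2 h1)
    cases s <;> simp [val] <;> nlinarith

/-! ### Sums over pairs -/

lemma sum_pair_symm {n : ℕ} (F : Fin n → Fin n → ℝ) (hF : ∀ i j, F i j = F j i) :
    ∑ i, ∑ j, (if i = j then 0 else F i j) = 2 * ∑ e : Pair n, F e.1.1 e.1.2 := by
  have h1 : ∑ e : Pair n, F e.1.1 e.1.2 = ∑ i, ∑ j, if i < j then F i j else 0 := by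
    rw [← Fintype.sum_prod_type' (f := fun i j => if i < j then F i j else 0),
      ← Finset.sum_filter]
    exact (Finset.sum_subtype _ (fun x => by simp) (fun x : Fin n × Fin n => F x.1 x.2)).symm
  have h2 : ∑ i, ∑ j, (if i < j then F i j else 0) = ∑ i, ∑ j, if j < i then F i j else 0 := by
    rw [Finset.sum_comm]
    simp only [hF]
  rw [two_mul, h1]
  nth_rw 2 [h2]
  rw [← Finset.sum_add_distrib]
  refine Finset.sum_congr rfl fun i _ => ?_
  rw [← Finset.sum_add_distrib]
  refine Finset.sum_congr rfl fun j _ => ?_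
  rcases lt_trichotomy i j with h | h | h
  · simp [h, h.ne, h.not_gt]
  · simp [h]
  · simp [h, h.ne', h.not_gt]

lemma sum_pair_add_le {n : ℕ} (t : Fin n → ℝ) (ht : ∀ i, 0 ≤ t i) :
    ∑ e : Pair n, (t e.1.1 + t e.1.2) ≤ n * ∑ i, t i := by
  have h1 := sum_pair_symm (fun i j => t i + t j) (fun i j => add_comm _ _)
  have h2 : ∑ i, ∑ j, (if i = j then 0 else t i + t j) ≤ ∑ i, ∑ j, (t i + t j) := by
    refine Finset.sum_le_sum fun i _ => Finset.sum_le_sum fun j _ => ?_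
    split_ifs
    · exact add_nonneg (ht i) (ht j)
    · exact le_rfl
  have h3 : ∑ i, ∑ j, (t i + t j) = 2 * (n * ∑ i, t i) := by
    simp only [Finset.sum_add_distrib, Finset.sum_const, Finset.card_univ, Fintype.card_fin,
      nsmul_eq_mul, ← Finset.mul_sum]
    ring
  linarith

lemma card_pair_le (n : ℕ) : (Fintype.card (Pair n) : ℝ) ≤ (n : ℝ) ^ 2 := by
  have h : Fintype.card (Pair n) ≤ Fintype.card (Fin n × Fin n) := Fintype.card_subtype_le _
  rw [Fintype.card_prod, Fintype.card_fin] at h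
  rw [pow_two]
  exact_mod_cast h

/-! ### The event on which the estimators are controlled -/

/-- The indicator of `z i = a`. -/
def ind {n k : ℕ} (z : Labels n k) (i : Fin n) (a : Fin k) : ℝ := if z i = a then 1 else 0

/-- The weight of the communities `(a, b)` at a pair of nodes, for the label weights `τ`. -/
def pairWt {n k : ℕ} (τ : Fin n → Fin k → ℝ) (a b : Fin k) (e : Pair n) : ℝ :=
  τ e.1.1 a * τ e.1.2 b

/-- The number of nodes at which the label functions differ. -/
def mismatch {n k : ℕ} (z z' : Labels n k) : ℝ := ∑ i, if z i = z' i then 0 else 1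

lemma pairWt_ind_mem {n k : ℕ} (z : Labels n k) (a b : Fin k) (e : Pair n) :
    pairWt (ind z) a b e ∈ Set.Icc (0 : ℝ) 1 := by
  unfold pairWt ind
  split_ifs <;> norm_num

lemma abs_pairWt_sub_le {n k : ℕ} (z z' : Labels n k) (a b : Fin k) (e : Pair n) :
    |pairWt (ind z) a b e - pairWt (ind z') a b e| ≤ 1 := by
  have h1 := pairWt_ind_mem z a b e
  have h2 := pairWt_ind_mem z' a b e
  rw [abs_le]
  constructor <;> linarith [h1.1, h1.2, h2.1, h2.2]

/-- The two weights differ only at pairs containing a mismatched node, and each node lies in fewer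
than `n` pairs. -/
lemma sum_sq_pairWt_sub_le {n k : ℕ} (z z' : Labels n k) (a b : Fin k) :
    ∑ e, (pairWt (ind z) a b e - pairWt (ind z') a b e) ^ 2 ≤ n * mismatch z z' := by
  refine le_trans (Finset.sum_le_sum fun e _ => ?_)
    (sum_pair_add_le (fun i => if z i = z' i then (0 : ℝ) else 1) fun i => by
      split_ifs <;> norm_num)
  by_cases h : z e.1.1 = z' e.1.1 ∧ z e.1.2 = z' e.1.2
  · simp [pairWt, ind, h.1, h.2]
  · have h1 : (pairWt (ind z) a b e - pairWt (ind z') a b e) ^ 2 ≤ 1 := by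
      rw [sq_le_one_iff_abs_le_one]
      exact abs_pairWt_sub_le z z' a b e
    refine h1.trans ?_
    by_cases h3 : z e.1.1 = z' e.1.1
    · have h4 : z e.1.2 ≠ z' e.1.2 := fun h4 => h ⟨h3, h4⟩
      simp [h3, h4]
    · simp only [h3, if_false]
      split_ifs <;> norm_num

/-- The community frequencies and the numbers of observed entries of each value between
communities are close to their expectations, uniformly over the label functions. -/
structure GoodEvent {n k : ℕ} (α : Simplex k) (Q : SymMat k) (p ε t : ℝ) (zs : Labels n k)
    (A X : PairMat n) : Prop where
  freq : ∀ a, |∑ i, ind zs i a - n * α.1 a| ≤ ε * n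
  diff : ∀ z s a b, |∑ e, (pairWt (ind z) a b e - pairWt (ind zs) a b e) *
    noise Q p zs A X s e| ≤ ε * (n * p) * mismatch z zs
  base : ∀ s a b, |∑ e, pairWt (ind zs) a b e * noise Q p zs A X s e| ≤ t

/-! ### Bounds on the probability that the event fails. -/

/-- The mismatch is additive over nodes, so the sum over labellings factors. Each node contributes
`1` for its correct label and `exp (-s)` for each other label. -/
lemma sum_exp_mismatch {n k : ℕ} (zs : Labels n k) (s : ℝ) :
    ∑ z : Labels n k, Real.exp (-s * mismatch z zs) ≤ Real.exp (n * (k * Real.exp (-s))) := by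
  have h1 : ∀ z : Labels n k, Real.exp (-s * mismatch z zs) =
      ∏ i, (if z i = zs i then 1 else Real.exp (-s)) := by
    intro z
    rw [mismatch, Finset.mul_sum, Real.exp_sum]
    refine Finset.prod_congr rfl fun i _ => ?_
    split_ifs <;> simp
  simp only [h1]
  rw [← Fintype.prod_sum (fun i a => if a = zs i then (1 : ℝ) else Real.exp (-s))]
  have h2 : ∀ i, ∑ a, (if a = zs i then (1 : ℝ) else Real.exp (-s)) ≤
      Real.exp (k * Real.exp (-s)) := by
    intro i
    calc ∑ a, (if a = zs i then (1 : ℝ) else Real.exp (-s))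
        ≤ ∑ a, ((if a = zs i then (1 : ℝ) else 0) + Real.exp (-s)) := by
          refine Finset.sum_le_sum fun a _ => ?_
          split_ifs <;> simp [Real.exp_nonneg]
      _ = k * Real.exp (-s) + 1 := by
          rw [Finset.sum_add_distrib]
          simp [add_comm]
      _ ≤ _ := Real.add_one_le_exp _
  calc _ ≤ ∏ _i : Fin n, Real.exp (k * Real.exp (-s)) :=
        Finset.prod_le_prod (fun i _ => Finset.sum_nonneg fun a _ => by
          split_ifs <;> simp [Real.exp_nonneg]) fun i _ => h2 i
    _ = _ := by
        rw [Finset.prod_const, Finset.card_univ, Fintype.card_fin, ← Real.exp_nat_mul]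

lemma sum_exp_mismatch_ne {n k : ℕ} (zs : Labels n k) (s : ℝ) :
    ∑ z ∈ Finset.univ.erase zs, Real.exp (-s * mismatch z zs) ≤
      Real.exp (n * (k * Real.exp (-s))) - 1 := by
  have h := sum_exp_mismatch zs s
  rw [← Finset.add_sum_erase _ _ (Finset.mem_univ zs)] at h
  have h0 : mismatch zs zs = 0 := by simp [mismatch]
  rw [h0, mul_zero, Real.exp_zero] at h
  linarith

/-- Union bound over `z ≠ zs`, weighted by the mismatch. The factor `4 k²` counts two tails, two
values of `s` and `k²` pairs of communities. -/
lemma condLaw_diff_fail {n k : ℕ} (Q : SymMat k) (p ε : ℝ) (zs : Labels n k)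
    (hQ : ∀ a b, Q.1 a b ∈ Set.Icc (0 : ℝ) 1) (hp : p ∈ Set.Icc (0 : ℝ) 1)
    (hε : 0 ≤ ε) (hε' : ε ≤ 1) :
    condLaw n Q p zs {ω | ¬ ∀ z s a b, |∑ e, (pairWt (ind z) a b e - pairWt (ind zs) a b e) *
      noise Q p zs ω.1 ω.2 s e| ≤ ε * (n * p) * mismatch z zs} ≤
      ENNReal.ofReal (4 * k ^ 2 * (Real.exp (n * (k * Real.exp (-(ε ^ 2 * (n * p) / 4)))) - 1)) := by
  set s0 := ε ^ 2 * (n * p) / 4 with hs0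
  have hsub : {ω : PairMat n × PairMat n |
      ¬ ∀ z s a b, |∑ e, (pairWt (ind z) a b e - pairWt (ind zs) a b e) *
      noise Q p zs ω.1 ω.2 s e| ≤ ε * (n * p) * mismatch z zs} ⊆
      ⋃ z ∈ Finset.univ.erase zs, ⋃ x ∈ (Finset.univ : Finset (Bool × Fin k × Fin k)),
        {ω | ε * (n * p) * mismatch z zs ≤ |∑ e,
          (pairWt (ind z) x.2.1 x.2.2 e - pairWt (ind zs) x.2.1 x.2.2 e) *
            noise Q p zs ω.1 ω.2 x.1 e|} := by
    intro ω hω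
    simp only [Set.mem_ofPred_eq, not_forall, not_le] at hω
    obtain ⟨z, s, a, b, h⟩ := hω
    simp only [Set.mem_iUnion]
    refine ⟨z, ?_, (s, a, b), Finset.mem_univ _, h.le⟩
    rw [Finset.mem_erase]
    refine ⟨?_, Finset.mem_univ _⟩
    -- At `z = zs` both sides vanish, so the inequality cannot fail. Dropping this term makes the
    -- bound tend to `0` instead of staying of order one.
    rintro rfl
    simp [mismatch] at h
  have hone : ∀ (z : Labels n k) (x : Bool × Fin k × Fin k),
      condLaw n Q p zs {ω | ε * (n * p) * mismatch z zs ≤ |∑ e,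
          (pairWt (ind z) x.2.1 x.2.2 e - pairWt (ind zs) x.2.1 x.2.2 e) *
            noise Q p zs ω.1 ω.2 x.1 e|} ≤ ENNReal.ofReal (2 * Real.exp (-s0 * mismatch z zs)) := by
    rintro z ⟨s, a, b⟩
    -- With `∑ w² ≤ n * mismatch`, the slope `ε / 2` minimizes the exponent and gives `-(ε² n p / 4)
    -- * mismatch`.
    refine (noise_tail Q p zs hQ hp s _ (abs_pairWt_sub_le z zs a b) (lam := ε / 2)
      (by linarith) (by linarith) _).trans ?_
    rw [ENNReal.ofReal_mul (by norm_num), ENNReal.ofReal_ofNat]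
    gcongr
    have h1 := sum_sq_pairWt_sub_le z zs a b
    rw [← Finset.mul_sum]
    have h2 := mul_le_mul_of_nonneg_left h1 (mul_nonneg (sq_nonneg (ε / 2)) hp.1)
    rw [hs0]
    linarith
  refine (measure_mono hsub).trans ?_
  calc _ ≤ ∑ z ∈ Finset.univ.erase zs, ∑ x ∈ (Finset.univ : Finset (Bool × Fin k × Fin k)),
        ENNReal.ofReal (2 * Real.exp (-s0 * mismatch z zs)) := by
        refine (measure_biUnion_finset_le _ _).trans (Finset.sum_le_sum fun z _ => ?_)
        exact (measure_biUnion_finset_le _ _).trans (Finset.sum_le_sum fun x _ => hone z x)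
    _ = ENNReal.ofReal (∑ z ∈ Finset.univ.erase zs,
          ∑ x ∈ (Finset.univ : Finset (Bool × Fin k × Fin k)),
            2 * Real.exp (-s0 * mismatch z zs)) := by
        rw [ENNReal.ofReal_sum_of_nonneg fun z _ => Finset.sum_nonneg fun x _ => by positivity]
        refine Finset.sum_congr rfl fun z _ => ?_
        rw [ENNReal.ofReal_sum_of_nonneg fun x _ => by positivity]
    _ ≤ _ := by
        apply ENNReal.ofReal_le_ofReal
        have h := sum_exp_mismatch_ne zs s0
        simp only [Finset.sum_const, Finset.card_univ, Fintype.card_prod, Fintype.card_bool,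
          Fintype.card_fin, nsmul_eq_mul, ← Finset.mul_sum]
        push_cast
        have h2 := mul_le_mul_of_nonneg_left h (by positivity : (0 : ℝ) ≤ 4 * k ^ 2)
        linarith

lemma condLaw_base_fail {n k : ℕ} (Q : SymMat k) (p κ : ℝ) (zs : Labels n k)
    (hQ : ∀ a b, Q.1 a b ∈ Set.Icc (0 : ℝ) 1) (hp : p ∈ Set.Icc (0 : ℝ) 1)
    (hκ : 0 < κ) (hnp : κ ^ 2 ≤ 4 * (n * p)) :
    condLaw n Q p zs {ω | ¬ ∀ s a b, |∑ e, pairWt (ind zs) a b e *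
      noise Q p zs ω.1 ω.2 s e| ≤ κ * Real.sqrt (n ^ 3 * p)} ≤
      ENNReal.ofReal (4 * k ^ 2 * Real.exp (-(κ ^ 2 / 4 * n))) := by
  have hnp0 : 0 < (n : ℝ) * p := by nlinarith [sq_pos_of_pos hκ]
  have hn : (0 : ℝ) < n := by
    rcases (Nat.cast_nonneg n : (0 : ℝ) ≤ n).eq_or_lt with h | h
    · rw [← h] at hnp0; simp at hnp0
    · exact h
  have hp0 : 0 < p := pos_of_mul_pos_right hnp0 hn.le
  set r := Real.sqrt (n ^ 3 * p) with hr
  have hr2 : r ^ 2 = n ^ 3 * p := Real.sq_sqrt (by positivity)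
  have hr0 : 0 ≤ r := Real.sqrt_nonneg _
  have hsub : {ω : PairMat n × PairMat n | ¬ ∀ s a b, |∑ e, pairWt (ind zs) a b e *
      noise Q p zs ω.1 ω.2 s e| ≤ κ * r} ⊆
      ⋃ x ∈ (Finset.univ : Finset (Bool × Fin k × Fin k)),
        {ω | κ * r ≤ |∑ e, pairWt (ind zs) x.2.1 x.2.2 e *
            noise Q p zs ω.1 ω.2 x.1 e|} := by
    intro ω hω
    simp only [Set.mem_ofPred_eq, not_forall, not_le] at hω
    obtain ⟨s, a, b, h⟩ := hω
    simp only [Set.mem_iUnion]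
    exact ⟨(s, a, b), Finset.mem_univ _, h.le⟩
  have hone : ∀ (x : Bool × Fin k × Fin k),
      condLaw n Q p zs {ω | κ * r ≤ |∑ e, pairWt (ind zs) x.2.1 x.2.2 e *
            noise Q p zs ω.1 ω.2 x.1 e|} ≤ ENNReal.ofReal (2 * Real.exp (-(κ ^ 2 / 4 * n))) := by
    rintro ⟨s, a, b⟩
    -- This slope minimizes `-lam κ r + lam² p n²`, the exponent once `∑ w² ≤ n²` is used. The
    -- hypothesis `hnp` is what makes it at most `1`.
    refine (noise_tail Q p zs hQ hp s _ (fun e => ?_) (lam := κ * r / (2 * (n ^ 2 * p)))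
      (by positivity) ?_ _).trans ?_
    · have := pairWt_ind_mem zs a b e
      rw [abs_of_nonneg this.1]
      exact this.2
    · rw [div_le_one (by positivity)]
      refine abs_le_of_sq_le_sq' ?_ (by positivity) |>.2
      rw [mul_pow, hr2]
      have := mul_le_mul_of_nonneg_right hnp (by positivity : 0 ≤ n ^ 3 * p)
      linarith
    · rw [ENNReal.ofReal_mul (by norm_num), ENNReal.ofReal_ofNat]
      gcongr
      have h1 : ∑ e : Pair n, pairWt (ind zs) a b e ^ 2 ≤ (n : ℝ) ^ 2 := by
        refine le_trans (Finset.sum_le_sum fun e _ => ?_) ((Finset.sum_const (1 : ℝ)).trans_le ?_)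
        · have := pairWt_ind_mem zs a b e
          exact pow_le_one₀ this.1 this.2
        · simpa using card_pair_le n
      rw [← Finset.mul_sum]
      have h2 : (κ * r / (2 * (n ^ 2 * p))) ^ 2 * (p * ∑ e : Pair n, pairWt (ind zs) a b e ^ 2) ≤
          (κ * r / (2 * (n ^ 2 * p))) ^ 2 * (p * n ^ 2) := by gcongr
      have h3 : -(κ * r / (2 * (n ^ 2 * p))) * (κ * r) +
          (κ * r / (2 * (n ^ 2 * p))) ^ 2 * (p * n ^ 2) = -(κ ^ 2 / 4 * n) := by
        have : -(κ * r / (2 * (n ^ 2 * p))) * (κ * r) +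
          (κ * r / (2 * (n ^ 2 * p))) ^ 2 * (p * n ^ 2) = - (κ ^ 2 * r ^ 2 / (4 * (n ^ 2 * p))) := by
          field_simp
          ring
        rw [this, hr2]
        field_simp
      linarith
  refine (measure_mono hsub).trans ?_
  calc _ ≤ ∑ x ∈ (Finset.univ : Finset (Bool × Fin k × Fin k)),
        ENNReal.ofReal (2 * Real.exp (-(κ ^ 2 / 4 * n))) :=
        (measure_biUnion_finset_le _ _).trans (Finset.sum_le_sum fun x _ => hone x)
    _ = ENNReal.ofReal (∑ x ∈ (Finset.univ : Finset (Bool × Fin k × Fin k)),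
            2 * Real.exp (-(κ ^ 2 / 4 * n))) := by
        rw [ENNReal.ofReal_sum_of_nonneg fun x _ => by positivity]
    _ ≤ _ := by
        apply ENNReal.ofReal_le_ofReal
        simp only [Finset.sum_const, Finset.card_univ, Fintype.card_prod, Fintype.card_bool,
          Fintype.card_fin, nsmul_eq_mul]
        push_cast
        linarith

lemma freq_fail {n k : ℕ} (α : Simplex k) (ε : ℝ) (hε : 0 ≤ ε) (hε' : ε ≤ 1) :
    (Measure.pi fun _ : Fin n => multinomial α)
      {z | ¬ ∀ a, |∑ i, ind z i a - n * α.1 a| ≤ ε * n} ≤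
      ENNReal.ofReal (2 * k * Real.exp (-(ε ^ 2 / 4 * n))) := by
  have hα1 : ∀ a, α.1 a ≤ 1 := fun a => by
    rw [← α.2.2]
    exact Finset.single_le_sum (fun i _ => α.2.1 i) (Finset.mem_univ a)
  have hsub : {z : Labels n k | ¬ ∀ a, |∑ i, ind z i a - n * α.1 a| ≤ ε * n} ⊆
      ⋃ a ∈ (Finset.univ : Finset (Fin k)),
        {z | ε * n ≤ |∑ i, ((if z i = a then 1 else 0) - α.1 a)|} := by
    intro z hz
    simp only [Set.mem_ofPred_eq, not_forall, not_le] at hz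
    obtain ⟨a, h⟩ := hz
    simp only [Set.mem_iUnion]
    refine ⟨a, Finset.mem_univ _, ?_⟩
    have : ∑ i, ((if z i = a then 1 else 0) - α.1 a) = ∑ i, ind z i a - n * α.1 a := by
      simp [ind, Finset.sum_sub_distrib]
    rw [Set.mem_ofPred_eq, this]
    exact h.le
  refine (measure_mono hsub).trans ((measure_biUnion_finset_le _ _).trans ?_)
  calc _ ≤ ∑ a : Fin k, ENNReal.ofReal (2 * Real.exp (-(ε ^ 2 / 4 * n))) := by
        refine Finset.sum_le_sum fun a _ => ?_
        refine (pi_abs_tail (fun _ : Fin n => multinomial α)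
          (f := fun _ x => (if x = a then 1 else 0) - α.1 a) (v := fun _ => 1) (lam := ε / 2)
          (ε * n) (by linarith) (by linarith) ?_ ?_ ?_).trans ?_
        · intro i x
          have h0 := α.2.1 a
          have h1 := hα1 a
          rw [abs_le]
          split_ifs <;> constructor <;> linarith
        · intro i
          rw [integral_multinomial]
          simp only [mul_sub, Finset.sum_sub_distrib, ← Finset.sum_mul, α.2.2]
          simp
        · intro i
          rw [integral_multinomial]
          refine le_of_le_of_eq (Finset.sum_le_sum fun x _ =>
            mul_le_of_le_one_right (α.2.1 x) ?_) α.2.2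
          rw [sq_le_one_iff_abs_le_one]
          have h0 := α.2.1 a
          have h1 := hα1 a
          rw [abs_le]
          split_ifs <;> constructor <;> linarith
        · rw [ENNReal.ofReal_mul (by norm_num), ENNReal.ofReal_ofNat]
          gcongr
          simp
          nlinarith
    _ = ENNReal.ofReal (∑ a : Fin k, 2 * Real.exp (-(ε ^ 2 / 4 * n))) := by
        rw [ENNReal.ofReal_sum_of_nonneg fun x _ => by positivity]
    _ ≤ _ := by
        apply ENNReal.ofReal_le_ofReal
        simp only [Finset.sum_const, Finset.card_univ, Fintype.card_fin, nsmul_eq_mul]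
        linarith

lemma law_goodEvent_fail {n k : ℕ} (α : Simplex k) (Q : SymMat k) (p ε κ : ℝ)
    (hQ : ∀ a b, Q.1 a b ∈ Set.Icc (0 : ℝ) 1) (hp : p ∈ Set.Icc (0 : ℝ) 1)
    (hε : 0 ≤ ε) (hε' : ε ≤ 1) (hκ : 0 < κ) (hnp : κ ^ 2 ≤ 4 * (n * p)) :
    law n α Q p {ω | ¬ GoodEvent α Q p ε (κ * Real.sqrt (n ^ 3 * p)) ω.1 ω.2.1 ω.2.2} ≤
      ENNReal.ofReal (2 * k * Real.exp (-(ε ^ 2 / 4 * n))) +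
      (ENNReal.ofReal (4 * k ^ 2 *
        (Real.exp (n * (k * Real.exp (-(ε ^ 2 * (n * p) / 4)))) - 1)) +
      ENNReal.ofReal (4 * k ^ 2 * Real.exp (-(κ ^ 2 / 4 * n)))) := by
  rw [law_apply n α Q p hQ hp]
  set S : Set (Labels n k) := {z | ¬ ∀ a, |∑ i, ind z i a - n * α.1 a| ≤ ε * n} with hS
  have := condLaw_isProbabilityMeasure n Q p hQ hp
  set r := ENNReal.ofReal (4 * k ^ 2 *
        (Real.exp (n * (k * Real.exp (-(ε ^ 2 * (n * p) / 4)))) - 1)) +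
      ENNReal.ofReal (4 * k ^ 2 * Real.exp (-(κ ^ 2 / 4 * n)))
  calc _ ≤ ∫⁻ z, (S.indicator (fun _ => 1) z + r) ∂(Measure.pi fun _ : Fin n => multinomial α) := by
        refine lintegral_mono fun z => ?_
        by_cases hz : z ∈ S
        · rw [Set.indicator_of_mem hz]
          exact prob_le_one.trans le_self_add
        · rw [Set.indicator_of_notMem hz, zero_add]
          refine le_trans (measure_mono ?_) ((measure_union_le _ _).trans (add_le_add
            (condLaw_diff_fail Q p ε z hQ hp hε hε') (condLaw_base_fail Q p κ z hQ hp hκ hnp)))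
          intro ω hω
          by_contra hcon
          rw [Set.mem_union, not_or] at hcon
          simp only [Set.mem_ofPred_eq, not_not] at hcon
          simp only [hS, Set.mem_ofPred_eq, not_not] at hz
          exact hω ⟨hz, hcon.1, hcon.2⟩
    _ = (Measure.pi fun _ : Fin n => multinomial α) S + r := by
        rw [lintegral_add_right _ measurable_const, lintegral_indicator (Set.toFinite S).measurableSet]
        simp
    _ ≤ _ := by
        gcongr
        exact freq_fail α ε hε hε'

/-! ### Asymptotics of the sampling rate -/

lemma eventually_mul_log_le {p : ℕ → ℝ}
    (h : (fun n : ℕ => Real.log n / n) =o[atTop] p) (hp : ∀ n, 0 ≤ p n) {K : ℝ} (hK : 0 < K) :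
    ∀ᶠ n : ℕ in atTop, K * Real.log n ≤ n * p n := by
  have h1 := h.def (inv_pos.2 hK)
  filter_upwards [h1, eventually_ge_atTop 1] with n hn hn1
  have hn0 : (0 : ℝ) < n := by exact_mod_cast hn1
  have hl : 0 ≤ Real.log n := Real.log_natCast_nonneg n
  rw [Real.norm_of_nonneg (by positivity), Real.norm_of_nonneg (hp n), div_le_iff₀ hn0,
    mul_assoc, ← div_eq_inv_mul, le_div_iff₀ hK] at hn
  linarith

lemma tendsto_mul_atTop {p : ℕ → ℝ}
    (h : (fun n : ℕ => Real.log n / n) =o[atTop] p) (hp : ∀ n, 0 ≤ p n) :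
    Tendsto (fun n : ℕ => n * p n) atTop atTop := by
  refine tendsto_atTop_mono' _ (eventually_mul_log_le h hp one_pos) ?_
  simpa [Function.comp_def] using Real.tendsto_log_atTop.comp tendsto_natCast_atTop_atTop

/-- Both the union bound and the entropy bound need this limit. Eventually `K n p ≥ 2 log n`, which
leaves at most `1 / n`. -/
lemma tendsto_mul_exp_neg {p : ℕ → ℝ}
    (h : (fun n : ℕ => Real.log n / n) =o[atTop] p) (hp : ∀ n, 0 ≤ p n) {K : ℝ} (hK : 0 < K) :
    Tendsto (fun n : ℕ => n * Real.exp (-(K * (n * p n)))) atTop (𝓝 0) := by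
  have h1 := eventually_mul_log_le h hp (div_pos two_pos hK)
  refine squeeze_zero' (Eventually.of_forall fun n => by positivity) ?_
    tendsto_inv_atTop_nhds_zero_nat
  filter_upwards [h1, eventually_ge_atTop 1] with n hn hn1
  have hn0 : (0 : ℝ) < n := by exact_mod_cast hn1
  have h2 : 2 * Real.log n ≤ K * (n * p n) := by
    rw [div_mul_eq_mul_div, div_le_iff₀ hK] at hn
    linarith
  have h3 : Real.exp (-(K * (n * p n))) ≤ ((n : ℝ) ^ 2)⁻¹ := by
    rw [← Real.exp_log (pow_pos hn0 2), ← Real.exp_neg, Real.log_pow]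
    rw [Real.exp_le_exp, neg_le_neg_iff]
    exact_mod_cast h2
  calc (n : ℝ) * Real.exp (-(K * (n * p n))) ≤ n * ((n : ℝ) ^ 2)⁻¹ := by gcongr
    _ = _ := by field_simp

lemma tendsto_exp_neg_nat {K : ℝ} (hK : 0 < K) :
    Tendsto (fun n : ℕ => Real.exp (-(K * n))) atTop (𝓝 0) := by
  refine Real.tendsto_exp_neg_atTop_nhds_zero.comp ?_
  exact tendsto_natCast_atTop_atTop.const_mul_atTop hK

lemma tendsto_law_goodEvent_fail {k : ℕ} (α : Simplex k) (Q : SymMat k) (p : ℕ → ℝ) (ε κ : ℝ)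
    (hQ : ∀ a b, Q.1 a b ∈ Set.Icc (0 : ℝ) 1) (hp : ∀ n, p n ∈ Set.Icc (0 : ℝ) 1)
    (h : (fun n : ℕ => Real.log n / n) =o[atTop] p)
    (hε : 0 < ε) (hε' : ε ≤ 1) (hκ : 0 < κ) :
    Tendsto (fun n : ℕ => law n α Q (p n)
      {ω | ¬ GoodEvent α Q (p n) ε (κ * Real.sqrt (n ^ 3 * p n)) ω.1 ω.2.1 ω.2.2})
      atTop (𝓝 0) := by
  have hp0 := fun n => (hp n).1
  have hnp : ∀ᶠ n : ℕ in atTop, κ ^ 2 ≤ 4 * (n * p n) := by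
    filter_upwards [(tendsto_mul_atTop h hp0).eventually_ge_atTop (κ ^ 2 / 4)] with n hn
    linarith
  have hlim : Tendsto (fun n : ℕ => ENNReal.ofReal (2 * k * Real.exp (-(ε ^ 2 / 4 * n))) +
      (ENNReal.ofReal (4 * k ^ 2 *
        (Real.exp (n * (k * Real.exp (-(ε ^ 2 * (n * p n) / 4)))) - 1)) +
      ENNReal.ofReal (4 * k ^ 2 * Real.exp (-(κ ^ 2 / 4 * n))))) atTop (𝓝 0) := by
    have t1 : Tendsto (fun n : ℕ => 2 * (k : ℝ) * Real.exp (-(ε ^ 2 / 4 * n))) atTop (𝓝 0) := by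
      simpa using (tendsto_exp_neg_nat (by positivity : 0 < ε ^ 2 / 4)).const_mul (2 * (k : ℝ))
    have t3 : Tendsto (fun n : ℕ => 4 * (k : ℝ) ^ 2 * Real.exp (-(κ ^ 2 / 4 * n))) atTop
        (𝓝 0) := by
      simpa using (tendsto_exp_neg_nat (by positivity : 0 < κ ^ 2 / 4)).const_mul (4 * (k : ℝ) ^ 2)
    have t2 : Tendsto (fun n : ℕ => 4 * (k : ℝ) ^ 2 *
        (Real.exp (n * (k * Real.exp (-(ε ^ 2 * (n * p n) / 4)))) - 1)) atTop (𝓝 0) := by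
      have h1 := (tendsto_mul_exp_neg h hp0 (by positivity : 0 < ε ^ 2 / 4)).const_mul (k : ℝ)
      have h2 : Tendsto (fun n : ℕ => (n : ℝ) * (k * Real.exp (-(ε ^ 2 * (n * p n) / 4))))
          atTop (𝓝 0) := by
        rw [mul_zero] at h1
        refine h1.congr fun n => ?_
        rw [show ε ^ 2 / 4 * (n * p n) = ε ^ 2 * (n * p n) / 4 by ring]
        ring
      have h3 := ((Real.continuous_exp.tendsto 0).comp h2).sub_const 1
      simpa using h3.const_mul (4 * (k : ℝ) ^ 2)
    simpa using (ENNReal.tendsto_ofReal t1).add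
      ((ENNReal.tendsto_ofReal t2).add (ENNReal.tendsto_ofReal t3))
  refine tendsto_of_tendsto_of_tendsto_of_le_of_le' tendsto_const_nhds hlim
    (Eventually.of_forall fun n => zero_le) ?_
  filter_upwards [hnp] with n hn
  exact law_goodEvent_fail α Q (p n) ε κ hQ (hp n) hε.le hε' hκ hn

/-- Reduces each claim with probability tending to `1` to a deterministic implication from the good
event, for large `n`. -/
lemma tendsto_law_of_goodEvent {k : ℕ} (α : Simplex k) (Q : SymMat k) (p : ℕ → ℝ) (ε κ : ℝ)
    (hQ : ∀ a b, Q.1 a b ∈ Set.Icc (0 : ℝ) 1) (hp : ∀ n, p n ∈ Set.Icc (0 : ℝ) 1)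
    (h : (fun n : ℕ => Real.log n / n) =o[atTop] p)
    (hε : 0 < ε) (hε' : ε ≤ 1) (hκ : 0 < κ)
    (S : ∀ n : ℕ, Set (Labels n k × PairMat n × PairMat n))
    (hS : ∀ᶠ n : ℕ in atTop, ∀ ω : Labels n k × PairMat n × PairMat n,
      GoodEvent α Q (p n) ε (κ * Real.sqrt (n ^ 3 * p n)) ω.1 ω.2.1 ω.2.2 → ω ∈ S n) :
    Tendsto (fun n : ℕ => law n α Q (p n) (S n)) atTop (𝓝 1) := by
  have h1 := tendsto_law_goodEvent_fail α Q p ε κ hQ hp h hε hε' hκ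
  have h2 : Tendsto (fun n : ℕ => 1 - law n α Q (p n)
      {ω | ¬ GoodEvent α Q (p n) ε (κ * Real.sqrt (n ^ 3 * p n)) ω.1 ω.2.1 ω.2.2})
      atTop (𝓝 1) := by
    simpa using ENNReal.Tendsto.sub (tendsto_const_nhds (x := (1 : ENNReal))) h1
      (Or.inl ENNReal.one_ne_top)
  have hprob := fun n => law_isProbabilityMeasure n α Q (p n) hQ (hp n)
  refine tendsto_of_tendsto_of_tendsto_of_le_of_le' h2 tendsto_const_nhds ?_
    (Eventually.of_forall fun n => prob_le_one)
  filter_upwards [hS] with n hn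
  rw [tsub_le_iff_right, ← measure_univ (μ := law n α Q (p n))]
  refine (measure_mono fun ω _ => ?_).trans (measure_union_le _ _)
  by_cases hω : GoodEvent α Q (p n) ε (κ * Real.sqrt (n ^ 3 * p n)) ω.1 ω.2.1 ω.2.2
  · exact Or.inl (hn ω hω)
  · exact Or.inr hω

/-! ### Product distributions on label functions -/

/-- Each `τ i` is a vector of probability weights. -/
structure IsWeights {n k : ℕ} (τ : Fin n → Fin k → ℝ) : Prop where
  nonneg : ∀ i a, 0 ≤ τ i a
  sum_eq : ∀ i, ∑ a, τ i a = 1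

lemma IsWeights.le_one {n k : ℕ} {τ : Fin n → Fin k → ℝ} (hτ : IsWeights τ) (i : Fin n)
    (a : Fin k) : τ i a ≤ 1 := by
  rw [← hτ.sum_eq i]
  exact Finset.single_le_sum (fun b _ => hτ.nonneg i b) (Finset.mem_univ a)

lemma isWeights_simplex {n k : ℕ} (τ : Fin n → Simplex k) : IsWeights fun i => (τ i).1 :=
  ⟨fun i a => (τ i).2.1 a, fun i => (τ i).2.2⟩

lemma isWeights_ind {n k : ℕ} (z : Labels n k) : IsWeights (ind z) :=
  ⟨fun i a => by unfold ind; split_ifs <;> norm_num, fun i => by simp [ind]⟩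

lemma sum_prod_weights {n k : ℕ} {τ : Fin n → Fin k → ℝ} (hτ : IsWeights τ) :
    ∑ z : Labels n k, ∏ l, τ l (z l) = 1 := by
  rw [← Fintype.prod_sum]
  simp [hτ.sum_eq]

lemma sum_prod_ind {n k : ℕ} {τ : Fin n → Fin k → ℝ} (hτ : IsWeights τ) (i : Fin n)
    (a : Fin k) : ∑ z : Labels n k, (∏ l, τ l (z l)) * ind z i a = τ i a := by
  have h1 : ∀ z : Labels n k, (∏ l, τ l (z l)) * ind z i a =
      ∏ l, (τ l (z l) * (if l = i then ind z l a else 1)) := by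
    intro z
    rw [Finset.prod_mul_distrib, Finset.prod_ite_eq' Finset.univ i (fun l => ind z l a)]
    simp
  rw [Finset.sum_congr rfl fun z _ => h1 z]
  simp only [ind]
  rw [← Fintype.prod_sum (fun l x => τ l x * (if l = i then (if x = a then (1 : ℝ) else 0) else 1))]
  have h2 : ∀ l, ∑ x, τ l x * (if l = i then (if x = a then (1 : ℝ) else 0) else 1) =
      if l = i then τ l a else 1 := by
    intro l
    split_ifs with h <;> simp [hτ.sum_eq]
  rw [Finset.prod_congr rfl fun l _ => h2 l]
  simp

lemma sum_prod_ind_mul_ind {n k : ℕ} {τ : Fin n → Fin k → ℝ} (hτ : IsWeights τ) {i j : Fin n}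
    (hij : i ≠ j) (a b : Fin k) :
    ∑ z : Labels n k, (∏ l, τ l (z l)) * (ind z i a * ind z j b) = τ i a * τ j b := by
  have h1 : ∀ z : Labels n k, (∏ l, τ l (z l)) * (ind z i a * ind z j b) =
      ∏ l, (τ l (z l) * ((if l = i then ind z l a else 1) * (if l = j then ind z l b else 1))) := by
    intro z
    rw [Finset.prod_mul_distrib, Finset.prod_mul_distrib,
      Finset.prod_ite_eq' Finset.univ i (fun l => ind z l a),
      Finset.prod_ite_eq' Finset.univ j (fun l => ind z l b)]
    simp
  rw [Finset.sum_congr rfl fun z _ => h1 z]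
  simp only [ind]
  rw [← Fintype.prod_sum (fun l x => τ l x * ((if l = i then (if x = a then (1 : ℝ) else 0) else 1) *
    (if l = j then (if x = b then (1 : ℝ) else 0) else 1)))]
  have h2 : ∀ l, ∑ x, τ l x * ((if l = i then (if x = a then (1 : ℝ) else 0) else 1) *
    (if l = j then (if x = b then (1 : ℝ) else 0) else 1)) =
      (if l = i then τ l a else 1) * (if l = j then τ l b else 1) := by
    intro l
    by_cases h : l = i
    · have h' : l ≠ j := fun h' => hij (h.symm.trans h')
      simp [h, hij]
    · by_cases h' : l = j
      · simp [h', hij.symm]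
      · simp [h, h', hτ.sum_eq]
  rw [Finset.prod_congr rfl fun l _ => h2 l, Finset.prod_mul_distrib]
  simp

/-- The sum over the pairs `e` of the mean of `c e` under the community weights `τ` of the nodes
of `e`. -/
def pairSum {n k : ℕ} (τ : Fin n → Fin k → ℝ) (c : Pair n → Fin k → Fin k → ℝ) : ℝ :=
  ∑ e, ∑ a, ∑ b, pairWt τ a b e * c e a b

lemma pairSum_ind {n k : ℕ} (z : Labels n k) (c : Pair n → Fin k → Fin k → ℝ) :
    pairSum (ind z) c = ∑ e : Pair n, c e (z e.1.1) (z e.1.2) := by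
  refine Finset.sum_congr rfl fun e _ => ?_
  simp [pairWt, ind]

lemma sum_prod_pairWt {n k : ℕ} {τ : Fin n → Fin k → ℝ} (hτ : IsWeights τ) (a b : Fin k)
    (e : Pair n) :
    ∑ z : Labels n k, (∏ l, τ l (z l)) * pairWt (ind z) a b e = pairWt τ a b e :=
  sum_prod_ind_mul_ind hτ e.2.ne a b

lemma sum_prod_pairSum {n k : ℕ} {τ : Fin n → Fin k → ℝ} (hτ : IsWeights τ)
    (c : Pair n → Fin k → Fin k → ℝ) :
    ∑ z : Labels n k, (∏ l, τ l (z l)) * pairSum (ind z) c = pairSum τ c := by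
  simp only [pairSum, Finset.mul_sum]
  rw [Finset.sum_comm]
  refine Finset.sum_congr rfl fun e _ => ?_
  rw [Finset.sum_comm]
  refine Finset.sum_congr rfl fun a _ => ?_
  rw [Finset.sum_comm]
  refine Finset.sum_congr rfl fun b _ => ?_
  rw [← sum_prod_pairWt hτ, Finset.sum_mul]
  exact Finset.sum_congr rfl fun z _ => (mul_assoc _ _ _).symm

lemma pairWt_nonneg {n k : ℕ} {τ : Fin n → Fin k → ℝ} (hτ : IsWeights τ) (a b : Fin k)
    (e : Pair n) : 0 ≤ pairWt τ a b e :=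
  mul_nonneg (hτ.nonneg _ _) (hτ.nonneg _ _)

lemma pairSum_mono {n k : ℕ} {τ : Fin n → Fin k → ℝ} (hτ : IsWeights τ)
    {c d : Pair n → Fin k → Fin k → ℝ} (h : ∀ e a b, c e a b ≤ d e a b) :
    pairSum τ c ≤ pairSum τ d :=
  Finset.sum_le_sum fun e _ => Finset.sum_le_sum fun a _ => Finset.sum_le_sum fun b _ =>
    mul_le_mul_of_nonneg_left (h e a b) (pairWt_nonneg hτ a b e)

lemma pairSum_add {n k : ℕ} (τ : Fin n → Fin k → ℝ) (c d : Pair n → Fin k → Fin k → ℝ) :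
    pairSum τ (fun e a b => c e a b + d e a b) = pairSum τ c + pairSum τ d := by
  simp only [pairSum, mul_add, Finset.sum_add_distrib]

lemma pairSum_sub {n k : ℕ} (τ : Fin n → Fin k → ℝ) (c d : Pair n → Fin k → Fin k → ℝ) :
    pairSum τ (fun e a b => c e a b - d e a b) = pairSum τ c - pairSum τ d := by
  simp only [pairSum, mul_sub, Finset.sum_sub_distrib]

lemma pairSum_const_mul {n k : ℕ} (τ : Fin n → Fin k → ℝ) (x : ℝ)
    (c : Pair n → Fin k → Fin k → ℝ) :
    pairSum τ (fun e a b => x * c e a b) = x * pairSum τ c := by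
  simp only [pairSum, Finset.mul_sum, mul_left_comm]

lemma pairSum_fst {n k : ℕ} {τ : Fin n → Fin k → ℝ} (hτ : IsWeights τ)
    (c : Pair n → Fin k → ℝ) :
    pairSum τ (fun e a _ => c e a) = ∑ e : Pair n, ∑ a, τ e.1.1 a * c e a := by
  refine Finset.sum_congr rfl fun e _ => Finset.sum_congr rfl fun a _ => ?_
  rw [← Finset.sum_mul]
  simp only [pairWt, ← Finset.mul_sum, hτ.sum_eq, mul_one]

lemma pairSum_snd {n k : ℕ} {τ : Fin n → Fin k → ℝ} (hτ : IsWeights τ)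
    (c : Pair n → Fin k → ℝ) :
    pairSum τ (fun e _ b => c e b) = ∑ e : Pair n, ∑ b, τ e.1.2 b * c e b := by
  refine Finset.sum_congr rfl fun e _ => ?_
  rw [Finset.sum_comm]
  refine Finset.sum_congr rfl fun b _ => ?_
  rw [← Finset.sum_mul]
  simp only [pairWt, ← Finset.sum_mul, hτ.sum_eq, one_mul]

lemma pairSum_const {n k : ℕ} {τ : Fin n → Fin k → ℝ} (hτ : IsWeights τ) (c : Pair n → ℝ) :
    pairSum τ (fun e _ _ => c e) = ∑ e : Pair n, c e := by
  rw [pairSum_fst hτ fun e _ => c e]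
  simp only [← Finset.sum_mul, hτ.sum_eq, one_mul]

/-- The mean number of nodes whose label, drawn from `τ`, differs from the one given by `z`. -/
def softMismatch {n k : ℕ} (τ : Fin n → Fin k → ℝ) (z : Labels n k) : ℝ := ∑ i, (1 - τ i (z i))

lemma softMismatch_nonneg {n k : ℕ} {τ : Fin n → Fin k → ℝ} (hτ : IsWeights τ)
    (z : Labels n k) : 0 ≤ softMismatch τ z :=
  Finset.sum_nonneg fun i _ => sub_nonneg.2 (hτ.le_one i _)

lemma softMismatch_le {n k : ℕ} {τ : Fin n → Fin k → ℝ} (hτ : IsWeights τ)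
    (z : Labels n k) : softMismatch τ z ≤ n := by
  refine (Finset.sum_le_sum fun i _ => sub_le_self 1 (hτ.nonneg i (z i))).trans ?_
  simp

lemma sum_prod_mismatch {n k : ℕ} {τ : Fin n → Fin k → ℝ} (hτ : IsWeights τ)
    (zs : Labels n k) :
    ∑ z : Labels n k, (∏ l, τ l (z l)) * mismatch z zs = softMismatch τ zs := by
  have h : ∀ z : Labels n k, mismatch z zs = ∑ i, (1 - ind z i (zs i)) := by
    intro z
    refine Finset.sum_congr rfl fun i _ => ?_
    unfold ind
    split_ifs <;> norm_num
  simp only [h, Finset.mul_sum]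
  rw [Finset.sum_comm]
  refine Finset.sum_congr rfl fun i _ => ?_
  simp only [mul_sub, Finset.sum_sub_distrib, mul_one]
  rw [sum_prod_weights hτ, sum_prod_ind hτ]

/-- The two nodes of a pair are distinct, hence independent under the product law, so `pairWt τ` is
the mean of `pairWt (ind z)`. The mismatch averages to `softMismatch`. A bound for all hard
labellings therefore extends to soft weights with the same constant. -/
lemma abs_sum_pairWt_sub_le {n k : ℕ} {τ : Fin n → Fin k → ℝ} (hτ : IsWeights τ)
    (zs : Labels n k) (a b : Fin k) (N : Pair n → ℝ) (B : ℝ)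
    (h : ∀ z : Labels n k, |∑ e, (pairWt (ind z) a b e - pairWt (ind zs) a b e) * N e| ≤
      B * mismatch z zs) :
    |∑ e, (pairWt τ a b e - pairWt (ind zs) a b e) * N e| ≤ B * softMismatch τ zs := by
  have h1 : ∑ e, (pairWt τ a b e - pairWt (ind zs) a b e) * N e =
      ∑ z : Labels n k, (∏ l, τ l (z l)) *
        ∑ e, (pairWt (ind z) a b e - pairWt (ind zs) a b e) * N e := by
    simp only [Finset.mul_sum]
    rw [Finset.sum_comm]
    refine Finset.sum_congr rfl fun e _ => ?_
    simp only [← mul_assoc, ← Finset.sum_mul, mul_sub, Finset.sum_sub_distrib]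
    rw [sum_prod_pairWt hτ, sum_prod_weights hτ, one_mul]
  rw [h1, ← sum_prod_mismatch hτ, Finset.mul_sum]
  refine (Finset.abs_sum_le_sum_abs _ _).trans (Finset.sum_le_sum fun z _ => ?_)
  have hP : 0 ≤ ∏ l, τ l (z l) := Finset.prod_nonneg fun l _ => hτ.nonneg l _
  rw [abs_mul, abs_of_nonneg hP, mul_left_comm]
  exact mul_le_mul_of_nonneg_left (h z) hP

/-! ### The Bernoulli log-likelihood -/

/-- The mean log-likelihood of the parameter `x` under the Bernoulli law of parameter `q`. -/
def crossEnt (q x : ℝ) : ℝ := q * Real.log x + (1 - q) * Real.log (1 - x)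

/-- From `log x ≤ x - 1` at `√x / √q`. Summed over the two outcomes of a Bernoulli variable, it
bounds relative entropy below by the squared Hellinger distance. -/
lemma two_mul_sub_sqrt_le {q x : ℝ} (hq : 0 < q) (hx : 0 < x) :
    2 * (q - Real.sqrt q * Real.sqrt x) ≤ q * Real.log q - q * Real.log x := by
  have h1 := Real.log_le_sub_one_of_pos (div_pos (Real.sqrt_pos.2 hx) (Real.sqrt_pos.2 hq))
  rw [Real.log_div (Real.sqrt_pos.2 hx).ne' (Real.sqrt_pos.2 hq).ne', Real.log_sqrt hx.le,
    Real.log_sqrt hq.le] at h1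
  have h2 := mul_le_mul_of_nonneg_left h1 hq.le
  have h3 : q * (Real.sqrt x / Real.sqrt q - 1) = Real.sqrt q * Real.sqrt x - q := by
    have := Real.sqrt_pos.2 hq
    nth_rw 1 [← Real.mul_self_sqrt hq.le]
    field_simp
    rw [mul_sub, Real.mul_self_sqrt hq.le]
  linarith

lemma sq_sub_le_sq_sqrt_sub {q x : ℝ} (hq : 0 ≤ q) (hq1 : q ≤ 1) (hx : 0 ≤ x) (hx1 : x ≤ 1) :
    (q - x) ^ 2 ≤ 4 * (Real.sqrt q - Real.sqrt x) ^ 2 := by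
  have h1 : q - x = (Real.sqrt q - Real.sqrt x) * (Real.sqrt q + Real.sqrt x) := by
    nth_rw 1 [← Real.sq_sqrt hq, ← Real.sq_sqrt hx]
    ring
  have h2 : Real.sqrt q ≤ 1 := Real.sqrt_le_one.2 hq1
  have h3 : Real.sqrt x ≤ 1 := Real.sqrt_le_one.2 hx1
  rw [h1, mul_pow, mul_comm]
  have h4 : (Real.sqrt q + Real.sqrt x) ^ 2 ≤ 2 ^ 2 :=
    pow_le_pow_left₀ (by positivity) (by linarith) 2
  nlinarith [sq_nonneg (Real.sqrt q - Real.sqrt x)]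

lemma crossEnt_gap {q x : ℝ} (hq : 0 < q) (hq1 : q < 1) (hx : 0 < x) (hx1 : x < 1) :
    1 / 4 * (q - x) ^ 2 ≤ crossEnt q q - crossEnt q x := by
  have h1 := two_mul_sub_sqrt_le hq hx
  have h2 := two_mul_sub_sqrt_le (sub_pos.2 hq1) (sub_pos.2 hx1)
  have h3 := sq_sub_le_sq_sqrt_sub hq.le hq1.le hx.le hx1.le
  have e1 := Real.sq_sqrt hq.le
  have e2 := Real.sq_sqrt hx.le
  have e3 := Real.sq_sqrt (sub_pos.2 hq1).le
  have e4 := Real.sq_sqrt (sub_pos.2 hx1).le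
  have h5 := sq_nonneg (Real.sqrt (1 - q) - Real.sqrt (1 - x))
  unfold crossEnt
  nlinarith

lemma abs_log_sub_log_le {l x y : ℝ} (hl : 0 < l) (hx : l ≤ x) (hy : l ≤ y) :
    |Real.log x - Real.log y| ≤ |x - y| / l := by
  have key : ∀ {u v : ℝ}, l ≤ u → l ≤ v → Real.log u - Real.log v ≤ |u - v| / l := by
    intro u v hu hv
    have hu0 := hl.trans_le hu
    have hv0 := hl.trans_le hv
    rw [← Real.log_div hu0.ne' hv0.ne']
    refine (Real.log_le_sub_one_of_pos (div_pos hu0 hv0)).trans ?_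
    rw [div_sub_one hv0.ne']
    calc (u - v) / v ≤ |u - v| / v := by gcongr; exact le_abs_self _
      _ ≤ |u - v| / l := by gcongr
  rw [abs_le]
  constructor
  · have := key hy hx
    rw [abs_sub_comm] at this
    linarith
  · exact key hx hy

lemma abs_crossEnt_sub_le {l q x y : ℝ} (hl : 0 < l) (hq : 0 ≤ q) (hq1 : q ≤ 1)
    (hx : x ∈ Set.Icc l (1 - l)) (hy : y ∈ Set.Icc l (1 - l)) :
    |crossEnt q x - crossEnt q y| ≤ |x - y| / l := by
  have h1 := abs_log_sub_log_le hl hx.1 hy.1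
  have h2 := abs_log_sub_log_le hl (le_sub_comm.1 hx.2) (le_sub_comm.1 hy.2)
  rw [show (1 - x) - (1 - y) = -(x - y) by ring, abs_neg] at h2
  have h3 : crossEnt q x - crossEnt q y = q * (Real.log x - Real.log y) +
    (1 - q) * (Real.log (1 - x) - Real.log (1 - y)) := by unfold crossEnt; ring
  rw [h3]
  refine (abs_add_le _ _).trans ?_
  rw [abs_mul, abs_mul, abs_of_nonneg hq, abs_of_nonneg (sub_nonneg.2 hq1)]
  have := mul_le_mul_of_nonneg_left h1 hq
  have := mul_le_mul_of_nonneg_left h2 (sub_nonneg.2 hq1)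
  linarith

lemma abs_log_le {l x : ℝ} (hl : 0 < l) (hx : l ≤ x) (hx1 : x ≤ 1) :
    |Real.log x| ≤ -Real.log l := by
  rw [abs_of_nonpos (Real.log_nonpos (hl.le.trans hx) hx1)]
  exact neg_le_neg (Real.log_le_log hl hx)

/-! ### The log-likelihood of random labels -/

/-- The mean of the log-likelihood under the product distribution of weights `τ`. -/
def softLik {n k : ℕ} (A X : PairMat n) (τ : Fin n → Fin k → ℝ) (Q : SymMat k) : ℝ :=
  pairSum τ fun e a b => val (X e) *
    (val (A e) * Real.log (Q.1 a b) + (1 - val (A e)) * Real.log (1 - Q.1 a b))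

lemma softLik_ind {n k : ℕ} (A X : PairMat n) (z : Labels n k) (Q : SymMat k) :
    softLik A X (ind z) Q = logLik A X z Q := pairSum_ind _ _

lemma sum_prod_logLik {n k : ℕ} (A X : PairMat n) {τ : Fin n → Fin k → ℝ} (hτ : IsWeights τ)
    (Q : SymMat k) :
    ∑ z : Labels n k, (∏ l, τ l (z l)) * logLik A X z Q = softLik A X τ Q := by
  simp only [← softLik_ind]
  exact sum_prod_pairSum hτ _

/-- The noise accumulated between the communities `a` and `b`. -/
def noiseSum {n k : ℕ} (Qs : SymMat k) (p : ℝ) (zs : Labels n k) (A X : PairMat n)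
    (τ : Fin n → Fin k → ℝ) (s : Bool) (a b : Fin k) : ℝ :=
  ∑ e, pairWt τ a b e * noise Qs p zs A X s e

/-- The contribution of the noise to the log-likelihood. -/
def noiseLik {n k : ℕ} (Qs : SymMat k) (p : ℝ) (zs : Labels n k) (A X : PairMat n)
    (τ : Fin n → Fin k → ℝ) (Q : SymMat k) : ℝ :=
  ∑ a, ∑ b, (Real.log (Q.1 a b) * noiseSum Qs p zs A X τ true a b +
    Real.log (1 - Q.1 a b) * noiseSum Qs p zs A X τ false a b)

/-- Splits the likelihood into its conditional expectation given `zs` and a part linear in the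
noise. Both values of `s` occur because observed ones and observed zeros carry different logarithms.
-/
lemma softLik_eq {n k : ℕ} (Qs : SymMat k) (p : ℝ) (zs : Labels n k) (A X : PairMat n)
    (τ : Fin n → Fin k → ℝ) (Q : SymMat k) :
    softLik A X τ Q =
      p * pairSum τ (fun e a b => crossEnt (Qs.1 (zs e.1.1) (zs e.1.2)) (Q.1 a b)) +
      noiseLik Qs p zs A X τ Q := by
  have h1 : noiseLik Qs p zs A X τ Q = pairSum τ fun e a b =>
      Real.log (Q.1 a b) * noise Qs p zs A X true e +
      Real.log (1 - Q.1 a b) * noise Qs p zs A X false e := by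
    simp only [noiseLik, noiseSum, pairSum, Finset.mul_sum, ← Finset.sum_add_distrib]
    symm
    rw [Finset.sum_comm]
    refine Finset.sum_congr rfl fun a _ => ?_
    rw [Finset.sum_comm]
    refine Finset.sum_congr rfl fun b _ => Finset.sum_congr rfl fun e _ => ?_
    ring
  rw [h1, ← pairSum_const_mul, ← pairSum_add, softLik]
  congr 1
  funext e a b
  simp only [noise, crossEnt, if_true, Bool.false_eq_true, if_false]
  ring

lemma abs_sum_log_mul_le {k : ℕ} {l D : ℝ} (hl : 0 < l) (Q : SymMat k)
    (hQ : ∀ a b, Q.1 a b ∈ Set.Icc l (1 - l)) (f g : Fin k → Fin k → ℝ)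
    (hf : ∀ a b, |f a b| ≤ D) (hg : ∀ a b, |g a b| ≤ D) :
    |∑ a, ∑ b, (Real.log (Q.1 a b) * f a b + Real.log (1 - Q.1 a b) * g a b)| ≤
      2 * k ^ 2 * -Real.log l * D := by
  have h1 : ∀ a b, |Real.log (Q.1 a b) * f a b + Real.log (1 - Q.1 a b) * g a b| ≤
      2 * (-Real.log l * D) := by
    intro a b
    have h := hQ a b
    have e1 := abs_log_le hl h.1 (by linarith [h.2])
    have e2 := abs_log_le hl (le_sub_comm.1 h.2) (by linarith [h.1])
    refine (abs_add_le _ _).trans ?_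
    rw [abs_mul, abs_mul, two_mul]
    have h0 : 0 ≤ -Real.log l := (abs_nonneg _).trans e1
    gcongr
    · exact hf a b
    · exact hg a b
  calc _ ≤ ∑ a, ∑ b, |Real.log (Q.1 a b) * f a b + Real.log (1 - Q.1 a b) * g a b| :=
        (Finset.abs_sum_le_sum_abs _ _).trans
          (Finset.sum_le_sum fun a _ => Finset.abs_sum_le_sum_abs _ _)
    _ ≤ ∑ _a : Fin k, ∑ _b : Fin k, 2 * (-Real.log l * D) :=
        Finset.sum_le_sum fun a _ => Finset.sum_le_sum fun b _ => h1 a b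
    _ = _ := by
        simp only [Finset.sum_const, Finset.card_univ, Fintype.card_fin, nsmul_eq_mul]
        ring

lemma GoodEvent.abs_noiseSum_sub_le {n k : ℕ} {α : Simplex k} {Qs : SymMat k} {p ε t : ℝ}
    {zs : Labels n k} {A X : PairMat n} (hG : GoodEvent α Qs p ε t zs A X)
    {τ : Fin n → Fin k → ℝ} (hτ : IsWeights τ) (s : Bool) (a b : Fin k) :
    |noiseSum Qs p zs A X τ s a b - noiseSum Qs p zs A X (ind zs) s a b| ≤
      ε * (n * p) * softMismatch τ zs := by
  have h := abs_sum_pairWt_sub_le hτ zs a b (noise Qs p zs A X s) (ε * (n * p))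
    fun z => hG.diff z s a b
  simpa only [noiseSum, sub_mul, Finset.sum_sub_distrib] using h

lemma GoodEvent.abs_noiseLik_sub_le {n k : ℕ} {α : Simplex k} {Qs : SymMat k} {p ε t l : ℝ}
    {zs : Labels n k} {A X : PairMat n} (hG : GoodEvent α Qs p ε t zs A X)
    {τ : Fin n → Fin k → ℝ} (hτ : IsWeights τ) (hl : 0 < l) (Q : SymMat k)
    (hQ : ∀ a b, Q.1 a b ∈ Set.Icc l (1 - l)) :
    |noiseLik Qs p zs A X τ Q - noiseLik Qs p zs A X (ind zs) Q| ≤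
      2 * k ^ 2 * -Real.log l * (ε * (n * p) * softMismatch τ zs) := by
  have h := abs_sum_log_mul_le hl Q hQ _ _ (hG.abs_noiseSum_sub_le hτ true)
    (hG.abs_noiseSum_sub_le hτ false)
  have e : noiseLik Qs p zs A X τ Q - noiseLik Qs p zs A X (ind zs) Q = ∑ a, ∑ b,
      (Real.log (Q.1 a b) * (noiseSum Qs p zs A X τ true a b -
        noiseSum Qs p zs A X (ind zs) true a b) +
      Real.log (1 - Q.1 a b) * (noiseSum Qs p zs A X τ false a b -
        noiseSum Qs p zs A X (ind zs) false a b)) := by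
    simp only [noiseLik, ← Finset.sum_sub_distrib]
    refine Finset.sum_congr rfl fun a _ => Finset.sum_congr rfl fun b _ => ?_
    ring
  rw [e]
  exact h

lemma GoodEvent.abs_noiseLik_ind_le {n k : ℕ} {α : Simplex k} {Qs : SymMat k} {p ε t l : ℝ}
    {zs : Labels n k} {A X : PairMat n} (hG : GoodEvent α Qs p ε t zs A X)
    (hl : 0 < l) (Q : SymMat k) (hQ : ∀ a b, Q.1 a b ∈ Set.Icc l (1 - l)) :
    |noiseLik Qs p zs A X (ind zs) Q| ≤ 2 * k ^ 2 * -Real.log l * t :=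
  abs_sum_log_mul_le hl Q hQ _ _ (hG.base true) (hG.base false)

lemma logLik_sub_softLik_eq {n k : ℕ} (Qs : SymMat k) (p : ℝ) (zs : Labels n k)
    (A X : PairMat n) {τ : Fin n → Fin k → ℝ} (hτ : IsWeights τ) (Q Q' : SymMat k) :
    logLik A X zs Q' - softLik A X τ Q =
      p * pairSum τ (fun e a b => crossEnt (Qs.1 (zs e.1.1) (zs e.1.2)) (Q'.1 (zs e.1.1) (zs e.1.2))
        - crossEnt (Qs.1 (zs e.1.1) (zs e.1.2)) (Q.1 a b)) +
      (noiseLik Qs p zs A X (ind zs) Q' - noiseLik Qs p zs A X τ Q) := by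
  rw [← softLik_ind, softLik_eq Qs p zs A X (ind zs), softLik_eq Qs p zs A X τ, pairSum_ind,
    pairSum_sub, pairSum_const hτ]
  ring

/-- The noise at the estimate is compared with the noise at `zs` for the same `Q`, where the crude
bound `softMismatch ≤ n` suffices. The two remaining noise terms, at `zs` with `Q` and with `Qs`,
account for `2 * t`. -/
lemma GoodEvent.global_gap {n k : ℕ} {α : Simplex k} {Qs : SymMat k} {p ε t l : ℝ}
    {zs : Labels n k} {A X : PairMat n} (hG : GoodEvent α Qs p ε t zs A X)
    {τ : Fin n → Fin k → ℝ} (hτ : IsWeights τ) (hl : 0 < l) (hl1 : l ≤ 1) (Q : SymMat k)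
    (hQ : ∀ a b, Q.1 a b ∈ Set.Icc l (1 - l)) (hQs : ∀ a b, Qs.1 a b ∈ Set.Icc l (1 - l))
    (hp : 0 ≤ p) (hε : 0 ≤ ε) :
    p * (1 / 4 * pairSum τ (fun e a b => (Qs.1 (zs e.1.1) (zs e.1.2) - Q.1 a b) ^ 2)) ≤
      logLik A X zs Qs - softLik A X τ Q +
        2 * k ^ 2 * -Real.log l * (2 * t + ε * (n ^ 2 * p)) := by
  rw [logLik_sub_softLik_eq Qs p zs A X hτ Q Qs]
  have h1 := (abs_le.1 (hG.abs_noiseLik_sub_le hτ hl Q hQ)).2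
  have h2 := (abs_le.1 (hG.abs_noiseLik_ind_le hl Q hQ)).2
  have h3 := (abs_le.1 (hG.abs_noiseLik_ind_le hl Qs hQs)).1
  have h4 : p * (1 / 4 * pairSum τ (fun e a b => (Qs.1 (zs e.1.1) (zs e.1.2) - Q.1 a b) ^ 2)) ≤
      p * pairSum τ (fun e a b => crossEnt (Qs.1 (zs e.1.1) (zs e.1.2))
        (Qs.1 (zs e.1.1) (zs e.1.2)) - crossEnt (Qs.1 (zs e.1.1) (zs e.1.2)) (Q.1 a b)) := by
    refine mul_le_mul_of_nonneg_left ?_ hp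
    rw [← pairSum_const_mul]
    refine pairSum_mono hτ fun e a b => ?_
    have a1 := hQs (zs e.1.1) (zs e.1.2)
    have a2 := hQ a b
    exact crossEnt_gap (by linarith [a1.1]) (by linarith [a1.2]) (by linarith [a2.1])
      (by linarith [a2.2])
  have h5 : 2 * k ^ 2 * -Real.log l * (ε * (n * p) * softMismatch τ zs) ≤
      2 * k ^ 2 * -Real.log l * (ε * (n ^ 2 * p)) := by
    have := softMismatch_le hτ zs
    have h0 : 0 ≤ -Real.log l := neg_nonneg.2 (Real.log_nonpos hl.le hl1)
    refine mul_le_mul_of_nonneg_left ?_ (by positivity)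
    calc ε * (n * p) * softMismatch τ zs ≤ ε * (n * p) * n := by gcongr
      _ = _ := by ring
  linarith

lemma pairSum_sum_compl_le {n k : ℕ} {τ : Fin n → Fin k → ℝ} (hτ : IsWeights τ)
    (zs : Labels n k) :
    pairSum τ (fun e a b => (1 - ind zs e.1.1 a) + (1 - ind zs e.1.2 b)) ≤
      n * softMismatch τ zs := by
  rw [pairSum_add τ (fun e a _ => 1 - ind zs e.1.1 a) (fun e _ b => 1 - ind zs e.1.2 b),
    pairSum_fst hτ (fun e a => 1 - ind zs e.1.1 a), pairSum_snd hτ (fun e b => 1 - ind zs e.1.2 b),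
    ← Finset.sum_add_distrib]
  refine le_of_eq_of_le ?_ (sum_pair_add_le (fun i => 1 - τ i (zs i))
    fun i => sub_nonneg.2 (hτ.le_one i _))
  refine Finset.sum_congr rfl fun e _ => ?_
  simp [mul_sub, Finset.sum_sub_distrib, hτ.sum_eq, ind]

/-- Here both likelihoods use the same `Q`, so the base noise `t` cancels and every error is
proportional to `softMismatch`. This linearity is what permits exact recovery. -/
lemma GoodEvent.local_gap {n k : ℕ} {α : Simplex k} {Qs : SymMat k} {p ε t l η : ℝ}
    {zs : Labels n k} {A X : PairMat n} (hG : GoodEvent α Qs p ε t zs A X)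
    {τ : Fin n → Fin k → ℝ} (hτ : IsWeights τ) (hl : 0 < l) (Q : SymMat k)
    (hQ : ∀ a b, Q.1 a b ∈ Set.Icc l (1 - l)) (hQs : ∀ a b, Qs.1 a b ∈ Set.Icc l (1 - l))
    (hp : 0 ≤ p) (hη : ∀ a b, |Q.1 a b - Qs.1 a b| ≤ η) :
    p * (1 / 4 * pairSum τ (fun e a b => (Qs.1 (zs e.1.1) (zs e.1.2) - Qs.1 a b) ^ 2)) -
      p * (2 * η / l * (n * softMismatch τ zs)) -
        2 * k ^ 2 * -Real.log l * (ε * (n * p) * softMismatch τ zs) ≤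
      logLik A X zs Q - softLik A X τ Q := by
  rw [logLik_sub_softLik_eq Qs p zs A X hτ Q Q]
  have h1 := (abs_le.1 (hG.abs_noiseLik_sub_le hτ hl Q hQ)).2
  have h4 : pairSum τ (fun e a b => 1 / 4 * (Qs.1 (zs e.1.1) (zs e.1.2) - Qs.1 a b) ^ 2 -
        2 * η / l * ((1 - ind zs e.1.1 a) + (1 - ind zs e.1.2 b))) ≤
      pairSum τ (fun e a b => crossEnt (Qs.1 (zs e.1.1) (zs e.1.2))
        (Q.1 (zs e.1.1) (zs e.1.2)) - crossEnt (Qs.1 (zs e.1.1) (zs e.1.2)) (Q.1 a b)) := by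
    refine pairSum_mono hτ fun e a b => ?_
    -- Where both labels are correct, the two cross entropies coincide. The loss `2 η / l` from
    -- replacing `Q` by `Qs` is thus paid only when an endpoint is wrong.
    by_cases hab : zs e.1.1 = a ∧ zs e.1.2 = b
    · obtain ⟨rfl, rfl⟩ := hab
      simp [ind]
    have a1 := hQs (zs e.1.1) (zs e.1.2)
    have a2 := hQs a b
    set q := Qs.1 (zs e.1.1) (zs e.1.2) with hq
    have hq0 : 0 < q := by linarith [a1.1]
    have hq1 : q < 1 := by linarith [a1.2]
    have g1 := crossEnt_gap hq0 hq1 (by linarith [a2.1] : 0 < Qs.1 a b) (by linarith [a2.2])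
    have g2 := abs_crossEnt_sub_le hl hq0.le hq1.le (hQ a b) (hQs a b)
    have g3 := abs_crossEnt_sub_le hl hq0.le hq1.le (hQ (zs e.1.1) (zs e.1.2)) a1
    have g4 : |Q.1 a b - Qs.1 a b| / l ≤ η / l := by gcongr; exact hη a b
    have g5 : |Q.1 (zs e.1.1) (zs e.1.2) - q| / l ≤ η / l := by gcongr; exact hη _ _
    have g6 := (abs_le.1 (g2.trans g4)).2
    have g7 := (abs_le.1 (g3.trans g5)).1
    have hη0 : 0 ≤ 2 * η / l :=
      div_nonneg (mul_nonneg two_pos.le ((abs_nonneg _).trans (hη a b))) hl.le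
    have g8 : 1 ≤ (1 - ind zs e.1.1 a) + (1 - ind zs e.1.2 b) := by
      unfold ind
      split_ifs with c1 c2
      · exact absurd ⟨c1, c2⟩ hab
      all_goals norm_num
    have g9 := mul_le_mul_of_nonneg_left g8 hη0
    have g10 : 2 * η / l = η / l + η / l := by ring
    linarith
  rw [pairSum_sub, pairSum_const_mul, pairSum_const_mul τ (2 * η / l)
    (fun e a b => (1 - ind zs e.1.1 a) + (1 - ind zs e.1.2 b))] at h4
  -- Nonnegativity of `η` is read off from an existing entry of the matrices. Without nodes there
  -- may be none, but then the sum is empty.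
  have h5 : 0 ≤ 2 * η / l ∨ n = 0 := by
    rcases Nat.eq_zero_or_pos n with h | h
    · exact Or.inr h
    · exact Or.inl (div_nonneg (mul_nonneg two_pos.le ((abs_nonneg _).trans
        (hη (zs ⟨0, h⟩) (zs ⟨0, h⟩)))) hl.le)
  have h6 := pairSum_sum_compl_le hτ zs
  have h7 : 2 * η / l * pairSum τ (fun e a b => (1 - ind zs e.1.1 a) + (1 - ind zs e.1.2 b)) ≤
      2 * η / l * (n * softMismatch τ zs) := by
    rcases h5 with h5 | rfl
    · exact mul_le_mul_of_nonneg_left h6 h5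
    · have : IsEmpty (Pair 0) := ⟨fun e => e.1.1.elim0⟩
      simp [pairSum]
  have h8 := mul_le_mul_of_nonneg_left (le_trans (sub_le_sub_left h7 _) h4) hp
  linarith

/-! ### Identification of the communities -/

/-- The mean squared difference of `M (z i) (z j)` and `Q a b`, for `a` and `b` drawn from the
weights of the nodes `i` and `j`. -/
def sqDiff {n k : ℕ} (M Q : Matrix (Fin k) (Fin k) ℝ) (z : Labels n k)
    (τ : Fin n → Fin k → ℝ) (i j : Fin n) : ℝ :=
  ∑ a, ∑ b, τ i a * τ j b * (M (z i) (z j) - Q a b) ^ 2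

lemma sqDiff_symm {n k : ℕ} (M Q : SymMat k) (z : Labels n k) (τ : Fin n → Fin k → ℝ)
    (i j : Fin n) : sqDiff M.1 Q.1 z τ i j = sqDiff M.1 Q.1 z τ j i := by
  rw [sqDiff, sqDiff, Finset.sum_comm]
  refine Finset.sum_congr rfl fun a _ => Finset.sum_congr rfl fun b _ => ?_
  rw [M.2.apply (z j) (z i), Q.2.apply a b, mul_comm (τ i b)]

lemma two_mul_pairSum_sq {n k : ℕ} (M Q : SymMat k) (z : Labels n k) (τ : Fin n → Fin k → ℝ) :
    2 * pairSum τ (fun e a b => (M.1 (z e.1.1) (z e.1.2) - Q.1 a b) ^ 2) =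
      ∑ i, ∑ j, if i = j then 0 else sqDiff M.1 Q.1 z τ i j :=
  (sum_pair_symm _ (sqDiff_symm M Q z τ)).symm

lemma sqDiff_nonneg {n k : ℕ} (M Q : Matrix (Fin k) (Fin k) ℝ) (z : Labels n k)
    {τ : Fin n → Fin k → ℝ} (hτ : IsWeights τ) (i j : Fin n) : 0 ≤ sqDiff M Q z τ i j :=
  Finset.sum_nonneg fun a _ => Finset.sum_nonneg fun b _ =>
    mul_nonneg (mul_nonneg (hτ.nonneg i a) (hτ.nonneg j b)) (sq_nonneg _)

lemma sqDiff_le_one {n k : ℕ} (M Q : Matrix (Fin k) (Fin k) ℝ) (z : Labels n k)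
    {τ : Fin n → Fin k → ℝ} (hτ : IsWeights τ) (i j : Fin n)
    (hM : ∀ a b, M a b ∈ Set.Icc (0 : ℝ) 1) (hQ : ∀ a b, Q a b ∈ Set.Icc (0 : ℝ) 1) :
    sqDiff M Q z τ i j ≤ 1 := by
  calc sqDiff M Q z τ i j ≤ ∑ a, ∑ b, τ i a * τ j b := by
        refine Finset.sum_le_sum fun a _ => Finset.sum_le_sum fun b _ => ?_
        refine mul_le_of_le_one_right (mul_nonneg (hτ.nonneg i a) (hτ.nonneg j b)) ?_
        rw [sq_le_one_iff_abs_le_one, abs_le]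
        have h1 := hM (z i) (z j)
        have h2 := hQ a b
        constructor <;> linarith [h1.1, h1.2, h2.1, h2.2]
    _ = 1 := by
        simp only [← Finset.mul_sum, hτ.sum_eq, mul_one]

lemma sum_sqDiff_le {n k : ℕ} (M Q : SymMat k) (z : Labels n k) {τ : Fin n → Fin k → ℝ}
    (hτ : IsWeights τ) (hM : ∀ a b, M.1 a b ∈ Set.Icc (0 : ℝ) 1)
    (hQ : ∀ a b, Q.1 a b ∈ Set.Icc (0 : ℝ) 1) :
    ∑ i, ∑ j, sqDiff M.1 Q.1 z τ i j ≤
      2 * pairSum τ (fun e a b => (M.1 (z e.1.1) (z e.1.2) - Q.1 a b) ^ 2) + n := by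
  rw [two_mul_pairSum_sq]
  have h : ∀ i j, sqDiff M.1 Q.1 z τ i j ≤
      (if i = j then 0 else sqDiff M.1 Q.1 z τ i j) + if i = j then 1 else 0 := by
    intro i j
    split_ifs
    · simpa using sqDiff_le_one M.1 Q.1 z hτ i j hM hQ
    · simp
  calc ∑ i, ∑ j, sqDiff M.1 Q.1 z τ i j ≤ ∑ i, ∑ j,
        ((if i = j then 0 else sqDiff M.1 Q.1 z τ i j) + if i = j then (1 : ℝ) else 0) :=
        Finset.sum_le_sum fun i _ => Finset.sum_le_sum fun j _ => h i j
    _ = _ := by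
        simp only [Finset.sum_add_distrib]
        simp

/-- The mean number of nodes of label `c` in `z` with a label `a` drawn from `τ`. -/
def confusion {n k : ℕ} (z : Labels n k) (τ : Fin n → Fin k → ℝ) (c a : Fin k) : ℝ :=
  ∑ i, ind z i c * τ i a

lemma ind_nonneg {n k : ℕ} (z : Labels n k) (i : Fin n) (a : Fin k) : 0 ≤ ind z i a :=
  (isWeights_ind z).nonneg i a

lemma confusion_nonneg {n k : ℕ} (z : Labels n k) {τ : Fin n → Fin k → ℝ} (hτ : IsWeights τ)
    (c a : Fin k) : 0 ≤ confusion z τ c a :=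
  Finset.sum_nonneg fun i _ => mul_nonneg (ind_nonneg z i c) (hτ.nonneg i a)

lemma sum_confusion {n k : ℕ} (z : Labels n k) {τ : Fin n → Fin k → ℝ} (hτ : IsWeights τ)
    (c : Fin k) : ∑ a, confusion z τ c a = ∑ i, ind z i c := by
  simp only [confusion]
  rw [Finset.sum_comm]
  simp only [← Finset.mul_sum, hτ.sum_eq, mul_one]

lemma confusion_mul_le {n k : ℕ} (M Q : Matrix (Fin k) (Fin k) ℝ) (z : Labels n k)
    {τ : Fin n → Fin k → ℝ} (hτ : IsWeights τ) (c d a b : Fin k) :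
    confusion z τ c a * confusion z τ d b * (M c d - Q a b) ^ 2 ≤
      ∑ i, ∑ j, sqDiff M Q z τ i j := by
  rw [confusion, confusion, Finset.sum_mul_sum, Finset.sum_mul]
  refine Finset.sum_le_sum fun i _ => ?_
  rw [Finset.sum_mul]
  refine Finset.sum_le_sum fun j _ => ?_
  by_cases h : z i = c ∧ z j = d
  · obtain ⟨rfl, rfl⟩ := h
    have h1 : ∑ b', τ i a * τ j b' * (M (z i) (z j) - Q a b') ^ 2 ≤ sqDiff M Q z τ i j :=
      Finset.single_le_sum
        (f := fun a' => ∑ b', τ i a' * τ j b' * (M (z i) (z j) - Q a' b') ^ 2)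
        (fun a' _ => Finset.sum_nonneg fun b' _ =>
          mul_nonneg (mul_nonneg (hτ.nonneg i a') (hτ.nonneg j b')) (sq_nonneg _))
        (Finset.mem_univ a)
    have h2 : τ i a * τ j b * (M (z i) (z j) - Q a b) ^ 2 ≤
        ∑ b', τ i a * τ j b' * (M (z i) (z j) - Q a b') ^ 2 :=
      Finset.single_le_sum (f := fun b' => τ i a * τ j b' * (M (z i) (z j) - Q a b') ^ 2)
        (fun b' _ => mul_nonneg (mul_nonneg (hτ.nonneg i a) (hτ.nonneg j b')) (sq_nonneg _))
        (Finset.mem_univ b)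
    simpa [ind] using h2.trans h1
  · have h0 : ind z i c * τ i a * (ind z j d * τ j b) = 0 := by
      rcases not_and_or.1 h with h | h <;> simp [ind, h]
    rw [h0, zero_mul]
    exact sqDiff_nonneg M Q z hτ i j

lemma softMismatch_eq {n k : ℕ} (z : Labels n k) {τ : Fin n → Fin k → ℝ} (hτ : IsWeights τ)
    (σ : Equiv.Perm (Fin k)) :
    softMismatch τ (fun i => σ (z i)) = ∑ c, ∑ a ∈ Finset.univ.erase (σ c), confusion z τ c a := by
  have h1 : ∀ i, 1 - τ i (σ (z i)) =
      ∑ c, ind z i c * ∑ a ∈ Finset.univ.erase (σ c), τ i a := by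
    intro i
    have : ∑ c, ind z i c * ∑ a ∈ Finset.univ.erase (σ c), τ i a =
        ∑ a ∈ Finset.univ.erase (σ (z i)), τ i a := by simp [ind]
    rw [this, ← hτ.sum_eq i, ← Finset.add_sum_erase _ _ (Finset.mem_univ (σ (z i)))]
    ring
  simp only [softMismatch, h1, confusion]
  rw [Finset.sum_comm]
  refine Finset.sum_congr rfl fun c _ => ?_
  simp only [Finset.mul_sum]
  rw [Finset.sum_comm]

/-- By pigeonhole each true community `d` has a label `f d` carrying a fair share of its weight.
Pairs of nodes with these labels are so numerous that `Q (f a) (f b)` must be close to `M a b`.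
Since the rows of `M` are `γ`-separated, `f` is injective, hence a permutation. Weight on any other
label would again create a large squared difference. -/
lemma exists_perm_of_sum_sqDiff_le {n k : ℕ} (M Q : Matrix (Fin k) (Fin k) ℝ) (z : Labels n k)
    {τ : Fin n → Fin k → ℝ} (hτ : IsWeights τ) {c γ δ ρ : ℝ} (hc : 0 < c) (hγ : 0 < γ)
    (hδ : 0 < δ) (hn : (0 : ℝ) < n) (hk : (0 : ℝ) < k)
    (hfreq : ∀ a, c * n ≤ ∑ i, ind z i a)
    (hM : ∀ a a', a ≠ a' → ∃ b, γ ≤ |M a b - M a' b|)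
    (hρ : ρ * k ^ 2 ≤ c ^ 2 * δ ^ 2) (hρ' : ρ * k ^ 2 ≤ c ^ 2 * (γ / 3) ^ 2)
    (hρ'' : 4 * k ^ 3 * ρ ≤ δ * (c * γ ^ 2))
    (hS : ∑ i, ∑ j, sqDiff M Q z τ i j ≤ ρ * n ^ 2) :
    ∃ σ : Equiv.Perm (Fin k), (∀ a b, |Q (σ a) (σ b) - M a b| ≤ δ) ∧
      softMismatch τ (fun i => σ (z i)) ≤ δ * n := by
  have hmax : ∀ d, ∃ a, c * n / k ≤ confusion z τ d a := by
    intro d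
    by_contra! hcon
    have h1 : ∑ a, confusion z τ d a ≤ ∑ _a : Fin k, c * n / k :=
      Finset.sum_le_sum fun a _ => (hcon a).le
    have h2 : ∑ a, confusion z τ d a < ∑ _a : Fin k, c * n / k :=
      Finset.sum_lt_sum_of_nonempty ⟨d, Finset.mem_univ d⟩ fun a _ => hcon a
    rw [sum_confusion z hτ] at h2
    have h3 : ∑ _a : Fin k, c * n / k = c * n := by
      rw [Finset.sum_const, Finset.card_univ, Fintype.card_fin, nsmul_eq_mul]
      field_simp
    linarith [hfreq d]
  choose f hf using hmax
  have hckn : 0 < c * n / k := by positivity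
  -- Used with `y = γ / 3` to separate rows and with `y = δ` for the conclusion.
  have hclose : ∀ y : ℝ, 0 < y → ρ * k ^ 2 ≤ c ^ 2 * y ^ 2 → ∀ a b, |Q (f a) (f b) - M a b| ≤ y := by
    intro y hy hρy a b
    have h1 := (confusion_mul_le M Q z hτ a b (f a) (f b)).trans hS
    have h2 : (c * n / k) * (c * n / k) * (M a b - Q (f a) (f b)) ^ 2 ≤ ρ * n ^ 2 := by
      refine le_trans ?_ h1
      have := hf a
      have := hf b
      have := hckn.le.trans (hf a)
      gcongr
    have h3 : ρ * n ^ 2 ≤ (c * n / k) * (c * n / k) * y ^ 2 := by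
      rw [show (c * n / k) * (c * n / k) * y ^ 2 = c ^ 2 * y ^ 2 * n ^ 2 / k ^ 2 by ring,
        le_div_iff₀ (by positivity)]
      have := mul_le_mul_of_nonneg_right hρy (sq_nonneg (n : ℝ))
      linarith
    have h4 := le_of_mul_le_mul_left (h2.trans h3) (by positivity)
    rw [abs_sub_comm]
    exact abs_le_of_sq_le_sq h4 hy.le
  have hinj : Function.Injective f := by
    intro a a' haa
    by_contra hne
    obtain ⟨b, hb⟩ := hM a a' hne
    have h1 := hclose (γ / 3) (by linarith) hρ' a b
    have h2 := hclose (γ / 3) (by linarith) hρ' a' b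
    rw [← haa] at h2
    have h3 := abs_sub_le (M a b) (Q (f a) (f b)) (M a' b)
    rw [abs_sub_comm (M a b) (Q (f a) (f b))] at h3
    linarith
  let σ : Equiv.Perm (Fin k) := Equiv.ofBijective f (Finite.injective_iff_bijective.1 hinj)
  have hσ : ∀ a, σ a = f a := fun a => rfl
  refine ⟨σ, fun a b => hclose δ hδ hρ a b, ?_⟩
  rw [softMismatch_eq z hτ]
  -- A label `a ≠ σ d` belongs to the community `σ.symm a`. In a column `b` separating the two rows,
  -- `Q a (f b)` is within `γ / 3` of the row of `σ.symm a`, hence at least `γ / 2` away from the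
  -- row of `d`.
  have hterm : ∀ d, ∀ a ∈ Finset.univ.erase (σ d), confusion z τ d a ≤ δ * n / k ^ 2 := by
    intro d a ha
    have hne : a ≠ σ d := (Finset.mem_erase.1 ha).1
    have hne' : d ≠ σ.symm a := fun h => hne (by rw [h, Equiv.apply_symm_apply])
    obtain ⟨b, hb⟩ := hM _ _ hne'
    have h1 := (confusion_mul_le M Q z hτ d b a (f b)).trans hS
    have h2 := hclose (γ / 3) (by linarith) hρ' (σ.symm a) b
    rw [← hσ (σ.symm a), Equiv.apply_symm_apply] at h2
    have h3 := abs_sub_le (M d b) (Q a (f b)) (M (σ.symm a) b)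
    have h4 : γ / 2 ≤ |M d b - Q a (f b)| := by linarith
    have h5 : (γ / 2) ^ 2 ≤ (M d b - Q a (f b)) ^ 2 := by
      rw [← sq_abs (M d b - Q a (f b))]
      gcongr
    have h6 : confusion z τ d a * (c * n / k) * (γ / 2) ^ 2 ≤ ρ * n ^ 2 := by
      refine le_trans ?_ h1
      have := confusion_nonneg z hτ d a
      have := confusion_nonneg z hτ b (f b)
      gcongr
      exact hf b
    have h7 : ρ * n ^ 2 ≤ (δ * n / k ^ 2) * (c * n / k) * (γ / 2) ^ 2 := by
      rw [show (δ * n / k ^ 2) * (c * n / k) * (γ / 2) ^ 2 =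
        δ * (c * γ ^ 2) * n ^ 2 / (4 * k ^ 3) by ring, le_div_iff₀ (by positivity)]
      have := mul_le_mul_of_nonneg_right hρ'' (sq_nonneg (n : ℝ))
      linarith
    have h8 := h6.trans h7
    rw [mul_assoc, mul_assoc (δ * n / k ^ 2)] at h8
    exact le_of_mul_le_mul_right h8 (by positivity)
  calc ∑ d, ∑ a ∈ Finset.univ.erase (σ d), confusion z τ d a
      ≤ ∑ d, ∑ a ∈ Finset.univ.erase (σ d), δ * n / k ^ 2 :=
        Finset.sum_le_sum fun d _ => Finset.sum_le_sum fun a ha => hterm d a ha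
    _ ≤ ∑ _d : Fin k, ∑ _a : Fin k, δ * n / k ^ 2 :=
        Finset.sum_le_sum fun d _ => Finset.sum_le_sum_of_subset_of_nonneg
          (Finset.erase_subset _ _) fun _ _ _ => by positivity
    _ = δ * n := by
        simp only [Finset.sum_const, Finset.card_univ, Fintype.card_fin, nsmul_eq_mul]
        field_simp

/-- A wrong label `a` at `i` is detected in a column `b` separating the rows of `z i` and `a`. Of
the at least `N` nodes of community `b`, at most `softMismatch` of the weight is misplaced, and the
`- 1` accounts for `j = i`. -/
lemma le_sum_sqDiff_ne {n k : ℕ} (M : Matrix (Fin k) (Fin k) ℝ) (z : Labels n k)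
    {τ : Fin n → Fin k → ℝ} (hτ : IsWeights τ) {γ N : ℝ} (hγ : 0 < γ)
    (hfreq : ∀ a, N ≤ ∑ i, ind z i a)
    (hM : ∀ a a', a ≠ a' → ∃ b, γ ≤ |M a b - M a' b|) (i : Fin n) :
    γ ^ 2 * (N - softMismatch τ z - 1) * (1 - τ i (z i)) ≤
      ∑ j, if i = j then 0 else sqDiff M M z τ i j := by
  have h1 : ∀ j, (∑ a, τ i a * (if i = j then 0 else τ j (z j) * (M (z i) (z j) - M a (z j)) ^ 2)) ≤
      if i = j then 0 else sqDiff M M z τ i j := by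
    intro j
    split_ifs with h
    · simp
    · refine Finset.sum_le_sum fun a _ => ?_
      rw [← mul_assoc]
      exact Finset.single_le_sum (f := fun b => τ i a * τ j b * (M (z i) (z j) - M a b) ^ 2)
        (fun b _ => mul_nonneg (mul_nonneg (hτ.nonneg i a) (hτ.nonneg j b)) (sq_nonneg _))
        (Finset.mem_univ (z j))
  have h2 : ∀ a, a ≠ z i → γ ^ 2 * (N - softMismatch τ z - 1) ≤
      ∑ j, if i = j then 0 else τ j (z j) * (M (z i) (z j) - M a (z j)) ^ 2 := by
    intro a ha
    obtain ⟨b, hb⟩ := hM (z i) a ha.symm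
    have hb2 : γ ^ 2 ≤ (M (z i) b - M a b) ^ 2 := by
      rw [← sq_abs (M (z i) b - M a b)]
      gcongr
    have h3 : ∀ j, γ ^ 2 * (ind z j b - (1 - τ j (z j)) - if i = j then 1 else 0) ≤
        if i = j then 0 else τ j (z j) * (M (z i) (z j) - M a (z j)) ^ 2 := by
      intro j
      have ht0 := hτ.nonneg j (z j)
      have ht1 := hτ.le_one j (z j)
      have hi : ind z j b ≤ 1 := (isWeights_ind z).le_one j b
      split_ifs with hij
      · refine mul_nonpos_of_nonneg_of_nonpos (sq_nonneg γ) (by linarith)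
      · by_cases hz : z j = b
        · subst hz
          have : ind z j (z j) = 1 := by simp [ind]
          rw [this]
          calc γ ^ 2 * (1 - (1 - τ j (z j)) - 0) = τ j (z j) * γ ^ 2 := by ring
            _ ≤ _ := mul_le_mul_of_nonneg_left hb2 ht0
        · have : ind z j b = 0 := by simp [ind, hz]
          rw [this]
          refine le_trans (mul_nonpos_of_nonneg_of_nonpos (sq_nonneg γ) (by linarith)) ?_
          positivity
    refine le_trans ?_ (Finset.sum_le_sum fun j _ => h3 j)
    rw [← Finset.mul_sum]
    refine mul_le_mul_of_nonneg_left ?_ (sq_nonneg γ)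
    simp only [Finset.sum_sub_distrib]
    have := hfreq b
    simp only [softMismatch, Finset.sum_sub_distrib]
    simp
    linarith
  calc γ ^ 2 * (N - softMismatch τ z - 1) * (1 - τ i (z i))
      = ∑ a ∈ Finset.univ.erase (z i), τ i a * (γ ^ 2 * (N - softMismatch τ z - 1)) := by
        rw [← Finset.sum_mul, ← hτ.sum_eq i, ← Finset.add_sum_erase _ _ (Finset.mem_univ (z i))]
        ring
    _ ≤ ∑ a ∈ Finset.univ.erase (z i), τ i a *
          ∑ j, (if i = j then 0 else τ j (z j) * (M (z i) (z j) - M a (z j)) ^ 2) :=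
        Finset.sum_le_sum fun a ha => mul_le_mul_of_nonneg_left
          (h2 a (Finset.mem_erase.1 ha).1) (hτ.nonneg i a)
    _ ≤ ∑ a, τ i a *
          ∑ j, (if i = j then 0 else τ j (z j) * (M (z i) (z j) - M a (z j)) ^ 2) := by
        refine Finset.sum_le_sum_of_subset_of_nonneg (Finset.erase_subset _ _) fun a _ _ => ?_
        refine mul_nonneg (hτ.nonneg i a) (Finset.sum_nonneg fun j _ => ?_)
        split_ifs
        · exact le_rfl
        · exact mul_nonneg (hτ.nonneg j _) (sq_nonneg _)
    _ = ∑ j, ∑ a, τ i a *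
          (if i = j then 0 else τ j (z j) * (M (z i) (z j) - M a (z j)) ^ 2) := by
        simp only [Finset.mul_sum]
        rw [Finset.sum_comm]
    _ ≤ _ := Finset.sum_le_sum fun j _ => h1 j

lemma le_two_mul_pairSum_sq {n k : ℕ} (M : SymMat k) (z : Labels n k)
    {τ : Fin n → Fin k → ℝ} (hτ : IsWeights τ) {γ N : ℝ} (hγ : 0 < γ)
    (hfreq : ∀ a, N ≤ ∑ i, ind z i a)
    (hM : ∀ a a', a ≠ a' → ∃ b, γ ≤ |M.1 a b - M.1 a' b|) :
    γ ^ 2 * (N - softMismatch τ z - 1) * softMismatch τ z ≤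
      2 * pairSum τ (fun e a b => (M.1 (z e.1.1) (z e.1.2) - M.1 a b) ^ 2) := by
  rw [two_mul_pairSum_sq]
  conv_lhs => rw [softMismatch]
  rw [Finset.mul_sum]
  exact Finset.sum_le_sum fun i _ => le_sum_sqDiff_ne M.1 z hτ hγ hfreq hM i

/-! ### Relabelling the communities -/

/-- The matrix `Q` after a permutation of the communities. -/
def permMat {k : ℕ} (σ : Equiv.Perm (Fin k)) (Q : SymMat k) : SymMat k :=
  ⟨fun a b => Q.1 (σ a) (σ b), by
    ext a b
    exact Q.2.apply (σ a) (σ b)⟩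

/-- The probability vector `x` after a permutation of the communities. -/
def permSimplex {k : ℕ} (σ : Equiv.Perm (Fin k)) (x : Simplex k) : Simplex k :=
  ⟨fun a => x.1 (σ a), fun a => x.2.1 (σ a), (Equiv.sum_comp σ x.1).trans x.2.2⟩

lemma IsWeights.comp_perm {n k : ℕ} {τ : Fin n → Fin k → ℝ} (hτ : IsWeights τ)
    (σ : Equiv.Perm (Fin k)) : IsWeights fun i a => τ i (σ a) :=
  ⟨fun i a => hτ.nonneg i (σ a), fun i => (Equiv.sum_comp σ (τ i)).trans (hτ.sum_eq i)⟩

lemma logLik_permMat {n k : ℕ} (A X : PairMat n) (z : Labels n k) (σ : Equiv.Perm (Fin k))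
    (Q : SymMat k) : logLik A X z (permMat σ Q) = logLik A X (fun i => σ (z i)) Q := rfl

lemma softLik_permMat {n k : ℕ} (A X : PairMat n) (τ : Fin n → Fin k → ℝ)
    (σ : Equiv.Perm (Fin k)) (Q : SymMat k) :
    softLik A X (fun i a => τ i (σ a)) (permMat σ Q) = softLik A X τ Q := by
  refine Finset.sum_congr rfl fun e _ => ?_
  symm
  rw [← Equiv.sum_comp σ]
  refine Finset.sum_congr rfl fun a _ => ?_
  rw [← Equiv.sum_comp σ]
  rfl

/-! ### Separation of the true labels -/

lemma GoodEvent.le_sum_ind {n k : ℕ} {α : Simplex k} {Qs : SymMat k} {p ε t c : ℝ}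
    {zs : Labels n k} {A X : PairMat n} (hG : GoodEvent α Qs p ε t zs A X)
    (hα : ∀ a, c ≤ α.1 a) (hε : ε ≤ c / 2) (a : Fin k) : c / 2 * n ≤ ∑ i, ind zs i a := by
  have h1 := (abs_le.1 (hG.freq a)).1
  have h2 := mul_le_mul_of_nonneg_left (hα a) (Nat.cast_nonneg (α := ℝ) n)
  have h3 := mul_le_mul_of_nonneg_right hε (Nat.cast_nonneg (α := ℝ) n)
  linarith

/-- For small `ε`, label weights that nearly maximize the likelihood are close to the true labels,
up to a permutation. -/
lemma exists_global_separation (k : ℕ) {l c γ δ K : ℝ} (hk : (0 : ℝ) < k) (hl : 0 < l)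
    (hl1 : l ≤ 1) (hc : 0 < c) (hγ : 0 < γ) (hδ : 0 < δ) :
    ∃ ε₀ > 0, ∀ {n : ℕ} {α : Simplex k} {Qs : SymMat k} {p ε t : ℝ} {zs : Labels n k}
      {A X : PairMat n}, GoodEvent α Qs p ε t zs A X → 0 ≤ ε → ε ≤ ε₀ → (∀ a, c ≤ α.1 a) →
      (∀ a b, Qs.1 a b ∈ Set.Icc l (1 - l)) →
      (∀ a a', a ≠ a' → ∃ b, γ ≤ |Qs.1 a b - Qs.1 a' b|) →
      0 < p → (0 : ℝ) < n → t ≤ ε₀ * (n ^ 2 * p) → K ≤ ε₀ * (n * p) → 1 ≤ ε₀ * n →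
      ∀ {τ : Fin n → Fin k → ℝ}, IsWeights τ → ∀ Q : SymMat k,
      (∀ a b, Q.1 a b ∈ Set.Icc l (1 - l)) →
      logLik A X zs Qs - K * n ≤ softLik A X τ Q →
      ∃ σ : Equiv.Perm (Fin k), (∀ a b, |Q.1 (σ a) (σ b) - Qs.1 a b| ≤ δ) ∧
        softMismatch τ (fun i => σ (zs i)) ≤ δ * n := by
  set c' := c / 2 with hc'
  have hc'0 : 0 < c' := by positivity
  set ρ := min (c' ^ 2 * δ ^ 2 / k ^ 2) (min (c' ^ 2 * (γ / 3) ^ 2 / k ^ 2)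
    (δ * (c' * γ ^ 2) / (4 * k ^ 3))) with hρ
  have hρ0 : 0 < ρ := by
    refine lt_min (by positivity) (lt_min (by positivity) (by positivity))
  set B := -Real.log l with hB
  have hB0 : 0 ≤ B := neg_nonneg.2 (Real.log_nonpos hl.le hl1)
  -- The gap gives `P / 4 ≤ (1 + 6 k² B) ε₀ n²`, and the sum of squares is at most `2 P + n`. The
  -- final `+ 1` absorbs the diagonal term `n ≤ ε₀ n²`.
  set C := 8 * (1 + 6 * k ^ 2 * B) + 1 with hC
  have hC0 : 0 < C := by positivity
  refine ⟨min c' (ρ / C), lt_min hc'0 (by positivity), ?_⟩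
  intro n α Qs p ε t zs A X hG hε hε₀ hα hQs hM hp hn ht hK h1n τ hτ Q hQ hmax
  set ε₀ := min c' (ρ / C) with hε₀def
  have hfreq := hG.le_sum_ind hα (hε₀.trans (min_le_left _ _))
  have hbox : ∀ {R : SymMat k}, (∀ a b, R.1 a b ∈ Set.Icc l (1 - l)) →
      ∀ a b, R.1 a b ∈ Set.Icc (0 : ℝ) 1 := fun hR a b =>
    ⟨hl.le.trans (hR a b).1, (hR a b).2.trans (by linarith)⟩
  have h1 := hG.global_gap hτ hl hl1 Q hQ hQs hp.le hε
  have h2 := sum_sqDiff_le Qs Q zs hτ (hbox hQs) (hbox hQ)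
  set P := pairSum τ (fun e a b => (Qs.1 (zs e.1.1) (zs e.1.2) - Q.1 a b) ^ 2)
  have h3 : 2 * k ^ 2 * B * (2 * t + ε * (n ^ 2 * p)) ≤
      2 * k ^ 2 * B * (3 * (ε₀ * (n ^ 2 * p))) := by
    have : ε * (n ^ 2 * p) ≤ ε₀ * (n ^ 2 * p) := by gcongr
    refine mul_le_mul_of_nonneg_left (by linarith) (by positivity)
  have h4 : K * n ≤ ε₀ * (n * p) * n := mul_le_mul_of_nonneg_right hK hn.le
  have h5 : p * (1 / 4 * P) ≤ p * ((1 + 6 * k ^ 2 * B) * ε₀ * n ^ 2) := by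
    have : p * ((1 + 6 * k ^ 2 * B) * ε₀ * n ^ 2) =
      ε₀ * (n * p) * n + 2 * k ^ 2 * B * (3 * (ε₀ * (n ^ 2 * p))) := by ring
    rw [this]
    linarith
  have h6 := le_of_mul_le_mul_left h5 hp
  have h7 : (n : ℝ) ≤ ε₀ * n ^ 2 := by
    have := mul_le_mul_of_nonneg_right h1n hn.le
    linarith
  have h8 : ∑ i, ∑ j, sqDiff Qs.1 Q.1 zs τ i j ≤ ρ * n ^ 2 := by
    have h9 : ε₀ * C ≤ ρ := by
      rw [← le_div_iff₀ hC0]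
      exact min_le_right _ _
    have h10 := mul_le_mul_of_nonneg_right h9 (sq_nonneg (n : ℝ))
    have h11 : ε₀ * C * n ^ 2 = 8 * ((1 + 6 * k ^ 2 * B) * ε₀ * n ^ 2) + ε₀ * n ^ 2 := by
      rw [hC]
      ring
    linarith
  refine exists_perm_of_sum_sqDiff_le Qs.1 Q.1 zs hτ hc'0 hγ hδ hn hk hfreq hM ?_ ?_ ?_ h8
  · rw [← le_div_iff₀ (by positivity)]
    exact min_le_left _ _
  · rw [← le_div_iff₀ (by positivity)]
    exact (min_le_right _ _).trans (min_le_left _ _)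
  · rw [mul_comm, ← le_div_iff₀ (by positivity)]
    exact (min_le_right _ _).trans (min_le_right _ _)

/-- Close to the true parameters, the likelihood decreases linearly in the number of mismatched
labels. -/
lemma exists_local_separation (k : ℕ) {l c γ : ℝ} (hl : 0 < l) (hl1 : l ≤ 1) (hc : 0 < c)
    (hγ : 0 < γ) :
    ∃ ε₁ > 0, ∃ c₂ > 0, ∀ {n : ℕ} {α : Simplex k} {Qs : SymMat k} {p ε t : ℝ} {zs : Labels n k}
      {A X : PairMat n}, GoodEvent α Qs p ε t zs A X → ε ≤ ε₁ → (∀ a, c ≤ α.1 a) →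
      (∀ a b, Qs.1 a b ∈ Set.Icc l (1 - l)) →
      (∀ a a', a ≠ a' → ∃ b, γ ≤ |Qs.1 a b - Qs.1 a' b|) →
      0 ≤ p → 1 ≤ ε₁ * n →
      ∀ {τ : Fin n → Fin k → ℝ}, IsWeights τ → ∀ Q : SymMat k,
      (∀ a b, Q.1 a b ∈ Set.Icc l (1 - l)) → (∀ a b, |Q.1 a b - Qs.1 a b| ≤ ε₁) →
      softMismatch τ zs ≤ ε₁ * n →
      c₂ * (n * p) * softMismatch τ zs ≤ logLik A X zs Q - softLik A X τ Q := by
  set c' := c / 2 with hc'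
  have hc'0 : 0 < c' := by positivity
  set B := -Real.log l with hB
  have hB0 : 0 ≤ B := neg_nonneg.2 (Real.log_nonpos hl.le hl1)
  -- `D` collects the two errors of `local_gap`, from the distance of `Q` to `Qs` and from the
  -- noise. The signal is `γ² c' / 16` per unit of `n p m`, and `ε₁ D` may consume at most half of
  -- it.
  set D := 2 / l + 2 * k ^ 2 * B with hD
  have hD0 : 0 < D := by positivity
  refine ⟨min (c' / 4) (γ ^ 2 * c' / 32 / D), lt_min (by positivity) (by positivity),
    γ ^ 2 * c' / 32, by positivity, ?_⟩
  intro n α Qs p ε t zs A X hG hε hα hQs hM hp h1n τ hτ Q hQ hQQ hm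
  set ε₁ := min (c' / 4) (γ ^ 2 * c' / 32 / D) with hε₁
  have e1 : ε₁ ≤ c' / 4 := min_le_left _ _
  have e2 : ε₁ * D ≤ γ ^ 2 * c' / 32 := by
    rw [← le_div_iff₀ hD0]
    exact min_le_right _ _
  have hn0 : (0 : ℝ) ≤ n := Nat.cast_nonneg n
  have hfreq := hG.le_sum_ind hα (hε.trans (e1.trans (by linarith)))
  have h1 := hG.local_gap hτ hl Q hQ hQs hp hQQ
  have h2 := le_two_mul_pairSum_sq Qs zs hτ hγ hfreq hM
  have hm0 := softMismatch_nonneg hτ zs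
  set m := softMismatch τ zs
  set P := pairSum τ (fun e a b => (Qs.1 (zs e.1.1) (zs e.1.2) - Qs.1 a b) ^ 2)
  have h3 : γ ^ 2 * (c' / 2 * n) * m ≤ 2 * P := by
    refine le_trans ?_ h2
    have : ε₁ * n ≤ c' / 4 * n := mul_le_mul_of_nonneg_right e1 hn0
    rw [← hc']
    gcongr
    linarith
  have h4 : γ ^ 2 * c' / 16 * (n * m) ≤ 1 / 4 * P := by linarith
  have h5 : 2 * k ^ 2 * B * (ε * (n * p) * m) ≤ p * (2 * k ^ 2 * B * ε₁ * (n * m)) := by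
    have : ε * (n * p * m) ≤ ε₁ * (n * p * m) := by gcongr
    have := mul_le_mul_of_nonneg_left this (by positivity : 0 ≤ 2 * (k : ℝ) ^ 2 * B)
    linarith
  have h6 : γ ^ 2 * c' / 32 * (n * m) ≤ 1 / 4 * P - 2 * ε₁ / l * (n * m) -
      2 * k ^ 2 * B * ε₁ * (n * m) := by
    have h7 := mul_le_mul_of_nonneg_right e2 (mul_nonneg hn0 hm0)
    have h8 : ε₁ * D * (n * m) = 2 * ε₁ / l * (n * m) + 2 * k ^ 2 * B * ε₁ * (n * m) := by
      rw [hD]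
      ring
    linarith
  have h9 := mul_le_mul_of_nonneg_left h6 hp
  have h10 : γ ^ 2 * c' / 32 * (n * p) * m = p * (γ ^ 2 * c' / 32 * (n * m)) := by ring
  rw [h10]
  linarith

/-- The regularity of the parameters, and the largeness of `n` and `n p`, under which the labels
are recovered: `ε` is the size of the deviations, `K n` the tolerance on the log-likelihood. -/
structure Regime {k : ℕ} (l c γ ε K : ℝ) (n : ℕ) (α : Simplex k) (Qs : SymMat k) (p t : ℝ) :
    Prop where
  le_prob : ∀ a, c ≤ α.1 a
  mem_box : ∀ a b, Qs.1 a b ∈ Set.Icc l (1 - l)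
  gap : ∀ a a', a ≠ a' → ∃ b, γ ≤ |Qs.1 a b - Qs.1 a' b|
  rate_pos : 0 < p
  size_pos : (0 : ℝ) < n
  noise_le : t ≤ ε * (n ^ 2 * p)
  tol_le : K ≤ ε * (n * p)
  one_le : 1 ≤ ε * n

lemma exists_separation (k : ℕ) {l c γ δ K : ℝ} (hk : (0 : ℝ) < k) (hl : 0 < l)
    (hl1 : l ≤ 1) (hc : 0 < c) (hγ : 0 < γ) (hδ : 0 < δ) :
    ∃ ε > 0, ε ≤ 1 ∧ ε ≤ δ ∧ ε ≤ c / 2 ∧ ∃ c₂ > 0, ∀ {n : ℕ} {α : Simplex k} {Qs : SymMat k}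
      {p t : ℝ}
      {zs : Labels n k} {A X : PairMat n}, Regime l c γ ε K n α Qs p t →
      GoodEvent α Qs p ε t zs A X →
      ∀ {τ : Fin n → Fin k → ℝ}, IsWeights τ → ∀ Q : SymMat k,
      (∀ a b, Q.1 a b ∈ Set.Icc l (1 - l)) →
      logLik A X zs Qs - K * n ≤ softLik A X τ Q →
      ∃ σ : Equiv.Perm (Fin k), (∀ a b, |Q.1 (σ a) (σ b) - Qs.1 a b| ≤ δ) ∧
        softMismatch τ (fun i => σ (zs i)) ≤ δ * n ∧
        c₂ * (n * p) * softMismatch τ (fun i => σ (zs i)) ≤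
          logLik A X (fun i => σ (zs i)) Q - softLik A X τ Q := by
  obtain ⟨ε₁, hε₁, c₂, hc₂, hloc⟩ := exists_local_separation k hl hl1 hc hγ
  -- The accuracy of the global step is chosen after `ε₁`, so that its output falls within the range
  -- of the local step.
  obtain ⟨ε₀, hε₀, hglob⟩ := exists_global_separation k (K := K) hk hl hl1 hc hγ
    (lt_min hδ hε₁)
  set ε := min (min ε₀ ε₁) (min (min 1 δ) (c / 2)) with hε
  have hε0 : 0 < ε := lt_min (lt_min hε₀ hε₁) (lt_min (lt_min one_pos hδ) (by positivity))
  have i0 : ε ≤ ε₀ := (min_le_left _ _).trans (min_le_left _ _)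
  have i1 : ε ≤ ε₁ := (min_le_left _ _).trans (min_le_right _ _)
  refine ⟨ε, hε0, (min_le_right _ _).trans ((min_le_left _ _).trans (min_le_left _ _)),
    (min_le_right _ _).trans ((min_le_left _ _).trans (min_le_right _ _)),
    (min_le_right _ _).trans (min_le_right _ _), c₂, hc₂, ?_⟩
  intro n α Qs p t zs A X hR hG τ hτ Q hQ hmax
  have hp := hR.rate_pos
  have hn := hR.size_pos
  obtain ⟨σ, h1, h2⟩ := hglob hG hε0.le i0 hR.le_prob hR.mem_box hR.gap hp hn
    (hR.noise_le.trans (by gcongr)) (hR.tol_le.trans (by gcongr))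
    (hR.one_le.trans (by gcongr)) hτ Q hQ hmax
  refine ⟨σ, fun a b => (h1 a b).trans (min_le_left _ _),
    h2.trans (by gcongr; exact min_le_left _ _), ?_⟩
  have h3 := hloc hG i1 hR.le_prob hR.mem_box hR.gap hp.le (hR.one_le.trans (by gcongr))
    (hτ.comp_perm σ) (permMat σ Q) (fun a b => hQ _ _)
    (fun a b => (h1 a b).trans (min_le_right _ _)) (h2.trans (by gcongr; exact min_le_right _ _))
  rw [softLik_permMat, logLik_permMat] at h3
  exact h3

/-! ### The variational objective -/

/-- The mean log-prior under the weights `τ`, plus the entropy of `τ`. -/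
def priorEnt {n k : ℕ} (τ : Fin n → Fin k → ℝ) (α : Simplex k) : ℝ :=
  ∑ i, ∑ a, τ i a * (Real.log (α.1 a) - Real.log (τ i a))

lemma sum_prod_sum {n k : ℕ} {τ : Fin n → Fin k → ℝ} (hτ : IsWeights τ)
    (g : Fin n → Fin k → ℝ) :
    ∑ z : Labels n k, (∏ l, τ l (z l)) * ∑ i, g i (z i) = ∑ i, ∑ a, τ i a * g i a := by
  have h1 : ∀ (z : Labels n k) (i : Fin n), g i (z i) = ∑ a, ind z i a * g i a := by
    intro z i
    simp [ind]
  simp only [h1, Finset.mul_sum]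
  rw [Finset.sum_comm]
  refine Finset.sum_congr rfl fun i _ => ?_
  rw [Finset.sum_comm]
  refine Finset.sum_congr rfl fun a _ => ?_
  rw [← sum_prod_ind hτ, Finset.sum_mul]
  exact Finset.sum_congr rfl fun z _ => (mul_assoc _ _ _).symm

/-- The evidence cancels against the normalization of the posterior, leaving an explicit function of
`(τ, α, Q)`. Labellings of zero probability drop out, so the logarithms only need to be split on the
support. -/
lemma objective_eq {n k : ℕ} (A X : PairMat n) (τ : Fin n → Simplex k) (α : Simplex k)
    (Q : SymMat k) (hα : ∀ a, 0 < α.1 a) :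
    objective A X τ α Q = softLik A X (fun i => (τ i).1) Q + priorEnt (fun i => (τ i).1) α := by
  have hτ := isWeights_simplex τ
  have hj : ∀ z : Labels n k, 0 < jointLik A X z α Q := fun z =>
    mul_pos (Finset.prod_pos fun i _ => hα (z i)) (Real.exp_pos _)
  have hP0 : ∀ z : Labels n k, prodProb τ z * Real.log (prodProb τ z / posterior A X α Q z) =
      prodProb τ z * Real.log (lik A X α Q) - prodProb τ z * logLik A X z Q -
        prodProb τ z * ∑ i, (Real.log (α.1 (z i)) - Real.log ((τ i).1 (z i))) := by
    intro z
    by_cases hz : prodProb τ z = 0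
    · simp [hz]
    have hlik : 0 < lik A X α Q :=
      Finset.sum_pos (fun z _ => hj z) ⟨z, Finset.mem_univ z⟩
    have h1 : Real.log (prodProb τ z) = ∑ i, Real.log ((τ i).1 (z i)) := by
      refine Real.log_prod fun i _ => ?_
      exact (Finset.prod_ne_zero_iff.1 hz) i (Finset.mem_univ i)
    have h2 : Real.log (jointLik A X z α Q) = ∑ i, Real.log (α.1 (z i)) + logLik A X z Q := by
      rw [jointLik, Real.log_mul (Finset.prod_pos fun i _ => hα (z i)).ne' (Real.exp_pos _).ne',
        Real.log_exp, Real.log_prod fun i _ => (hα (z i)).ne']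
    rw [posterior, Real.log_div hz (div_pos (hj z) hlik).ne', Real.log_div (hj z).ne' hlik.ne',
      h1, h2, Finset.sum_sub_distrib]
    ring
  have hsum : ∑ z, prodProb τ z = 1 := sum_prod_weights hτ
  have h3 := sum_prod_logLik A X hτ Q
  have h4 := sum_prod_sum hτ fun i a => Real.log (α.1 a) - Real.log ((τ i).1 a)
  rw [objective, KL, Finset.sum_congr rfl fun z _ => hP0 z, Finset.sum_sub_distrib,
    Finset.sum_sub_distrib, ← Finset.sum_mul, hsum, priorEnt, ← h3, ← h4]
  simp only [prodProb]
  ring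

/-- Linear majorant of the entropy function with free slope `s`. The entropy of small weights is not
linear in them, and the additive `exp (-s)` is the price for making it so. -/
lemma neg_mul_log_le {x : ℝ} (hx : 0 ≤ x) (s : ℝ) :
    -(x * Real.log x) ≤ s * x + Real.exp (-s) := by
  rcases hx.eq_or_lt with rfl | hx
  · simp [Real.exp_nonneg]
  · have h1 := Real.log_le_sub_one_of_pos (div_pos (Real.exp_pos (-s)) hx)
    rw [Real.log_div (Real.exp_pos _).ne' hx.ne', Real.log_exp] at h1
    have h2 := mul_le_mul_of_nonneg_left h1 hx.le
    have h3 : x * (Real.exp (-s) / x - 1) = Real.exp (-s) - x := by field_simp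
    linarith

lemma neg_mul_log_le_one_sub {x : ℝ} (hx : 0 ≤ x) : -(x * Real.log x) ≤ 1 - x := by
  rcases hx.eq_or_lt with rfl | hx
  · simp
  · have h1 := mul_le_mul_of_nonneg_left (Real.one_sub_inv_le_log_of_pos hx) hx.le
    rw [mul_sub, mul_inv_cancel₀ hx.ne'] at h1
    linarith

lemma simplex_le_one {k : ℕ} (α : Simplex k) (a : Fin k) : α.1 a ≤ 1 := by
  rw [← α.2.2]
  exact Finset.single_le_sum (fun b _ => α.2.1 b) (Finset.mem_univ a)

lemma priorEnt_le {n k : ℕ} {τ : Fin n → Fin k → ℝ} (hτ : IsWeights τ) (α : Simplex k) :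
    priorEnt τ α ≤ k * n := by
  calc priorEnt τ α ≤ ∑ _i : Fin n, ∑ _a : Fin k, (1 : ℝ) := by
        refine Finset.sum_le_sum fun i _ => Finset.sum_le_sum fun a _ => ?_
        have h1 := neg_mul_log_le_one_sub (hτ.nonneg i a)
        have h2 := mul_nonpos_of_nonneg_of_nonpos (hτ.nonneg i a)
          (Real.log_nonpos (α.2.1 a) (simplex_le_one α a))
        have h3 := hτ.nonneg i a
        linarith
    _ = k * n := by simp [mul_comm]

lemma priorEnt_ind {n k : ℕ} (z : Labels n k) (α : Simplex k) :
    priorEnt (ind z) α = ∑ i, Real.log (α.1 (z i)) := by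
  refine Finset.sum_congr rfl fun i _ => ?_
  rw [Finset.sum_eq_single (z i)]
  · simp [ind]
  · intro a _ ha
    simp [ind, ha.symm]
  · simp

lemma le_priorEnt_ind {n k : ℕ} (z : Labels n k) (α : Simplex k) {c : ℝ} (hc : 0 < c)
    (hα : ∀ a, c ≤ α.1 a) : Real.log c * n ≤ priorEnt (ind z) α := by
  rw [priorEnt_ind]
  calc Real.log c * n = ∑ _i : Fin n, Real.log c := by simp [mul_comm]
    _ ≤ _ := Finset.sum_le_sum fun i _ => Real.log_le_log hc (hα (z i))

/-- Correct labels use the majorant `1 - x`, wrong labels the one of slope `s`. With `s` a fraction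
of `n p`, the gain stays below the likelihood loss up to a vanishing remainder. -/
lemma priorEnt_sub_le {n k : ℕ} {τ : Fin n → Fin k → ℝ} (hτ : IsWeights τ) (z : Labels n k)
    (α : Simplex k) {c : ℝ} (hc : 0 < c) (hα : ∀ a, c ≤ α.1 a) (s : ℝ) :
    priorEnt τ α - priorEnt (ind z) α ≤
      (1 + s - Real.log c) * softMismatch τ z + n * (k * Real.exp (-s)) := by
  have key : ∀ i, ∑ a, τ i a * (Real.log (α.1 a) - Real.log (τ i a)) - Real.log (α.1 (z i)) ≤
      (1 + s - Real.log c) * (1 - τ i (z i)) + k * Real.exp (-s) := by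
    intro i
    have hsum : 1 - τ i (z i) = ∑ a ∈ Finset.univ.erase (z i), τ i a := by
      rw [← hτ.sum_eq i, ← Finset.add_sum_erase _ _ (Finset.mem_univ (z i))]
      ring
    have h1 : τ i (z i) * (Real.log (α.1 (z i)) - Real.log (τ i (z i))) - Real.log (α.1 (z i)) ≤
        (1 - Real.log c) * (1 - τ i (z i)) := by
      have e1 := neg_mul_log_le_one_sub (hτ.nonneg i (z i))
      have e2 := mul_le_mul_of_nonneg_left (Real.log_le_log hc (hα (z i)))
        (sub_nonneg.2 (hτ.le_one i (z i)))
      linarith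
    have h2 : ∀ a ∈ Finset.univ.erase (z i), τ i a * (Real.log (α.1 a) - Real.log (τ i a)) ≤
        s * τ i a + Real.exp (-s) := by
      intro a _
      have e1 := neg_mul_log_le (hτ.nonneg i a) s
      have e2 := mul_nonpos_of_nonneg_of_nonpos (hτ.nonneg i a)
          (Real.log_nonpos (α.2.1 a) (simplex_le_one α a))
      linarith
    have h3 : ∑ a ∈ Finset.univ.erase (z i), τ i a * (Real.log (α.1 a) - Real.log (τ i a)) ≤
        s * (1 - τ i (z i)) + k * Real.exp (-s) := by
      refine (Finset.sum_le_sum h2).trans ?_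
      rw [Finset.sum_add_distrib, ← Finset.mul_sum, ← hsum, add_le_add_iff_left]
      refine (Finset.sum_le_sum_of_subset_of_nonneg (Finset.erase_subset _ _)
        fun _ _ _ => (Real.exp_pos _).le).trans ?_
      simp
    rw [← Finset.add_sum_erase _ _ (Finset.mem_univ (z i))]
    linarith
  rw [priorEnt_ind, priorEnt, ← Finset.sum_sub_distrib, softMismatch, Finset.mul_sum]
  refine (Finset.sum_le_sum fun i _ => key i).trans ?_
  rw [Finset.sum_add_distrib]
  simp

/-- The label functions as degenerate weights. -/
def oneHot {n k : ℕ} (z : Labels n k) (i : Fin n) : Simplex k :=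
  ⟨ind z i, (isWeights_ind z).nonneg i, (isWeights_ind z).sum_eq i⟩

lemma objective_oneHot {n k : ℕ} (A X : PairMat n) (z : Labels n k) (α : Simplex k)
    (Q : SymMat k) (hα : ∀ a, 0 < α.1 a) :
    objective A X (oneHot z) α Q = logLik A X z Q + priorEnt (ind z) α := by
  rw [objective_eq A X _ α Q hα, ← softLik_ind]
  rfl

/-! ### Recovery of the labels -/

lemma sub_le_softMismatch {n k : ℕ} {τ : Fin n → Fin k → ℝ} (hτ : IsWeights τ) (z : Labels n k)
    (i : Fin n) : 1 - τ i (z i) ≤ softMismatch τ z :=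
  Finset.single_le_sum (f := fun i => 1 - τ i (z i))
    (fun j _ => sub_nonneg.2 (hτ.le_one j _)) (Finset.mem_univ i)

/-- Every `τ i (z i)` exceeds `1 / 2`, so it is the unique largest weight. -/
lemma eq_of_softMismatch_lt {n k : ℕ} {τ : Fin n → Fin k → ℝ} (hτ : IsWeights τ)
    {z z' : Labels n k} (hm : softMismatch τ z < 1 / 2) (hz' : ∀ i a, τ i a ≤ τ i (z' i))
    (i : Fin n) : z' i = z i := by
  by_contra hne
  have h1 := sub_le_softMismatch hτ z i
  have h2 := hz' i (z i)
  have h3 : τ i (z' i) + τ i (z i) ≤ 1 := by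
    rw [← hτ.sum_eq i, ← Finset.sum_pair hne]
    exact Finset.sum_le_sum_of_subset_of_nonneg (Finset.subset_univ _) fun a _ _ => hτ.nonneg i a
  linarith

section Recovery

variable {k n : ℕ} {l c γ δ K ε c₂ p t : ℝ} {α : Simplex k} {Qs : SymMat k} {zs : Labels n k}
  {A X : PairMat n}

/-- The conclusion of `exists_separation` for given data. -/
def Separated (l δ K c₂ : ℝ) (Qs : SymMat k) (p : ℝ) (zs : Labels n k) (A X : PairMat n) : Prop :=
  ∀ {τ : Fin n → Fin k → ℝ}, IsWeights τ → ∀ Q : SymMat k,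
    (∀ a b, Q.1 a b ∈ Set.Icc l (1 - l)) →
    logLik A X zs Qs - K * n ≤ softLik A X τ Q →
    ∃ σ : Equiv.Perm (Fin k), (∀ a b, |Q.1 (σ a) (σ b) - Qs.1 a b| ≤ δ) ∧
      softMismatch τ (fun i => σ (zs i)) ≤ δ * n ∧
      c₂ * (n * p) * softMismatch τ (fun i => σ (zs i)) ≤
        logLik A X (fun i => σ (zs i)) Q - softLik A X τ Q

/-- The estimate beats `σ ∘ zs` at its own `Q`, whereas separation says that it loses in proportion
to the mismatch. The mismatch is therefore zero. -/
lemma Separated.of_isMLE (h : Separated l δ K c₂ Qs p zs A X) (hK : 0 ≤ K)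
    (hc₂ : 0 < c₂) (hp : 0 < p) (hn : (0 : ℝ) < n)
    {𝒬 : Set (SymMat k)} (h𝒬 : ∀ Q ∈ 𝒬, ∀ a b, Q.1 a b ∈ Set.Icc l (1 - l)) (hQs : Qs ∈ 𝒬)
    {Q : SymMat k} {z : Labels n k} (hQ : IsMLE 𝒬 A X Q z) :
    ∃ σ : Equiv.Perm (Fin k), (∀ a b, |Q.1 (σ a) (σ b) - Qs.1 a b| ≤ δ) ∧
      ∀ i, z i = σ (zs i) := by
  have h0 := hQ.2 Qs hQs zs
  obtain ⟨σ, h1, -, h3⟩ := h (isWeights_ind z) Q (h𝒬 Q hQ.1) (by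
    rw [softLik_ind]
    have := mul_nonneg hK hn.le
    linarith)
  refine ⟨σ, h1, ?_⟩
  rw [softLik_ind] at h3
  have h4 := hQ.2 Q hQ.1 fun i => σ (zs i)
  have h5 : softMismatch (ind z) (fun i => σ (zs i)) ≤ 0 := by
    refine le_of_mul_le_mul_left (h3.trans ?_) (by positivity : 0 < c₂ * (n * p))
    linarith
  refine eq_of_softMismatch_lt (isWeights_ind z) (by linarith) fun i a => ?_
  have : ind z i (z i) = 1 := by simp [ind]
  rw [this]
  exact (isWeights_ind z).le_one i a

/-- The tolerance `k - log c` per node comes from `priorEnt ≤ k n` at the estimate and `priorEnt ≥ n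
log c` at the truth. It brings the mean log-likelihood within the range of separation. -/
lemma Separated.of_isVarEstimate (h : Separated l δ (k - Real.log c) c₂ Qs p zs A X)
    (hc : 0 < c)
    (hbig : 1 - Real.log c ≤ c₂ * (n * p) / 4) (hbig' : 1 ≤ c₂ * (n * p) / 4)
    (hsmall : n * (k * Real.exp (-(c₂ * (n * p) / 2))) < 1 / 2)
    {𝒜 : Set (Simplex k)} {𝒬 : Set (SymMat k)} (h𝒜 : ∀ α ∈ 𝒜, ∀ a, c ≤ α.1 a)
    (h𝒬 : ∀ Q ∈ 𝒬, ∀ a b, Q.1 a b ∈ Set.Icc l (1 - l)) (hα : α ∈ 𝒜) (hQs : Qs ∈ 𝒬)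
    {β : Simplex k} {Q : SymMat k} {τ : Fin n → Simplex k} (hτ : IsVarEstimate 𝒜 𝒬 A X β Q τ) :
    ∃ σ : Equiv.Perm (Fin k), (∀ a b, |Q.1 (σ a) (σ b) - Qs.1 a b| ≤ δ) ∧
      softMismatch (fun i => (τ i).1) (fun i => σ (zs i)) ≤ δ * n ∧
      softMismatch (fun i => (τ i).1) (fun i => σ (zs i)) < 1 / 2 := by
  obtain ⟨hβ, hQ, hmax⟩ := hτ
  have hpos : ∀ α ∈ 𝒜, ∀ a, 0 < α.1 a := fun α hα a => hc.trans_le (h𝒜 α hα a)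
  have hw := isWeights_simplex τ
  have h0 := hmax α hα Qs hQs (oneHot zs)
  rw [objective_oneHot A X zs α Qs (hpos α hα), objective_eq A X τ β Q (hpos β hβ)] at h0
  have h1 := priorEnt_le hw β
  have h2 := le_priorEnt_ind zs α hc (h𝒜 α hα)
  obtain ⟨σ, g1, g2, g3⟩ := h hw Q (h𝒬 Q hQ) (by linarith)
  refine ⟨σ, g1, g2, ?_⟩
  have h3 := hmax β hβ Q hQ (oneHot fun i => σ (zs i))
  rw [objective_oneHot A X _ β Q (hpos β hβ), objective_eq A X τ β Q (hpos β hβ)] at h3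
  -- With this slope, and `1 - log c` at most a quarter of `c₂ n p`, the entropy uses at most three
  -- quarters of the loss `c₂ n p m`. The last quarter is at least `m` and at most the remainder
  -- `hsmall`.
  have h4 := priorEnt_sub_le hw (fun i => σ (zs i)) β hc (h𝒜 β hβ) (c₂ * (n * p) / 2)
  have hm0 := softMismatch_nonneg hw (fun i => σ (zs i))
  set m := softMismatch (fun i => (τ i).1) (fun i => σ (zs i))
  have h5 := mul_le_mul_of_nonneg_right hbig hm0
  have h6 := mul_le_mul_of_nonneg_right hbig' hm0
  linarith

end Recovery

/-! ### Existence of the estimators over compact parameter spaces -/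

/-- The symmetric matrices with entries in `[l, 1 - l]`. -/
def matBox (k : ℕ) (l : ℝ) : Set (SymMat k) := {Q | ∀ a b, Q.1 a b ∈ Set.Icc l (1 - l)}

/-- The probability vectors with coordinates at least `c`. -/
def simplexBox (k : ℕ) (c : ℝ) : Set (Simplex k) := {α | ∀ a, c ≤ α.1 a}

lemma continuous_entry {k : ℕ} (a b : Fin k) : Continuous fun Q : SymMat k => Q.1 a b :=
  continuous_subtype_val.matrix_elem a b

lemma isCompact_matBox (k : ℕ) (l : ℝ) : IsCompact (matBox k l) := by
  have h1 : IsCompact (Set.pi Set.univ fun _ : Fin k => Set.pi Set.univ fun _ : Fin k =>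
      Set.Icc l (1 - l)) := isCompact_univ_pi fun _ => isCompact_univ_pi fun _ => isCompact_Icc
  have h2 : IsClosed {Q : Matrix (Fin k) (Fin k) ℝ | Q.IsSymm} :=
    isClosed_eq continuous_id.matrix_transpose continuous_id
  have h3 := h2.isClosedEmbedding_subtypeVal.isCompact_preimage h1
  have h4 : matBox k l = Subtype.val ⁻¹' (Set.pi Set.univ fun _ : Fin k =>
      Set.pi Set.univ fun _ : Fin k => Set.Icc l (1 - l)) := by
    ext Q
    exact ⟨fun h a _ b _ => h a b, fun h a b => h a trivial b trivial⟩
  rw [h4]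
  exact h3

lemma isCompact_simplexBox (k : ℕ) (c : ℝ) : IsCompact (simplexBox k c) := by
  refine IsClosed.isCompact ?_
  simp only [simplexBox, Set.ofPred_forall]
  exact isClosed_iInter fun a => isClosed_le continuous_const
    ((continuous_apply a).comp continuous_subtype_val)

lemma continuousOn_log_entry {k : ℕ} {l : ℝ} (hl : 0 < l) (a b : Fin k) :
    ContinuousOn (fun Q : SymMat k => Real.log (Q.1 a b)) (matBox k l) :=
  (continuous_entry a b).continuousOn.log fun _ hQ => (hl.trans_le (hQ a b).1).ne'

lemma continuousOn_log_one_sub_entry {k : ℕ} {l : ℝ} (hl : 0 < l) (a b : Fin k) :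
    ContinuousOn (fun Q : SymMat k => Real.log (1 - Q.1 a b)) (matBox k l) :=
  (continuous_const.sub (continuous_entry a b)).continuousOn.log fun _ hQ =>
    (hl.trans_le (le_sub_comm.1 (hQ a b).2)).ne'

lemma continuousOn_logLik {n k : ℕ} {l : ℝ} (hl : 0 < l) (A X : PairMat n) (z : Labels n k) :
    ContinuousOn (fun Q : SymMat k => logLik A X z Q) (matBox k l) := by
  unfold logLik
  refine continuousOn_finsetSum _ fun e _ => ?_
  exact continuousOn_const.mul ((continuousOn_const.mul (continuousOn_log_entry hl _ _)).add
    (continuousOn_const.mul (continuousOn_log_one_sub_entry hl _ _)))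

lemma exists_isMLE_matBox {n k : ℕ} {l : ℝ} (hl : 0 < l) (A X : PairMat n) (zs : Labels n k)
    {Qs : SymMat k} (hQs : Qs ∈ matBox k l) :
    ∃ (Q : SymMat k) (z : Labels n k), IsMLE (matBox k l) A X Q z := by
  choose Q hQ hmax using fun z : Labels n k =>
    (isCompact_matBox k l).exists_isMaxOn ⟨Qs, hQs⟩ (continuousOn_logLik hl A X z)
  obtain ⟨z, -, hz⟩ := Finset.exists_max_image Finset.univ (fun z => logLik A X z (Q z))
    ⟨zs, Finset.mem_univ zs⟩
  exact ⟨Q z, z, hQ z, fun Q' hQ' z' => (hmax z' hQ').trans (hz z' (Finset.mem_univ z'))⟩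

/-- The boxes keep the arguments of `log` in the likelihood and the prior away from `0`. The weights
`τ` may reach the boundary of the simplex, where continuity comes from that of `x log x`. -/
lemma exists_isVarEstimate_box {n k : ℕ} {l c : ℝ} (hl : 0 < l) (hc : 0 < c) (A X : PairMat n)
    (zs : Labels n k) {Qs : SymMat k} (hQs : Qs ∈ matBox k l) {α : Simplex k}
    (hα : α ∈ simplexBox k c) :
    ∃ (β : Simplex k) (Q : SymMat k) (τ : Fin n → Simplex k),
      IsVarEstimate (simplexBox k c) (matBox k l) A X β Q τ := by
  set S : Set ((Fin n → Simplex k) × Simplex k × SymMat k) :=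
    Set.univ ×ˢ (simplexBox k c ×ˢ matBox k l) with hS
  have hcomp : IsCompact S :=
    isCompact_univ.prod ((isCompact_simplexBox k c).prod (isCompact_matBox k l))
  have hτc : ∀ i a, Continuous fun x : (Fin n → Simplex k) × Simplex k × SymMat k =>
      (x.1 i).1 a := fun i a =>
    (continuous_apply a).comp (continuous_subtype_val.comp ((continuous_apply i).comp
      continuous_fst))
  have hαc : ∀ a, Continuous fun x : (Fin n → Simplex k) × Simplex k × SymMat k =>
      x.2.1.1 a := fun a =>
    (continuous_apply a).comp (continuous_subtype_val.comp (continuous_fst.comp continuous_snd))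
  have hQc : Set.MapsTo (fun x : (Fin n → Simplex k) × Simplex k × SymMat k => x.2.2) S
      (matBox k l) := fun x hx => hx.2.2
  have hQcont : ContinuousOn (fun x : (Fin n → Simplex k) × Simplex k × SymMat k => x.2.2) S :=
    (continuous_snd.comp continuous_snd).continuousOn
  have hcont : ContinuousOn (fun x : (Fin n → Simplex k) × Simplex k × SymMat k =>
      softLik A X (fun i => (x.1 i).1) x.2.2 + priorEnt (fun i => (x.1 i).1) x.2.1) S := by
    refine ContinuousOn.add ?_ ?_
    · unfold softLik pairSum pairWt
      refine continuousOn_finsetSum _ fun e _ => continuousOn_finsetSum _ fun a _ =>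
        continuousOn_finsetSum _ fun b _ => ?_
      refine ContinuousOn.mul ((hτc _ _).mul (hτc _ _)).continuousOn ?_
      exact continuousOn_const.mul ((continuousOn_const.mul
        ((continuousOn_log_entry hl a b).comp hQcont hQc)).add
        (continuousOn_const.mul ((continuousOn_log_one_sub_entry hl a b).comp hQcont hQc)))
    · unfold priorEnt
      refine continuousOn_finsetSum _ fun i _ => continuousOn_finsetSum _ fun a _ => ?_
      simp only [mul_sub]
      refine ContinuousOn.sub ((hτc i a).continuousOn.mul ((hαc a).continuousOn.log
        fun x hx => (hc.trans_le (hx.2.1 a)).ne')) ?_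
      exact (Real.continuous_mul_log.comp (hτc i a)).continuousOn
  obtain ⟨⟨τ, β, Q⟩, ⟨-, hβ, hQ⟩, hmax⟩ := hcomp.exists_isMaxOn
    ⟨(oneHot zs, α, Qs), Set.mem_univ _, hα, hQs⟩ hcont
  refine ⟨β, Q, τ, hβ, hQ, fun α' hα' Q' hQ' τ' => ?_⟩
  have h := hmax (show (τ', α', Q') ∈ S from ⟨Set.mem_univ _, hα', hQ'⟩)
  rw [objective_eq A X τ' α' Q' fun a => hc.trans_le (hα' a),
    objective_eq A X τ β Q fun a => hc.trans_le (hβ a)]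
  exact h

/-! ### Transfer of the estimators to the parameter spaces -/

/-- Relabelling preserves the likelihood, so a maximizer over the larger box whose relabelled matrix
lies in `𝒬` yields a maximizer over `𝒬`. -/
lemma exists_isMLE_of_matBox {n k : ℕ} {l : ℝ} {A X : PairMat n} {𝒬 : Set (SymMat k)}
    (h𝒬 : 𝒬 ⊆ matBox k l) {Q : SymMat k} {z : Labels n k}
    (hQ : IsMLE (matBox k l) A X Q z) (σ : Equiv.Perm (Fin k)) (hσ : permMat σ Q ∈ 𝒬) :
    ∃ (Q : SymMat k) (z : Labels n k), IsMLE 𝒬 A X Q z := by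
  refine ⟨permMat σ Q, fun i => σ.symm (z i), hσ, fun Q' hQ' z' => ?_⟩
  rw [logLik_permMat]
  simpa using hQ.2 Q' (h𝒬 hQ') z'

/-- The mean of the weights `τ i`. -/
def meanWeights {n k : ℕ} (hn : 0 < n) (τ : Fin n → Simplex k) : Simplex k :=
  ⟨fun a => (∑ i, (τ i).1 a) / n,
    fun a => div_nonneg (Finset.sum_nonneg fun i _ => (τ i).2.1 a) (Nat.cast_nonneg n), by
      have : (n : ℝ) ≠ 0 := Nat.cast_ne_zero.2 hn.ne'
      rw [← Finset.sum_div, Finset.sum_comm]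
      simp [(isWeights_simplex τ).sum_eq, this]⟩

/-- Gibbs' inequality: for fixed `τ`, the mean of the `τ i` is the optimal prior. The maximizing `α`
over the box is not otherwise located, whereas this one is close to the true frequencies. -/
lemma priorEnt_le_meanWeights {n k : ℕ} (hn : 0 < n) (τ : Fin n → Simplex k) (α : Simplex k)
    (hα : ∀ a, 0 < α.1 a) :
    priorEnt (fun i => (τ i).1) α ≤ priorEnt (fun i => (τ i).1) (meanWeights hn τ) := by
  have hn0 : (0 : ℝ) < n := Nat.cast_pos.2 hn
  have e : ∀ β : Simplex k, priorEnt (fun i => (τ i).1) β =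
      ∑ a, (∑ i, (τ i).1 a) * Real.log (β.1 a) - ∑ i, ∑ a, (τ i).1 a * Real.log ((τ i).1 a) := by
    intro β
    simp only [priorEnt, mul_sub, Finset.sum_sub_distrib, Finset.sum_mul]
    rw [Finset.sum_comm]
  rw [e, e, sub_le_sub_iff_right, ← sub_nonpos, ← Finset.sum_sub_distrib]
  have key : ∀ a, (∑ i, (τ i).1 a) * Real.log (α.1 a) -
      (∑ i, (τ i).1 a) * Real.log ((meanWeights hn τ).1 a) ≤ n * α.1 a - ∑ i, (τ i).1 a := by
    intro a
    have hT0 : 0 ≤ ∑ i, (τ i).1 a := Finset.sum_nonneg fun i _ => (τ i).2.1 a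
    have hm : (meanWeights hn τ).1 a = (∑ i, (τ i).1 a) / n := rfl
    rw [hm]
    set T := ∑ i, (τ i).1 a
    rcases hT0.eq_or_lt with h | h
    · rw [← h]
      have := mul_nonneg hn0.le (hα a).le
      simpa using this
    · have h1 := Real.log_le_sub_one_of_pos (div_pos (hα a) (div_pos h hn0))
      rw [Real.log_div (hα a).ne' (div_pos h hn0).ne'] at h1
      have h2 := mul_le_mul_of_nonneg_left h1 h.le
      have h3 : T * (α.1 a / (T / n) - 1) = n * α.1 a - T := by field_simp
      linarith
  refine (Finset.sum_le_sum fun a _ => key a).trans ?_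
  rw [Finset.sum_sub_distrib, ← Finset.mul_sum, α.2.2, Finset.sum_comm]
  simp [(isWeights_simplex τ).sum_eq]

lemma abs_meanWeights_sub_le {n k : ℕ} (hn : 0 < n) (τ : Fin n → Simplex k) (zs : Labels n k)
    (α : Simplex k) {ε δ : ℝ} (hm : softMismatch (fun i => (τ i).1) zs ≤ δ * n) (a : Fin k)
    (hfreq : |∑ i, ind zs i a - n * α.1 a| ≤ ε * n) :
    |(meanWeights hn τ).1 a - α.1 a| ≤ δ + ε := by
  have hn0 : (0 : ℝ) < n := Nat.cast_pos.2 hn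
  have hw := isWeights_simplex τ
  have h1 : |∑ i, (τ i).1 a - ∑ i, ind zs i a| ≤ softMismatch (fun i => (τ i).1) zs := by
    rw [← Finset.sum_sub_distrib]
    refine (Finset.abs_sum_le_sum_abs _ _).trans (Finset.sum_le_sum fun i _ => ?_)
    by_cases h : zs i = a
    · subst h
      have := hw.le_one i (zs i)
      simp only [ind, if_true]
      rw [abs_of_nonpos (by linarith)]
      linarith
    · have h2 : (τ i).1 (zs i) + (τ i).1 a ≤ 1 := by
        rw [← hw.sum_eq i, ← Finset.sum_pair h]
        exact Finset.sum_le_sum_of_subset_of_nonneg (Finset.subset_univ _)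
          fun b _ _ => hw.nonneg i b
      simp only [ind, h, if_false, sub_zero]
      rw [abs_of_nonneg (hw.nonneg i a)]
      linarith
  have h3 : (meanWeights hn τ).1 a - α.1 a = (∑ i, (τ i).1 a - n * α.1 a) / n := by
    have : (meanWeights hn τ).1 a = (∑ i, (τ i).1 a) / n := rfl
    rw [this]
    field_simp
  rw [h3, abs_div, abs_of_pos hn0, div_le_iff₀ hn0]
  have h4 := abs_sub_le (∑ i, (τ i).1 a) (∑ i, ind zs i a) (n * α.1 a)
  linarith

lemma priorEnt_perm {n k : ℕ} (τ : Fin n → Fin k → ℝ) (α : Simplex k) (σ : Equiv.Perm (Fin k)) :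
    priorEnt (fun i a => τ i (σ a)) (permSimplex σ α) = priorEnt τ α :=
  Finset.sum_congr rfl fun i _ =>
    Equiv.sum_comp σ fun a => τ i a * (Real.log (α.1 a) - Real.log (τ i a))

/-- Relabelling keeps the objective and the new prior can only increase it, so the value still
dominates everything in the box, in particular in `𝒜` and `𝒬`. -/
lemma isVarEstimate_of_box {n k : ℕ} {l c : ℝ} {A X : PairMat n} (hc : 0 < c) (hn : 0 < n)
    {𝒜 : Set (Simplex k)} {𝒬 : Set (SymMat k)} (h𝒜 : 𝒜 ⊆ simplexBox k c)
    (h𝒬 : 𝒬 ⊆ matBox k l) {β : Simplex k} {Q : SymMat k} {τ : Fin n → Simplex k}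
    (hτ : IsVarEstimate (simplexBox k c) (matBox k l) A X β Q τ) (σ : Equiv.Perm (Fin k))
    (hσ : permMat σ Q ∈ 𝒬) (hβ : meanWeights hn (fun i => permSimplex σ (τ i)) ∈ 𝒜) :
    IsVarEstimate 𝒜 𝒬 A X (meanWeights hn fun i => permSimplex σ (τ i)) (permMat σ Q)
      fun i => permSimplex σ (τ i) := by
  refine ⟨hβ, hσ, fun α' hα' Q' hQ' τ' => ?_⟩
  refine (hτ.2.2 α' (h𝒜 hα') Q' (h𝒬 hQ') τ').trans ?_
  have hpos : ∀ a, 0 < β.1 a := fun a => hc.trans_le (hτ.1 a)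
  rw [objective_eq A X τ β Q hpos, objective_eq A X _ _ _ fun a => hc.trans_le (h𝒜 hβ a)]
  have h1 := priorEnt_le_meanWeights hn (fun i => permSimplex σ (τ i)) (permSimplex σ β)
    fun a => hpos (σ a)
  have h2 : priorEnt (fun i => (permSimplex σ (τ i)).1) (permSimplex σ β) =
      priorEnt (fun i => (τ i).1) β := priorEnt_perm (fun i => (τ i).1) β σ
  have h3 : softLik A X (fun i => (permSimplex σ (τ i)).1) (permMat σ Q) =
      softLik A X (fun i => (τ i).1) Q := softLik_permMat A X (fun i => (τ i).1) σ Q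
  rw [h3]
  linarith

/-! ### The plug-in estimator -/

lemma blockMean_perm {n k : ℕ} (A X : PairMat n) (z : Labels n k) (σ : Equiv.Perm (Fin k))
    (a b : Fin k) :
    blockMean A X (fun i => σ (z i)) (σ a) (σ b) = blockMean A X z a b := by
  have h : block (fun i => σ (z i)) (σ a) (σ b) = block z a b := by
    unfold block
    simp
  rw [blockMean, blockMean, h]

lemma sum_block {n k : ℕ} (z : Labels n k) (a b : Fin k) (g : Pair n → ℝ) :
    ∑ e ∈ block z a b, g e = ∑ e, pairWt (ind z) a b e * g e +
      if a = b then 0 else ∑ e, pairWt (ind z) b a e * g e := by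
  rw [block, Finset.sum_filter]
  split_ifs with hab
  · subst hab
    rw [add_zero]
    refine Finset.sum_congr rfl fun e _ => ?_
    by_cases h1 : z e.1.1 = a <;> by_cases h2 : z e.1.2 = a <;> simp [pairWt, ind, h1, h2]
  · rw [← Finset.sum_add_distrib]
    refine Finset.sum_congr rfl fun e _ => ?_
    by_cases h1 : z e.1.1 = a
    · have h1' : z e.1.1 ≠ b := fun h => hab (h1.symm.trans h)
      by_cases h2 : z e.1.2 = b <;> simp [pairWt, ind, h1, h2, hab]
    · by_cases h2 : z e.1.1 = b <;> by_cases h3 : z e.1.2 = a <;>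
        simp [pairWt, ind, h1, h2, h3, Ne.symm hab]

/-- Counts ordered pairs of nodes: the diagonal costs at most `n`, and each unordered pair of the
block is counted at most twice. -/
lemma card_block_ge {n k : ℕ} (z : Labels n k) (a b : Fin k) :
    (∑ i, ind z i a) * (∑ j, ind z j b) - n ≤ 2 * (block z a b).card := by
  have h1 := sum_pair_symm (fun i j : Fin n => if (z i = a ∧ z j = b) ∨ (z i = b ∧ z j = a)
    then (1 : ℝ) else 0) (fun i j => by simp only [or_comm, and_comm])
  have h2 : ∑ e : Pair n, (if (z e.1.1 = a ∧ z e.1.2 = b) ∨ (z e.1.1 = b ∧ z e.1.2 = a)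
      then (1 : ℝ) else 0) = (block z a b).card := by
    rw [block, Finset.sum_boole]
  rw [h2] at h1
  rw [← h1, Finset.sum_mul_sum, sub_le_iff_le_add]
  have h3 : ∀ i j : Fin n, ind z i a * ind z j b ≤
      (if i = j then 0 else if (z i = a ∧ z j = b) ∨ (z i = b ∧ z j = a) then (1 : ℝ) else 0) +
        if i = j then 1 else 0 := by
    intro i j
    unfold ind
    by_cases h : i = j
    · simp only [h, if_true, zero_add]
      split_ifs <;> norm_num
    · simp only [h, if_false, add_zero]
      by_cases h1 : z i = a <;> by_cases h2 : z j = b <;> simp [h1, h2]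
      all_goals split_ifs <;> norm_num
  calc ∑ i, ∑ j, ind z i a * ind z j b ≤ ∑ i, ∑ j,
      ((if i = j then 0 else if (z i = a ∧ z j = b) ∨ (z i = b ∧ z j = a) then (1 : ℝ) else 0) +
        if i = j then 1 else 0) :=
        Finset.sum_le_sum fun i _ => Finset.sum_le_sum fun j _ => h3 i j
    _ = _ := by
        simp only [Finset.sum_add_distrib]
        simp

lemma GoodEvent.abs_sum_block_noise_le {n k : ℕ} {α : Simplex k} {Qs : SymMat k} {p ε t : ℝ}
    {zs : Labels n k} {A X : PairMat n} (hG : GoodEvent α Qs p ε t zs A X) (s : Bool)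
    (a b : Fin k) : |∑ e ∈ block zs a b, noise Qs p zs A X s e| ≤ 2 * t := by
  rw [sum_block]
  have h1 := hG.base s a b
  have h2 := hG.base s b a
  have h0 := (abs_nonneg _).trans h1
  split_ifs
  · rw [add_zero]
    linarith
  · refine (abs_add_le _ _).trans ?_
    linarith

/-- The block has at least `c² n² / 4` pairs, so at least `c² n² p / 8` of them are observed after
subtracting the noise. The constant `48` is `6 * 8`. -/
lemma GoodEvent.abs_blockMean_sub_le {n k : ℕ} {α : Simplex k} {Qs : SymMat k} {p ε t c : ℝ}
    {zs : Labels n k} {A X : PairMat n} (hG : GoodEvent α Qs p ε t zs A X)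
    (hQs : ∀ a b, Qs.1 a b ∈ Set.Icc (0 : ℝ) 1) (hc : 0 < c) (hp : 0 < p) (hn : (0 : ℝ) < n)
    (hfreq : ∀ a, c * n ≤ ∑ i, ind zs i a) (hcn : 2 ≤ c ^ 2 * n)
    (ht : 32 * t ≤ c ^ 2 * (n ^ 2 * p)) (a b : Fin k) :
    |Qs.1 a b - blockMean A X zs a b| ≤ 48 * t / (c ^ 2 * (n ^ 2 * p)) := by
  have hcard := card_block_ge zs a b
  have h1 : c ^ 2 * n ^ 2 / 4 ≤ (block zs a b).card := by
    have h2 : c * n * (c * n) ≤ (∑ i, ind zs i a) * (∑ j, ind zs j b) :=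
      mul_le_mul (hfreq a) (hfreq b) (by positivity) ((by positivity : 0 ≤ c * n).trans (hfreq a))
    have h3 := mul_le_mul_of_nonneg_right hcn hn.le
    linarith
  have hT := hG.abs_sum_block_noise_le true a b
  have hF := hG.abs_sum_block_noise_le false a b
  set NT := ∑ e ∈ block zs a b, noise Qs p zs A X true e with hNT
  set NF := ∑ e ∈ block zs a b, noise Qs p zs A X false e with hNF
  set q := Qs.1 a b with hq
  have hqe : ∀ e ∈ block zs a b, Qs.1 (zs e.1.1) (zs e.1.2) = q := by
    intro e he
    rcases (Finset.mem_filter.1 he).2 with ⟨h, h'⟩ | ⟨h, h'⟩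
    · rw [h, h']
    · rw [h, h', hq]
      exact Qs.2.apply a b
  set D := ∑ e ∈ block zs a b, val (X e) with hD
  set S := ∑ e ∈ block zs a b, val (X e) * val (A e) with hS
  have eS : S = NT + p * q * (block zs a b).card := by
    have : ∀ e ∈ block zs a b, val (X e) * val (A e) = noise Qs p zs A X true e + p * q := by
      intro e he
      simp only [noise, if_true, hqe e he]
      ring
    rw [hS, Finset.sum_congr rfl this, Finset.sum_add_distrib, Finset.sum_const, nsmul_eq_mul]
    ring
  have eD : D = NT + NF + p * (block zs a b).card := by
    have : ∀ e ∈ block zs a b, val (X e) =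
        noise Qs p zs A X true e + noise Qs p zs A X false e + p := by
      intro e he
      simp only [noise, if_true, Bool.false_eq_true, if_false]
      ring
    rw [hD, Finset.sum_congr rfl this, Finset.sum_add_distrib, Finset.sum_add_distrib,
      Finset.sum_const, nsmul_eq_mul]
    ring
  obtain ⟨hq0, hq1⟩ := hQs a b
  obtain ⟨hT1, hT2⟩ := abs_le.1 hT
  obtain ⟨hF1, hF2⟩ := abs_le.1 hF
  have hDpos : c ^ 2 * (n ^ 2 * p) / 8 ≤ D := by
    have := mul_le_mul_of_nonneg_left h1 hp.le
    rw [eD]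
    linarith
  have hM : 0 < c ^ 2 * (n ^ 2 * p) := by positivity
  have hD0 : 0 < D := by linarith
  have hdev : |q * D - S| ≤ 6 * t := by
    -- The mean parts cancel, so only noise remains in the numerator.
    have e1 : q * D - S = q * NF - (1 - q) * NT := by
      rw [eD, eS]
      ring
    have ht0 : 0 ≤ 2 * t := (abs_nonneg _).trans hT
    rw [e1]
    refine (abs_sub _ _).trans ?_
    rw [abs_mul, abs_mul, abs_of_nonneg hq0, abs_of_nonneg (sub_nonneg.2 hq1)]
    have := mul_le_mul_of_nonneg_left hF hq0
    have := mul_le_mul_of_nonneg_left hT (sub_nonneg.2 hq1)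
    linarith
  have e2 : q - blockMean A X zs a b = (q * D - S) / D := by
    have : blockMean A X zs a b = S / D := rfl
    rw [this]
    field_simp
  rw [e2, abs_div, abs_of_pos hD0, div_le_div_iff₀ hD0 hM]
  have ht0 : 0 ≤ t := by
    have := (abs_nonneg _).trans hT
    linarith
  calc |q * D - S| * (c ^ 2 * (n ^ 2 * p)) ≤ 6 * t * (8 * D) :=
        mul_le_mul hdev (by linarith) hM.le (by positivity)
    _ = 48 * t * D := by ring

lemma frobSq_le {n k : ℕ} (M R : Matrix (Fin k) (Fin k) ℝ) (z z' : Labels n k) {x : ℝ}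
    (h : ∀ i j, |M (z i) (z j) - R (z' i) (z' j)| ≤ x) :
    frobSq (connection M z - connection R z') ≤ n ^ 2 * x ^ 2 := by
  calc frobSq (connection M z - connection R z') ≤ ∑ _i : Fin n, ∑ _j : Fin n, x ^ 2 := by
        refine Finset.sum_le_sum fun i _ => Finset.sum_le_sum fun j _ => ?_
        simp only [Matrix.sub_apply, connection]
        split_ifs
        · simpa using sq_nonneg x
        · exact sq_le_sq' (abs_le.1 (h i j)).1 (abs_le.1 (h i j)).2
    _ = _ := by
        simp only [Finset.sum_const, Finset.card_univ, Fintype.card_fin, nsmul_eq_mul]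
        ring

/-! ### The parameter spaces -/

/-- Two equal rows of the symmetric `Q` would give equal coordinates of `α Q`. Finiteness of the set
of pairs makes the separation uniform. -/
lemma DistinctCoords.exists_gap {k : ℕ} {α : Simplex k} {Q : SymMat k} (h : DistinctCoords α Q) :
    ∃ γ > 0, ∀ a a', a ≠ a' → ∃ b, γ ≤ |Q.1 a b - Q.1 a' b| := by
  have h1 : ∀ x : Fin k × Fin k, ∃ g : ℝ, 0 < g ∧
      (x.1 ≠ x.2 → ∃ b, g ≤ |Q.1 x.1 b - Q.1 x.2 b|) := by
    rintro ⟨a, a'⟩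
    by_cases hne : a = a'
    · exact ⟨1, one_pos, fun h => absurd hne h⟩
    · have h2 : ∃ b, Q.1 a b ≠ Q.1 a' b := by
        by_contra! hcon
        refine hne (h ?_)
        simp only [Matrix.vecMul, dotProduct]
        refine Finset.sum_congr rfl fun b _ => ?_
        rw [Q.2.apply a b, Q.2.apply a' b, hcon b]
      obtain ⟨b, hb⟩ := h2
      exact ⟨_, abs_pos.2 (sub_ne_zero.2 hb), fun _ => ⟨b, le_rfl⟩⟩
  choose g hg0 hg using h1
  rcases isEmpty_or_nonempty (Fin k) with hk | hk
  · exact ⟨1, one_pos, fun a => isEmptyElim a⟩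
  · obtain ⟨x, -, hx⟩ := Finset.exists_min_image (Finset.univ : Finset (Fin k × Fin k)) g
      Finset.univ_nonempty
    refine ⟨g x, hg0 x, fun a a' hne => ?_⟩
    obtain ⟨b, hb⟩ := hg (a, a') hne
    exact ⟨b, (hx (a, a') (Finset.mem_univ _)).trans hb⟩

lemma exists_radius_simplex {k : ℕ} {𝒜 : Set (Simplex k)} {α : Simplex k}
    (h : α ∈ interior 𝒜) :
    ∃ r > 0, ∀ β : Simplex k, (∀ a, |β.1 a - α.1 a| ≤ r) → β ∈ 𝒜 := by
  obtain ⟨r, hr, hsub⟩ := Metric.mem_nhds_iff.1 (mem_interior_iff_mem_nhds.1 h)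
  refine ⟨r / 2, by positivity, fun β hβ => hsub ?_⟩
  rw [Metric.mem_ball, Subtype.dist_eq, dist_pi_lt_iff hr]
  intro a
  rw [Real.dist_eq]
  exact (hβ a).trans_lt (by linarith)

lemma exists_radius_symMat {k : ℕ} {𝒬 : Set (SymMat k)} {Q : SymMat k}
    (h : Q ∈ interior 𝒬) :
    ∃ r > 0, ∀ R : SymMat k, (∀ a b, |R.1 a b - Q.1 a b| ≤ r) → R ∈ 𝒬 := by
  have h1 := mem_interior_iff_mem_nhds.1 h
  rw [nhds_subtype_eq_comap, Filter.mem_comap] at h1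
  obtain ⟨t, ht, hsub⟩ := h1
  have ht' : t ∈ @nhds (Fin k → Fin k → ℝ) _ Q.1 := ht
  obtain ⟨r, hr, hball⟩ := Metric.mem_nhds_iff.1 ht'
  have key : ∀ M N : Fin k → Fin k → ℝ, (∀ a b, |M a b - N a b| ≤ r / 2) →
      M ∈ Metric.ball N r := by
    intro M N h
    rw [Metric.mem_ball, dist_pi_lt_iff hr]
    intro a
    rw [dist_pi_lt_iff hr]
    intro b
    rw [Real.dist_eq]
    exact (h a b).trans_lt (by linarith)
  exact ⟨r / 2, by positivity, fun R hR => hsub (hball (key R.1 Q.1 hR))⟩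

lemma Bounded.exists_boxes {k : ℕ} {𝒜 : Set (Simplex k)} {𝒬 : Set (SymMat k)}
    (h : Bounded 𝒜 𝒬) :
    ∃ c > 0, ∃ l > 0, (∀ α ∈ 𝒜, ∀ a, α.1 a ∈ Set.Icc c (1 - c)) ∧ 𝒬 ⊆ matBox k l := by
  obtain ⟨⟨c, hc, hA⟩, l, u, hl, hu, hQ⟩ := h
  refine ⟨c, hc, min l (1 - u), lt_min hl (sub_pos.2 hu), hA, fun Q hQm a b => ?_⟩
  have h1 := hQ Q hQm a b
  exact ⟨(min_le_left _ _).trans h1.1, by linarith [min_le_right l (1 - u), h1.2]⟩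

lemma two_le_of_prob_lt_one {k : ℕ} (α : Simplex k) (h : ∀ a, α.1 a < 1) : 2 ≤ k := by
  by_contra! hk
  have hsum := α.2.2
  interval_cases k
  · simp at hsum
  · rw [Fin.sum_univ_one] at hsum
    exact absurd hsum (h 0).ne

lemma sqrt_pow_mul_le {n p x : ℝ} (hn : 0 < n) (hp : 0 < p) (hx : 0 < x)
    (h : 1 ≤ x ^ 2 * (n * p)) : Real.sqrt (n ^ 3 * p) ≤ x * (n ^ 2 * p) := by
  rw [Real.sqrt_le_left (by positivity)]
  have := mul_le_mul_of_nonneg_right h (by positivity : 0 ≤ n ^ 3 * p)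
  linarith

/-! ### The estimators on the event of small deviations -/

/-- Separation is used with the boxes as parameter spaces for existence, and with `𝒜` and `𝒬` for
arbitrary maximizers. -/
lemma GoodEvent.conclusion {k n : ℕ} {l c γ δ ε r c₂ p t : ℝ} {α : Simplex k} {Qs : SymMat k}
    {zs : Labels n k} {A X : PairMat n} (hG : GoodEvent α Qs p ε t zs A X)
    (hl : 0 < l) (hc : 0 < c) (hc1 : c ≤ 1) (hc₂ : 0 < c₂) (hn : 0 < n)
    (hsep : Separated l δ (k - Real.log c) c₂ Qs p zs A X)
    (hR : Regime l c γ ε (k - Real.log c) n α Qs p t) (hδ : δ + ε ≤ r) (hε : 0 ≤ ε)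
    (hbig : 1 - Real.log c ≤ c₂ * (n * p) / 4) (hbig' : 1 ≤ c₂ * (n * p) / 4)
    (hsmall : n * (k * Real.exp (-(c₂ * (n * p) / 2))) < 1 / 2)
    {𝒜 : Set (Simplex k)} {𝒬 : Set (SymMat k)} (h𝒜 : 𝒜 ⊆ simplexBox k c) (h𝒬 : 𝒬 ⊆ matBox k l)
    (hα : α ∈ 𝒜) (hQs : Qs ∈ 𝒬)
    (hrA : ∀ β : Simplex k, (∀ a, |β.1 a - α.1 a| ≤ r) → β ∈ 𝒜)
    (hrQ : ∀ R : SymMat k, (∀ a b, |R.1 a b - Qs.1 a b| ≤ r) → R ∈ 𝒬) :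
    (∃ z, IsVarLabels 𝒜 𝒬 A X z) ∧ (∃ Q z, IsMLE 𝒬 A X Q z) ∧
      (∀ z, IsVarLabels 𝒜 𝒬 A X z → ∃ σ : Equiv.Perm (Fin k), ∀ i, z i = σ (zs i)) ∧
      ∀ Q z, IsMLE 𝒬 A X Q z → ∃ σ : Equiv.Perm (Fin k), ∀ i, z i = σ (zs i) := by
  have hK : 0 ≤ (k : ℝ) - Real.log c :=
    sub_nonneg.2 ((Real.log_nonpos hc.le hc1).trans (Nat.cast_nonneg k))
  have hp := hR.rate_pos
  refine ⟨?_, ?_, ?_, ?_⟩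
  · obtain ⟨β, Q, τ, hτ⟩ := exists_isVarEstimate_box hl hc A X zs (h𝒬 hQs) (h𝒜 hα)
    obtain ⟨σ, g1, g2, -⟩ := hsep.of_isVarEstimate hc hbig hbig' hsmall (fun _ h => h)
      (fun _ h => h) (h𝒜 hα) (h𝒬 hQs) hτ
    have hest := isVarEstimate_of_box hc hn h𝒜 h𝒬 hτ σ
      (hrQ _ fun a b => (g1 a b).trans (by linarith))
      (hrA _ fun a => (abs_meanWeights_sub_le hn _ zs α g2 a (hG.freq a)).trans hδ)
    choose z hz using fun i => Finset.exists_max_image Finset.univ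
      (fun a => (permSimplex σ (τ i)).1 a) ⟨zs i, Finset.mem_univ _⟩
    exact ⟨z, _, _, _, hest, fun i a => (hz i).2 a (Finset.mem_univ a)⟩
  · obtain ⟨Q, z, hQ⟩ := exists_isMLE_matBox hl A X zs (h𝒬 hQs)
    obtain ⟨σ, g1, -⟩ := hsep.of_isMLE hK hc₂ hp hR.size_pos (fun _ h => h) (h𝒬 hQs) hQ
    exact exists_isMLE_of_matBox h𝒬 hQ σ (hrQ _ fun a b => (g1 a b).trans (by linarith))
  · rintro z ⟨β, Q, τ, hτ, hz⟩
    obtain ⟨σ, -, -, g3⟩ := hsep.of_isVarEstimate hc hbig hbig' hsmall h𝒜 h𝒬 hα hQs hτ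
    exact ⟨σ, eq_of_softMismatch_lt (isWeights_simplex τ) g3 hz⟩
  · intro Q z hQ
    obtain ⟨σ, -, h⟩ := hsep.of_isMLE hK hc₂ hp hR.size_pos h𝒬 hQs hQ
    exact ⟨σ, h⟩

/-- Relabelling does not affect the plug-in matrix, so the block means are those of the true
communities. The factor `c² / 96` in the noise level makes the squared error exactly `n / (4 p)`,
and `1 / 4 ≤ log 2 ≤ log k`. -/
lemma GoodEvent.frobSq_blockMean_le {n k : ℕ} {α : Simplex k} {Qs : SymMat k} {p ε c : ℝ}
    {zs : Labels n k} {A X : PairMat n}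
    (hG : GoodEvent α Qs p ε (c ^ 2 / 96 * Real.sqrt (n ^ 3 * p)) zs A X)
    (hQs : ∀ a b, Qs.1 a b ∈ Set.Icc (0 : ℝ) 1) (hc : 0 < c) (hp : 0 < p) (hn : (0 : ℝ) < n)
    (hk : 2 ≤ k) (hfreq : ∀ a, c * n ≤ ∑ i, ind zs i a) (hcn : 2 ≤ c ^ 2 * n)
    (hnp : 1 ≤ n * p) {z : Labels n k} {σ : Equiv.Perm (Fin k)} (hz : ∀ i, z i = σ (zs i)) :
    frobSq (connection Qs.1 zs - connection (blockMean A X z) z) ≤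
      1 * ((k : ℝ) ^ 2 + n * Real.log k) / p := by
  obtain rfl : z = fun i => σ (zs i) := funext hz
  -- The value `3` is what `32 t ≤ c² n² p` requires for `t = c² r / 96`.
  have hs := sqrt_pow_mul_le hn hp three_pos (by linarith)
  have hr2 := Real.sq_sqrt (by positivity : 0 ≤ (n : ℝ) ^ 3 * p)
  set r := Real.sqrt ((n : ℝ) ^ 3 * p)
  have h1 := hG.abs_blockMean_sub_le hQs hc hp hn hfreq hcn (by
    have := mul_le_mul_of_nonneg_left hs (sq_nonneg c)
    linarith)
  refine (frobSq_le _ _ _ _ fun i j => ?_).trans (b := (n : ℝ) ^ 2 *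
    (48 * (c ^ 2 / 96 * r) / (c ^ 2 * (n ^ 2 * p))) ^ 2) ?_
  · rw [blockMean_perm]
    exact h1 _ _
  · have e : (n : ℝ) ^ 2 * (48 * (c ^ 2 / 96 * r) / (c ^ 2 * (n ^ 2 * p))) ^ 2 = n * (1 / 4) / p := by
      have : 48 * (c ^ 2 / 96 * r) / (c ^ 2 * (n ^ 2 * p)) = r / (2 * (n ^ 2 * p)) := by
        field_simp
        ring
      rw [this, div_pow, hr2]
      field_simp
      norm_num
    rw [e, one_mul]
    gcongr
    have h2 : (1 / 4 : ℝ) ≤ Real.log k := by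
      have h3 : Real.log 2 ≤ Real.log k := Real.log_le_log two_pos (by exact_mod_cast hk)
      linarith [Real.log_two_gt_d9]
    have h4 := mul_le_mul_of_nonneg_left h2 hn.le
    have h5 := sq_nonneg (k : ℝ)
    linarith

end

end SBM

theorem theorem2 {k : ℕ} (Qstar : SBM.SymMat k) :
    ∃ C : ℝ, 0 < C ∧
      ∀ (αstar : SBM.Simplex k) (𝒜 : Set (SBM.Simplex k)) (𝒬 : Set (SBM.SymMat k)),
        SBM.Bounded 𝒜 𝒬 → SBM.IsInterior 𝒜 𝒬 αstar Qstar → SBM.DistinctCoords αstar Qstar →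
      ∀ p : ℕ → ℝ, (∀ n, p n ∈ Set.Icc (0 : ℝ) 1) →
        ((fun n : ℕ => Real.log n / n) =o[Filter.atTop] p) →
      Filter.Tendsto
        (fun n : ℕ => SBM.law n αstar Qstar (p n)
          {ω | (∃ zvar : SBM.Labels n k, SBM.IsVarLabels 𝒜 𝒬 ω.2.1 ω.2.2 zvar) ∧
            (∃ (Qml : SBM.SymMat k) (zml : SBM.Labels n k), SBM.IsMLE 𝒬 ω.2.1 ω.2.2 Qml zml) ∧
            ∀ (zvar zml : SBM.Labels n k) (Qml : SBM.SymMat k),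
              SBM.IsVarLabels 𝒜 𝒬 ω.2.1 ω.2.2 zvar → SBM.IsMLE 𝒬 ω.2.1 ω.2.2 Qml zml →
                SBM.LabelEquiv zvar zml})
        Filter.atTop (nhds 1) ∧
      Filter.Tendsto
        (fun n : ℕ => SBM.law n αstar Qstar (p n)
          {ω | ∀ zvar : SBM.Labels n k, SBM.IsVarLabels 𝒜 𝒬 ω.2.1 ω.2.2 zvar →
            SBM.frobSq (SBM.connection Qstar.1 ω.1 -
                SBM.connection (SBM.blockMean ω.2.1 ω.2.2 zvar) zvar) ≤
              C * ((k : ℝ) ^ 2 + n * Real.log k) / p n})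
        Filter.atTop (nhds 1) := by
  refine ⟨1, one_pos, fun α 𝒜 𝒬 hB hI hD p hp ho => ?_⟩
  obtain ⟨c, hc, l, hl, hA, h𝒬⟩ := hB.exists_boxes
  have hαm : α ∈ 𝒜 := interior_subset hI.1
  have hQm : Qstar ∈ 𝒬 := interior_subset hI.2
  have hk : 2 ≤ k := SBM.two_le_of_prob_lt_one α fun a => by linarith [(hA α hαm a).2]
  have hk0 : (0 : ℝ) < k := by exact_mod_cast (by omega : 0 < k)
  let a₀ : Fin k := ⟨0, by omega⟩
  have hc1 : c ≤ 1 := by linarith [(hA α hαm a₀).1, (hA α hαm a₀).2]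
  have hl1 : l ≤ 1 := by linarith [(h𝒬 hQm a₀ a₀).1, (h𝒬 hQm a₀ a₀).2]
  have h𝒜 : 𝒜 ⊆ SBM.simplexBox k c := fun β hβ a => (hA β hβ a).1
  have hQ01 : ∀ a b, Qstar.1 a b ∈ Set.Icc (0 : ℝ) 1 := fun a b =>
    ⟨hl.le.trans (h𝒬 hQm a b).1, (h𝒬 hQm a b).2.trans (by linarith)⟩
  obtain ⟨γ, hγ, hgap⟩ := hD.exists_gap
  obtain ⟨r₁, hr₁, hrA⟩ := SBM.exists_radius_simplex hI.1
  obtain ⟨r₂, hr₂, hrQ⟩ := SBM.exists_radius_symMat hI.2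
  -- Half of the smaller radius is given to `δ`; with `ε ≤ δ`, the estimated frequencies, off by at
  -- most `δ + ε`, remain within the radius.
  obtain ⟨ε, hε, hε1, hεδ, hεc, c₂, hc₂, hsep⟩ := SBM.exists_separation k
    (δ := min r₁ r₂ / 2) (K := k - Real.log c) hk0 hl hl1 hc hγ (half_pos (lt_min hr₁ hr₂))
  -- On the good event communities have at least `(c / 2) n` nodes, so `c / 2` plays the role of `c`
  -- in the bound for the block means.
  have hκ : 0 < (c / 2) ^ 2 / 96 := by positivity
  have hp0 := fun n => (hp n).1
  have hlim := SBM.tendsto_mul_atTop ho hp0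
  have hlim' := (SBM.tendsto_mul_exp_neg ho hp0 (half_pos hc₂)).const_mul (k : ℝ)
  rw [mul_zero] at hlim'
  have hnat := tendsto_natCast_atTop_atTop (R := ℝ)
  have hmain : ∀ᶠ n : ℕ in Filter.atTop, 0 < n ∧ 1 ≤ n * p n ∧ 2 ≤ (c / 2) ^ 2 * n ∧
      1 - Real.log c ≤ c₂ * (n * p n) / 4 ∧ 1 ≤ c₂ * (n * p n) / 4 ∧
      n * (k * Real.exp (-(c₂ * (n * p n) / 2))) < 1 / 2 ∧
      SBM.Regime l c γ ε (k - Real.log c) n α Qstar (p n)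
        ((c / 2) ^ 2 / 96 * Real.sqrt (n ^ 3 * p n)) := by
    filter_upwards [Filter.eventually_gt_atTop 0, hlim.eventually_ge_atTop 1,
      hnat.eventually_ge_atTop (2 / (c / 2) ^ 2),
      hlim.eventually_ge_atTop (4 * (1 - Real.log c) / c₂), hlim.eventually_ge_atTop (4 / c₂),
      hlim'.eventually_lt_const one_half_pos,
      hlim.eventually_ge_atTop (1 / (ε / ((c / 2) ^ 2 / 96)) ^ 2),
      hlim.eventually_ge_atTop ((k - Real.log c) / ε), hnat.eventually_ge_atTop (1 / ε)]
      with n h0 h1 h2 h3 h4 h5 h6 h7 h8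
    have hn : (0 : ℝ) < n := by exact_mod_cast h0
    have hpn : 0 < p n := pos_of_mul_pos_right (one_pos.trans_le h1) hn.le
    rw [div_le_iff₀' (by positivity)] at h2 h3 h4 h6 h7 h8
    refine ⟨h0, h1, h2, by linarith, by linarith, ?_, fun a => (hA α hαm a).1, h𝒬 hQm, hgap, hpn,
      hn, ?_, h7, h8⟩
    · rw [show c₂ * (n * p n) / 2 = c₂ / 2 * (n * p n) by ring]
      linarith
    · have h9 := SBM.sqrt_pow_mul_le hn hpn (div_pos hε hκ) h6
      have h10 := mul_le_mul_of_nonneg_left h9 hκ.le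
      refine h10.trans (le_of_eq ?_)
      field_simp
  have hδr : min r₁ r₂ / 2 + ε ≤ min r₁ r₂ := by linarith
  constructor
  · refine SBM.tendsto_law_of_goodEvent α Qstar p ε _ hQ01 hp ho hε hε1 hκ _ ?_
    filter_upwards [hmain] with n ⟨h0, _, _, h3, h4, h5, hR⟩ ω hG
    obtain ⟨g1, g2, g3, g4⟩ := hG.conclusion hl hc hc1 hc₂ h0 (hsep hR hG) hR hδr hε.le h3 h4 h5
      h𝒜 h𝒬 hαm hQm (fun β hβ => hrA β fun a => (hβ a).trans (min_le_left _ _))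
      (fun R hR => hrQ R fun a b => (hR a b).trans (min_le_right _ _))
    refine ⟨g1, g2, fun zvar zml Qml hv hm => ?_⟩
    obtain ⟨σ, hσ⟩ := g3 zvar hv
    obtain ⟨σ', hσ'⟩ := g4 Qml zml hm
    -- Both label estimates are relabellings of the true labels, so they are compared through them.
    exact ⟨σ'.symm.trans σ, fun i => by simp [hσ, hσ']⟩
  · refine SBM.tendsto_law_of_goodEvent α Qstar p ε _ hQ01 hp ho hε hε1 hκ _ ?_
    filter_upwards [hmain] with n ⟨h0, h1, h2, h3, h4, h5, hR⟩ ω hG zvar hv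
    obtain ⟨-, -, g3, -⟩ := hG.conclusion hl hc hc1 hc₂ h0 (hsep hR hG) hR hδr hε.le h3 h4 h5
      h𝒜 h𝒬 hαm hQm (fun β hβ => hrA β fun a => (hβ a).trans (min_le_left _ _))
      (fun R hR => hrQ R fun a b => (hR a b).trans (min_le_right _ _))
    obtain ⟨σ, hσ⟩ := g3 zvar hv
    exact hG.frobSq_blockMean_le hQ01 (half_pos hc) hR.rate_pos hR.size_pos hk
      (hG.le_sum_ind hR.le_prob hεc) h2 h1 hσ
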